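/- Let $L\ge 1$, $E\ge 0$, $K=L+E$, $N=L(L+1)/2+LE$, and let $d\in\mathbb C\setminus\mathbb Z$. Momenta are real linear combinations of $l_1,\dots,l_L$ (loop momenta) and $p_1,\dots,p_E$ (independent external momenta). Let $M$ be the symmetric matrix of scalar products of $(l_1,\dots,l_L,p_1,\dots,p_E)$, with independent entries. For a space $W$ of momenta let $G(W)$ be the Gram determinant of a basis of $W$; it is a polynomial in the entries of $M$, determined up to a positive constant. An integral family consists of $N$ Baikov variables $x_1,\dots,x_N$, each a real linear combination of the scalar products involving loop momenta plus a term independent of the loop momenta, with linearly independent linear parts, together with a subset of them, the propagators of the top sector. A sector is a subset of these propagators; the other variables are ISPs (irreducible scalar products) for this sector, and they may be replaced by other variables that form, with the propagators of the sector, an affine coordinate system equivalent to the present one. A representation is given by a formal product $\prod_W G(W)^{\rho(W)}$ (powers of the same polynomial are added) and a set of variables. Consider the tree whose root is the top sector with all $N$ variables and the standard Baikov representation $G(p_1,\dots,p_E)^{-(d-E-1)/2}\,G(l_1,\dots,l_L,p_1,\dots,p_E)^{(d-K-1)/2}$, and whose nodes are obtained by finitely many steps of the following kinds: choose other ISPs;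 pass to a subsector by pinching propagators (which become ISPs); integrate out a quadratic ISP $z$. Here $z$ is quadratic if it appears in exactly one of the polynomials, $P=G(W)$, and $P=-(Az^2+Bz+C)$ with $A>0$ when $M$ is positive definite, so that $P\ge 0$ between its roots; the other variables are fixed when $z$ varies. 1. (Each step.) For every node of the tree and every quadratic ISP $z$ at this node, $W$ has a basis $e_1,\dots,e_n$, $n\ge 2$, whose Gram matrix $\tilde M$ contains $z$ only in the entries $(1,n)$ and $(n,1)$, with coefficient $1$. For every such basis, with $X=2\dots n-1$, $\det\tilde M=-(Az^2+Bz+C)$ with $A=\tilde M_{X,X}$ and $B^2-4AC=4\,\tilde M_{1X,1X}\tilde M_{Xn,Xn}$. Integrating out $z$ replaces $P^{\gamma}$ by $\tilde M_{X,X}^{-1-\gamma}\,\tilde M_{1X,1X}^{\gamma+1/2}\,\tilde M_{Xn,Xn}^{\gamma+1/2}$ and removes $z$ from the variables. If $\operatorname{Re}\gamma>-1$, there is a constant $\kappa\neq0$ such that, for all positive definite $M$ and all integers $k\ge 0$, the integral of $z^k$ times the old product of powers between the roots $c_1<c_2$ of $P$ is $\kappa$ times the new product of powers times $$\Big(\frac{c_1+c_2}{2}\Big)^{k}\,{}_2F_1\Big(-\frac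 k2,\frac{1-k}2;\frac32+\gamma;\Big(\frac{c_1-c_2}{c_1+c_2}\Big)^2\Big)$$ (where $c_1+c_2\ne0$ if $k>0$; for $k=0$ the last factor is $1$). 2. (All loop-by-loop representations are reached.) Let $S$ be any sector. Consider any loop-by-loop change of variables for $S$: loop momenta $\ell_1,\dots,\ell_L$ (which together with the $p_j$ form a basis of the space of momenta), treated in this order, and for each $i$ a space $V_i\subseteq\operatorname{span}(\ell_{i+1},\dots,\ell_L,p_1,\dots,p_E)$ of dimension $E_i$, the external momenta of the $i$-th loop, such that (a) each propagator of $S$ is, up to a term independent of the loop momenta, a linear combination of scalar products of momenta in $C_i=\operatorname{span}(\ell_i)+V_i$ for some $i$, and (b) whenever $j<i$ and $V_j\subseteq \operatorname{span}(\ell_i,\dots,\ell_L,p_1,\dots,p_E)$ but $V_j\not\subseteq \operatorname{span}(\ell_{i+1},\dots,\ell_L,p_1,\dots,p_E)$, one has $V_j\subseteq C_i$. Then the loop-by-loop Baikov representation $$\prod_{i=1}^L G(C_i)^{(d-E_i-2)/2}\,G(V_i)^{-(d-E_i-1)/2}$$ is the representation at some node of the tree with sector $S$. This node has $\sum_i(E_i+1)$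 variables, and all of them are, up to terms independent of the loop momenta, linear combinations of scalar products within the spaces $C_1,\dots,C_L$. 3. (Number of polynomials.) At every node of the tree, at most $2L-1$ Gram polynomials $G(W)$ with $W\not\subseteq\operatorname{span}(p_1,\dots,p_E)$ appear with non-zero power. -/

import Mathlib

open scoped Matrix

noncomputable section

namespace Baikov

/-- Momenta are formal real combinations of the `L` loop momenta `l_i` (left summand) and the `E`
independent external momenta `p_j` (right summand), given by their coefficient vectors. -/
abbrev Mom (L E : ℕ) : Type := Fin L ⊕ Fin E → ℝ

/-- Matrices of scalar products `q_i · q_j` of `(q_1, …, q_K) = (l_1, …, l_L, p_1, …, p_E)`,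
`K = L + E`. -/
abbrev GramMat (L E : ℕ) : Type := Matrix (Fin L ⊕ Fin E) (Fin L ⊕ Fin E) ℝ

/-- The span of the external momenta. -/
def ext (L E : ℕ) : Submodule ℝ (Mom L E) where
  carrier := {q | ∀ i, q (Sum.inl i) = 0}
  add_mem' := by
    intro a b ha hb i
    simp [ha i, hb i]
  zero_mem' := by
    intro i
    rfl
  smul_mem' := by
    intro c a ha i
    simp [ha i]

/-- The directions in which the matrix of scalar products can move when the loop momenta vary and
the external momenta are kept: symmetric matrices whose external-external block vanishes. This is a
space of dimension `L (L + 1) / 2 + L E`. -/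
def Dir (L E : ℕ) : Submodule ℝ (GramMat L E) where
  carrier := {δ | δ.IsSymm ∧ ∀ i j, δ (Sum.inr i) (Sum.inr j) = 0}
  add_mem' := by
    rintro a b ⟨ha, ha'⟩ ⟨hb, hb'⟩
    exact ⟨ha.add hb, fun i j => by simp [ha' i j, hb' i j]⟩
  zero_mem' := ⟨Matrix.isSymm_zero, fun _ _ => rfl⟩
  smul_mem' := by
    rintro c a ⟨ha, ha'⟩
    exact ⟨ha.smul c, fun i j => by simp [ha' i j]⟩

/-- The scalar product of two momenta, given the matrix `M` of basic scalar products. -/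
def sp {L E : ℕ} (M : GramMat L E) (v w : Mom L E) : ℝ := v ⬝ᵥ M *ᵥ w

/-- The Gram determinant `G(v_1, …, v_n)` as a polynomial in the entries of `M`. -/
def gramDet {L E n : ℕ} (v : Fin n → Mom L E) (M : GramMat L E) : ℝ :=
  (Matrix.of fun i j => sp M (v i) (v j)).det

/-- Gram determinants of two systems of momenta related by a linear substitution differ by the
square of its determinant; so, up to a non-zero constant, the Gram determinant of a linearly
independent system depends only on its span. -/
theorem gramDet_substitution {L E n : ℕ} (v w : Fin n → Mom L E) (T : Matrix (Fin n) (Fin n) ℝ)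
    (h : ∀ i, w i = ∑ j, T i j • v j) (M : GramMat L E) :
    gramDet w M = T.det ^ 2 * gramDet v M := by
  have key : (Matrix.of fun i j => sp M (w i) (w j))
      = T * (Matrix.of fun i j => sp M (v i) (v j)) * Tᵀ := by
    ext i j
    simp only [Matrix.of_apply, Matrix.mul_apply, Matrix.transpose_apply, sp, h,
      sum_dotProduct, Matrix.mulVec_sum, dotProduct_sum, Matrix.mulVec_smul, smul_dotProduct,
      dotProduct_smul, smul_eq_mul, Finset.sum_mul, Finset.mul_sum]
    refine Finset.sum_congr rfl fun a _ => Finset.sum_congr rfl fun b _ => ?_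
    ring
  unfold gramDet
  rw [key, Matrix.det_mul, Matrix.det_mul, Matrix.det_transpose]
  ring

/-- The Gram polynomial of a space of momenta `W`: the Gram determinant of a basis of `W`. -/
def gram {L E : ℕ} (W : Submodule ℝ (Mom L E)) (M : GramMat L E) : ℝ :=
  gramDet (fun i => (Module.finBasis ℝ W i : Mom L E)) M

/-- An integral family: `N = L (L + 1) / 2 + L E` Baikov variables `x_a`, each an affine function of
the scalar products involving loop momenta, which together are equivalent to these scalar products.
`x a` is the linear part of the `a`-th variable: `x a δ` is the change of this variable when the
scalar products change by `δ` (the loop-independent term `f_a` drops out). The `x_a` with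
`a ∈ top` are the propagators of the top sector, the others are its ISPs. -/
structure IntegralFamily (L E : ℕ) where
  x : Fin (L * (L + 1) / 2 + L * E) → Module.Dual ℝ (Dir L E)
  indep : LinearIndependent ℝ x
  top : Finset (Fin (L * (L + 1) / 2 + L * E))

/-- The polynomials and powers of a Baikov representation all of whose Baikov polynomials are Gram
determinants: `ρ W` is the power of the Gram polynomial of `W`. Gram polynomials of spaces
`W ≤ ext L E` do not depend on the loop momenta: they are part of the kinematic prefactor. -/
abbrev Rep (L E : ℕ) : Type := Submodule ℝ (Mom L E) →₀ ℂ

/-- The product of the powers of Gram polynomials in a representation. -/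
def integrand {L E : ℕ} (ρ : Rep L E) (M : GramMat L E) : ℂ :=
  ρ.prod fun W γ => ((gram W M : ℝ) : ℂ) ^ γ

/-- The standard representation
`G(p_1, …, p_E) ^ (-(d - E - 1) / 2) * G(l_1, …, l_L, p_1, …, p_E) ^ ((d - K - 1) / 2)`. -/
def standardRep (L E : ℕ) (d : ℂ) : Rep L E :=
  Finsupp.single ⊤ ((d - (L + E) - 1) / 2) + Finsupp.single (ext L E) (-(d - E - 1) / 2)

/-- A node of the tree: a sector (the set of its propagators), the (linear parts of the) Baikov
variables that have not been integrated out, and the representation. -/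
structure Node (L E : ℕ) where
  sector : Finset (Fin (L * (L + 1) / 2 + L * E))
  vars : Finset (Module.Dual ℝ (Dir L E))
  rep : Rep L E

open Classical in
/-- The root of the tree: the top sector, in its standard representation, with all `N` variables. -/
def root {L E : ℕ} (F : IntegralFamily L E) (d : ℂ) : Node L E where
  sector := F.top
  vars := Finset.univ.image F.x
  rep := standardRep L E d

/-- The direction `δ` in which the variable `z` grows at unit speed while the other variables of
`vars` are fixed. -/
def IsDualDirection {L E : ℕ} (vars : Finset (Module.Dual ℝ (Dir L E)))
    (z : Module.Dual ℝ (Dir L E)) (δ : Dir L E) : Prop :=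
  z δ = 1 ∧ ∀ y ∈ vars, y ≠ z → y δ = 0

/-- The variable with direction `δ` is quadratic in the Gram polynomial of `W`, which has the form
`-(A z ^ 2 + B z + C)`. The region where it is non-negative is the interval between its roots
(`0 < A`), for scalar products of Euclidean momenta in general position. -/
def IsQuadratic {L E : ℕ} (δ : GramMat L E) (W : Submodule ℝ (Mom L E)) : Prop :=
  ∀ M : GramMat L E, M.PosDef → ∃ A B C : ℝ, 0 < A ∧
    ∀ t : ℝ, gram W (M + t • δ) = -(A * t ^ 2 + B * t + C)

/-- The variable with direction `δ` does not appear in the Gram polynomial of `W`. -/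
def IsAbsent {L E : ℕ} (δ : GramMat L E) (W : Submodule ℝ (Mom L E)) : Prop :=
  ∀ M : GramMat L E, M.IsSymm → ∀ t : ℝ, gram W (M + t • δ) = gram W M

/-- `e = (e_1, …, e_n)`, `n = m + 2`, is a basis of `W` whose Gram matrix contains the variable with
direction `δ` only in the entries `(1, n)` and `(n, 1)`, with coefficient `1`. -/
def IsCornerFrame {L E m : ℕ} (δ : GramMat L E) (W : Submodule ℝ (Mom L E))
    (e : Fin (m + 2) → Mom L E) : Prop :=
  LinearIndependent ℝ e ∧ Submodule.span ℝ (Set.range e) = W ∧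
    ∀ i j, sp δ (e i) (e j) =
      if (i = 0 ∧ j = Fin.last (m + 1)) ∨ (i = Fin.last (m + 1) ∧ j = 0) then 1 else 0

/-- The momenta `e_2, …, e_{n-1}`, belonging to the minor `M_{X,X}`. -/
def frameX {L E m : ℕ} (e : Fin (m + 2) → Mom L E) : Fin m → Mom L E :=
  fun i => e i.castSucc.succ

/-- The momenta `e_1, …, e_{n-1}`, belonging to the minor `M_{1X,1X}`. -/
def frame1X {L E m : ℕ} (e : Fin (m + 2) → Mom L E) : Fin (m + 1) → Mom L E :=
  fun i => e i.castSucc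

/-- The momenta `e_2, …, e_n`, belonging to the minor `M_{Xn,Xn}`. -/
def frameXn {L E m : ℕ} (e : Fin (m + 2) → Mom L E) : Fin (m + 1) → Mom L E :=
  fun i => e i.succ

/-- Replacing `M_{1Xn,1Xn} ^ γ` by
`M_{X,X} ^ (-1 - γ) * M_{1X,1X} ^ (γ + 1/2) * M_{Xn,Xn} ^ (γ + 1/2)` in a representation. Powers of
the same polynomial are added, and a polynomial whose power becomes `0` drops out. -/
def replaceGram {L E m : ℕ} (ρ : Rep L E) (W : Submodule ℝ (Mom L E))
    (e : Fin (m + 2) → Mom L E) : Rep L E :=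
  ρ.erase W
    + Finsupp.single (Submodule.span ℝ (Set.range (frameX e))) (-1 - ρ W)
    + Finsupp.single (Submodule.span ℝ (Set.range (frame1X e))) (ρ W + 1 / 2)
    + Finsupp.single (Submodule.span ℝ (Set.range (frameXn e))) (ρ W + 1 / 2)

open Classical in
/-- The edges of the tree. One may choose other ISPs for the current sector, as affine
functions of the current variables; go to a subsector by pinching propagators, which become ISPs;
or integrate out an ISP that is quadratic in one Baikov polynomial and absent from the others. -/
inductive Step {L E : ℕ} (F : IntegralFamily L E) : Node L E → Node L E → Prop
  | redefine (ν : Node L E) (vars' : Finset (Module.Dual ℝ (Dir L E)))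
      (props : ∀ a ∈ ν.sector, F.x a ∈ vars')
      (indep : LinearIndepOn ℝ id (vars' : Set (Module.Dual ℝ (Dir L E))))
      (span_eq : Submodule.span ℝ (vars' : Set (Module.Dual ℝ (Dir L E)))
        = Submodule.span ℝ (ν.vars : Set (Module.Dual ℝ (Dir L E)))) :
      Step F ν ⟨ν.sector, vars', ν.rep⟩
  | pinch (ν : Node L E) (S : Finset (Fin (L * (L + 1) / 2 + L * E))) (sub : S ⊆ ν.sector) :
      Step F ν ⟨S, ν.vars, ν.rep⟩
  | integrate (ν : Node L E) (z : Module.Dual ℝ (Dir L E)) (mem : z ∈ ν.vars)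
      (isp : ∀ a ∈ ν.sector, F.x a ≠ z)
      (δ : Dir L E) (dual : IsDualDirection ν.vars z δ)
      (W : Submodule ℝ (Mom L E)) (poly : W ∈ ν.rep.support)
      (quadratic : IsQuadratic (δ : GramMat L E) W)
      (absent : ∀ W' ∈ ν.rep.support, W' ≠ W → IsAbsent (δ : GramMat L E) W')
      (m : ℕ) (e : Fin (m + 2) → Mom L E) (frame : IsCornerFrame (δ : GramMat L E) W e) :
      Step F ν ⟨ν.sector, ν.vars.erase z, replaceGram ν.rep W e⟩

/-- The nodes of the tree: what is reached from the root by finitely many steps. -/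
def Reachable {L E : ℕ} (F : IntegralFamily L E) (d : ℂ) (ν : Node L E) : Prop :=
  Relation.ReflTransGen (Step F) (root F d) ν

/-- The change `δ` of the scalar products does not affect scalar products of momenta in `W`. -/
def VanishesOn {L E : ℕ} (δ : GramMat L E) (W : Submodule ℝ (Mom L E)) : Prop :=
  ∀ v ∈ W, ∀ w ∈ W, sp δ v w = 0

/-- Data of a loop-by-loop change of variables for the sector with propagators `S`.

The loop momenta `l 0, l 1, …` are traded for Baikov variables one at a time, in this order. When
`l i` is treated, `l j` with `j > i` and the `p_j` are external momenta; the integrand depends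
on `l i` only through `(l i) ^ 2` and the scalar products of `l i` with the momenta in a space
`V i`, of dimension `E_i`, of such external momenta. That loop then contributes the one-loop Baikov
factor `G(l_i, V_i) ^ ((d - E_i - 2) / 2) * G(V_i) ^ (-(d - E_i - 1) / 2)`, whose Gram determinants
depend on the momenta not yet treated through the scalar products of momenta in `V i`. -/
structure LoopByLoop {L E : ℕ} (F : IntegralFamily L E)
    (S : Finset (Fin (L * (L + 1) / 2 + L * E))) where
  /-- the loop momenta -/
  l : Fin L → Mom L E
  /-- the external momenta of the successive loops -/
  V : Fin L → Submodule ℝ (Mom L E)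
  /-- the loop and external momenta together span all momenta -/
  span_eq : ext L E ⊔ Submodule.span ℝ (Set.range l) = ⊤
  /-- the external momenta of a loop do not involve that loop momentum or earlier ones -/
  V_le : ∀ i, V i ≤ ext L E ⊔ Submodule.span ℝ (l '' {k | i < k})
  /-- the Gram determinants left by an earlier loop `j` whose first dependence on a
  remaining loop momentum is on `l i` involve only scalar products available to loop `i` -/
  seen : ∀ j i, j < i → V j ≤ ext L E ⊔ Submodule.span ℝ (l '' {k | i ≤ k}) →
    ¬ V j ≤ ext L E ⊔ Submodule.span ℝ (l '' {k | i < k}) → V j ≤ Submodule.span ℝ {l i} ⊔ V i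
  /-- every propagator of the sector is a function of the scalar products available to one of
  the loops -/
  props : ∀ a ∈ S, ∃ i, ∀ δ : Dir L E,
    VanishesOn (δ : GramMat L E) (Submodule.span ℝ {l i} ⊔ V i) → F.x a δ = 0

/-- The span of the loop momentum of the `i`-th loop and its external momenta. -/
def LoopByLoop.block {L E : ℕ} {F : IntegralFamily L E}
    {S : Finset (Fin (L * (L + 1) / 2 + L * E))} (Λ : LoopByLoop F S) (i : Fin L) :
    Submodule ℝ (Mom L E) :=
  Submodule.span ℝ {Λ.l i} ⊔ Λ.V i

/-- The number `E_i` of independent external momenta of the `i`-th loop. -/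
def LoopByLoop.numExt {L E : ℕ} {F : IntegralFamily L E}
    {S : Finset (Fin (L * (L + 1) / 2 + L * E))} (Λ : LoopByLoop F S) (i : Fin L) : ℕ :=
  Module.finrank ℝ (Λ.V i)

/-- The loop-by-loop Baikov representation
`∏ i, G(l_i, V_i) ^ ((d - E_i - 2) / 2) * G(V_i) ^ (-(d - E_i - 1) / 2)`. -/
def LoopByLoop.rep {L E : ℕ} {F : IntegralFamily L E}
    {S : Finset (Fin (L * (L + 1) / 2 + L * E))} (Λ : LoopByLoop F S) (d : ℂ) : Rep L E :=
  ∑ i, (Finsupp.single (Λ.block i) ((d - Λ.numExt i - 2) / 2)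
    + Finsupp.single (Λ.V i) (-(d - Λ.numExt i - 1) / 2))

end Baikov

end

/-! A variable `z` enters only through its direction `δ`, a symmetric bilinear form on momenta, and
everything follows from the geometry of `δ` on the spaces `W`.

Each step. Diagonalize `δ` on `W`, with values `c i`, and let `M` make the same basis orthonormal:
the Gram determinant at `M + t • δ` is then a positive multiple of `∏ (1 + t * c i)`. Absence of `z`
forces all `c i = 0`, that is, `δ` vanishes on `W`. A quadratic with `A > 0` forces exactly two
non-zero `c i`, of opposite signs, so `W` is a hyperbolic plane plus the radical of `δ`; two
isotropic vectors of the plane are the ends of the corner frame and the radical is the span of `X`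
(`IsQuadratic.exists_cornerFrame`). The Schur complement of `X` gives the leading coefficient and
the discriminant. Rescaling the integration interval turns the integral into moments of a symmetric
beta distribution, whose recurrence is that of the hypergeometric coefficients
(`integral_quadratic_cpow`, `IsCornerFrame.integral_eq`).

Loop-by-loop representations. With maximal `V i` the product telescopes to the standard
representation. Starting there, the `V i` are shrunk one dimension at a time, for `i` in increasing
order. Removing `u` from `V i` means integrating out the scalar product of `l i` with `u`; the
direction is the symmetrized product of a functional `φ` detecting `l i` and a functional `ψ`
detecting `u`, chosen so that every other block lies in the kernel of one of them
(`LoopByLoop.exists_functionals`, which rests on condition (b)). The step then changes the factors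
of loop `i` exactly as required (`LoopByLoop.Reached.shrink`).

Number of polynomials. At every node the power of `G(W)` is an integer `k W` times `(d - dim W - 1)
/ 2`, and this factor is non-zero because `d` is not an integer. A step replaces `W` in `k` by its
two isotropic hyperplanes minus their intersection. This preserves `IsTreeLike`: `k` is a sum of
differences over strictly nested pairs of spaces, and its total dimension is `L`. Hence at most `L`
pairs, so at most `2 * L` spaces, occur, and one second component consists of external momenta
(`IsTreeLike.ncard_le`). -/

noncomputable section
namespace Baikov

variable {L E : ℕ}

/-! ### Scalar products and Gram determinants -/

theorem sp_eq_toBilin' (M : GramMat L E) (v w : Mom L E) : sp M v w = Matrix.toBilin' M v w :=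
  (Matrix.toBilin'_apply' M v w).symm

theorem sp_comm {M : GramMat L E} (hM : M.IsSymm) (v w : Mom L E) : sp M v w = sp M w v := by
  unfold sp
  rw [Matrix.dotProduct_mulVec, ← Matrix.mulVec_transpose, hM.eq, dotProduct_comm]

theorem sp_add_left (M : GramMat L E) (u v w : Mom L E) : sp M (u + v) w = sp M u w + sp M v w := by
  simp [sp_eq_toBilin']

theorem sp_add_right (M : GramMat L E) (u v w : Mom L E) :
    sp M u (v + w) = sp M u v + sp M u w := by
  simp [sp_eq_toBilin']

theorem sp_sub_left (M : GramMat L E) (u v w : Mom L E) : sp M (u - v) w = sp M u w - sp M v w := by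
  simp [sp_eq_toBilin']

theorem sp_smul_left (M : GramMat L E) (c : ℝ) (v w : Mom L E) :
    sp M (c • v) w = c * sp M v w := by
  simp [sp_eq_toBilin']

theorem sp_smul_right (M : GramMat L E) (c : ℝ) (v w : Mom L E) :
    sp M v (c • w) = c * sp M v w := by
  simp [sp_eq_toBilin']

theorem sp_zero_left (M : GramMat L E) (w : Mom L E) : sp M 0 w = 0 := by
  simp [sp_eq_toBilin']

theorem sp_add_smul (M δ : GramMat L E) (t : ℝ) (v w : Mom L E) :
    sp (M + t • δ) v w = sp M v w + t * sp δ v w := by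
  simp [sp, Matrix.add_mulVec, Matrix.smul_mulVec]

theorem gramDet_pos {n : ℕ} {v : Fin n → Mom L E} (hv : LinearIndependent ℝ v)
    {M : GramMat L E} (hM : M.PosDef) : 0 < gramDet v M := by
  have key : (Matrix.of fun i j => sp M (v i) (v j))
      = (Matrix.of fun p i => v i p)ᴴ * M * (Matrix.of fun p i => v i p) := by
    ext i j
    simp only [Matrix.of_apply, sp, Matrix.mul_assoc]
    rw [Matrix.mul_apply]
    rfl
  have h := Matrix.PosDef.conjTranspose_mul_mul_same hM (B := Matrix.of fun p i => v i p) ?_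
  · rw [← key] at h
    exact h.det_pos
  · exact Matrix.mulVec_injective_iff.2 hv

/-- The constant is the squared determinant of the change of basis. It transfers identities for a
convenient basis to `gram`, which is tied to `Module.finBasis`. -/
theorem exists_gram_eq {n : ℕ} {e : Fin n → Mom L E} (he : LinearIndependent ℝ e)
    {W : Submodule ℝ (Mom L E)} (hW : Submodule.span ℝ (Set.range e) = W) :
    ∃ c : ℝ, 0 < c ∧ ∀ M, gram W M = c * gramDet e M := by
  subst hW
  have hn : n = Module.finrank ℝ (Submodule.span ℝ (Set.range e)) := by
    rw [finrank_span_eq_card he, Fintype.card_fin]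
  set b := Module.finBasis ℝ (Submodule.span ℝ (Set.range e)) with hb
  let b' := (Module.Basis.span he).reindex (finCongr hn)
  have hs : ∀ i, (b i : Mom L E)
      = ∑ j, (b'.toMatrix b)ᵀ i j • ((b' j : Submodule.span ℝ (Set.range e)) : Mom L E) := by
    intro i
    have h := congrArg Subtype.val (b'.sum_repr (b i))
    simp only [Submodule.coe_sum, Submodule.coe_smul] at h
    rw [← h]
    rfl
  have hdet : (b'.toMatrix b)ᵀ.det ≠ 0 := by
    rw [Matrix.det_transpose]
    have := b'.invertibleToMatrix b
    exact (Matrix.isUnit_det_of_invertible _).ne_zero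
  refine ⟨(b'.toMatrix b)ᵀ.det ^ 2, by positivity, fun M => ?_⟩
  have h := gramDet_substitution (fun j => ((b' j : Submodule.span ℝ (Set.range e)) : Mom L E))
    (fun i => (b i : Mom L E)) _ hs M
  rw [gram, h]
  congr 1
  unfold gramDet
  rw [← Matrix.det_submatrix_equiv_self (finCongr hn)]
  congr 1
  ext i j
  simp [b', Module.Basis.span_apply]

theorem gram_pos (W : Submodule ℝ (Mom L E)) {M : GramMat L E} (hM : M.PosDef) :
    0 < gram W M :=
  gramDet_pos ((Module.finBasis ℝ W).linearIndependent.map' W.subtype W.ker_subtype) hM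

theorem gram_congr {W : Submodule ℝ (Mom L E)} {M M' : GramMat L E}
    (h : ∀ v ∈ W, ∀ w ∈ W, sp M v w = sp M' v w) : gram W M = gram W M' := by
  unfold gram gramDet
  congr 1
  ext i j
  exact h _ (Submodule.coe_mem _) _ (Submodule.coe_mem _)

theorem VanishesOn.mono {δ : GramMat L E} {U W : Submodule ℝ (Mom L E)} (h : VanishesOn δ W)
    (hU : U ≤ W) : VanishesOn δ U :=
  fun v hv w hw => h v (hU hv) w (hU hw)

theorem VanishesOn.isAbsent {δ : GramMat L E} {W : Submodule ℝ (Mom L E)}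
    (h : VanishesOn δ W) : IsAbsent δ W := fun M _ t =>
  gram_congr fun v hv w hw => by rw [sp_add_smul, h v hv w hw, mul_zero, add_zero]

theorem Dir.isSymm (δ : Dir L E) : (δ : GramMat L E).IsSymm := δ.2.1

theorem Dir.vanishesOn_ext (δ : Dir L E) : VanishesOn (δ : GramMat L E) (ext L E) := by
  intro v hv w hw
  have hv' : ∀ i, v (Sum.inl i) = 0 := hv
  have hw' : ∀ i, w (Sum.inl i) = 0 := hw
  simp [sp, dotProduct, Matrix.mulVec, Fintype.sum_sum_type, hv', hw', δ.2.2]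

/-! ### Simultaneous diagonalization on a space of momenta -/

/-- A basis of a space of momenta is orthonormal for some positive definite matrix of scalar
products. -/
theorem exists_posDef_orthonormal {n : ℕ} {v : Fin n → Mom L E} (hv : LinearIndependent ℝ v) :
    ∃ M : GramMat L E, M.PosDef ∧ ∀ i j, sp M (v i) (v j) = if i = j then 1 else 0 := by
  classical
  let b := Module.Basis.extend hv.linearIndepOn_id
  have : Finite (hv.linearIndepOn_id.extend (Set.subset_univ _)) := Module.Finite.finite_basis b
  let : Fintype (hv.linearIndepOn_id.extend (Set.subset_univ _)) := Fintype.ofFinite _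
  let k : Fin n → hv.linearIndepOn_id.extend (Set.subset_univ _) := fun i =>
    ⟨v i, hv.linearIndepOn_id.subset_extend _ (Set.mem_range_self i)⟩
  let C := LinearMap.toMatrix' b.equivFun.toLinearMap
  have hC : ∀ x, C *ᵥ x = b.equivFun x := fun x => LinearMap.toMatrix'_mulVec _ _
  refine ⟨Cᴴ * C, Matrix.PosDef.conjTranspose_mul_self C ?_, fun i j => ?_⟩
  · intro x y hxy
    simp only [hC] at hxy
    exact b.equivFun.injective hxy
  · have h : ∀ x y, sp (Cᴴ * C) x y = (C *ᵥ x) ⬝ᵥ (C *ᵥ y) := by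
      intro x y
      rw [sp, ← Matrix.mulVec_mulVec, Matrix.dotProduct_mulVec, Matrix.vecMul_conjTranspose]
      simp
    have hb : ∀ i, v i = b (k i) := fun i =>
      (Module.Basis.extend_apply_self hv.linearIndepOn_id (k i)).symm
    have hk : k i = k j ↔ i = j :=
      ⟨fun h => hv.injective (congrArg Subtype.val h), fun h => by rw [h]⟩
    rw [h, hC, hC, hb, hb, Module.Basis.equivFun_apply, Module.Basis.equivFun_apply,
      Module.Basis.repr_self, Module.Basis.repr_self]
    simp [dotProduct, Finsupp.single_apply, eq_comm, hk]

theorem isSymm_restrict {δ : GramMat L E} (hδ : δ.IsSymm) (W : Submodule ℝ (Mom L E)) :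
    LinearMap.IsSymm ((Matrix.toBilin' δ).restrict W) where
  eq x y := by
    have h := sp_comm hδ (x : Mom L E) (y : Mom L E)
    rw [sp_eq_toBilin', sp_eq_toBilin'] at h
    exact h

/-- A `δ`-orthogonal basis of `W` made orthonormal for `M` diagonalizes both forms at once, so the
signature of `δ` on `W` can be read off a polynomial in `t`. -/
theorem exists_diagonal {δ : GramMat L E} (hδ : δ.IsSymm) (W : Submodule ℝ (Mom L E)) :
    ∃ (n : ℕ) (v : Fin n → Mom L E) (c : Fin n → ℝ), LinearIndependent ℝ v ∧
      Submodule.span ℝ (Set.range v) = W ∧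
      (∀ i j, sp δ (v i) (v j) = if i = j then c i else 0) ∧
      ∃ M : GramMat L E, M.PosDef ∧ ∀ t : ℝ, gramDet v (M + t • δ) = ∏ i, (1 + t * c i) := by
  obtain ⟨b, hb⟩ := LinearMap.BilinForm.exists_orthogonal_basis (isSymm_restrict hδ W)
  have hli : LinearIndependent ℝ fun i => (b i : Mom L E) :=
    b.linearIndependent.map' W.subtype W.ker_subtype
  have hδv : ∀ i j, sp δ (b i) (b j) = if i = j then sp δ (b i) (b i) else 0 := by
    intro i j
    split_ifs with h
    · rw [h]
    · rw [sp_eq_toBilin']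
      exact hb h
  obtain ⟨M, hM, hMv⟩ := exists_posDef_orthonormal hli
  refine ⟨_, fun i => b i, fun i => sp δ (b i) (b i), hli, ?_, hδv, M, hM, fun t => ?_⟩
  · have : Set.range (fun i => (b i : Mom L E)) = W.subtype '' Set.range b := by
      rw [← Set.range_comp]; rfl
    rw [this, Submodule.span_image, b.span_eq, Submodule.map_top, Submodule.range_subtype]
  · have : (Matrix.of fun i j => sp (M + t • δ) (b i : Mom L E) (b j))
        = Matrix.diagonal fun i => 1 + t * sp δ (b i) (b i) := by
      ext i j
      rw [Matrix.of_apply, sp_add_smul, hMv, hδv, Matrix.diagonal_apply]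
      split_ifs <;> simp
    rw [gramDet, this, Matrix.det_diagonal]

theorem vanishesOn_of_orthogonal {δ : GramMat L E} {n : ℕ} {v : Fin n → Mom L E}
    (h : ∀ i j, sp δ (v i) (v j) = 0) : VanishesOn δ (Submodule.span ℝ (Set.range v)) := by
  intro x hx y hy
  induction hx, hy using Submodule.span_induction₂ with
  | mem_mem x y hx hy =>
    obtain ⟨i, rfl⟩ := hx
    obtain ⟨j, rfl⟩ := hy
    exact h i j
  | zero_left y _ => simp [sp_eq_toBilin']
  | zero_right y _ => simp [sp_eq_toBilin']
  | add_left x y z _ _ _ h1 h2 => rw [sp_add_left, h1, h2, add_zero]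
  | add_right x y z _ _ _ h1 h2 => rw [sp_add_right, h1, h2, add_zero]
  | smul_left r x y _ _ h => rw [sp_smul_left, h, mul_zero]
  | smul_right r x y _ _ h => rw [sp_smul_right, h, mul_zero]

/-- If some `c i ≠ 0`, the determinant would vanish at `t = -(c i)⁻¹`, while its value at `t = 0` is
positive. -/
theorem IsAbsent.vanishesOn {δ : GramMat L E} (hδ : δ.IsSymm) {W : Submodule ℝ (Mom L E)}
    (h : IsAbsent δ W) : VanishesOn δ W := by
  obtain ⟨n, v, c, hv, hW, hδv, M, hM, hdet⟩ := exists_diagonal hδ W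
  obtain ⟨a, ha, hg⟩ := exists_gram_eq hv hW
  have hc : ∀ i, c i = 0 := by
    intro i
    by_contra hi
    have h1 := h M hM.1 (-(c i)⁻¹)
    rw [hg, hg, hdet, Finset.prod_eq_zero (Finset.mem_univ i) (by field_simp; ring)] at h1
    have := mul_pos ha (gramDet_pos hv hM)
    linarith
  rw [← hW]
  refine vanishesOn_of_orthogonal fun i j => ?_
  rw [hδv, hc]
  simp

/-! ### Corner frames -/

/-- The frame is `a`, a basis of `R`, `b`. It is independent because pairing with `a` separates `b`
from `R`, and pairing with `b` separates `a` from `span {b} ⊔ R`. -/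
theorem exists_cornerFrame {δ : GramMat L E} (hδ : δ.IsSymm) {R : Submodule ℝ (Mom L E)}
    {a b : Mom L E} (haa : sp δ a a = 0) (hbb : sp δ b b = 0) (hab : sp δ a b = 1)
    (hRa : ∀ r ∈ R, sp δ a r = 0) (hRb : ∀ r ∈ R, sp δ b r = 0) (hR : VanishesOn δ R) :
    ∃ (m : ℕ) (e : Fin (m + 2) → Mom L E),
      IsCornerFrame δ (Submodule.span ℝ {a} ⊔ (Submodule.span ℝ {b} ⊔ R)) e ∧
      Submodule.span ℝ (Set.range (frameX e)) = R ∧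
      Submodule.span ℝ (Set.range (frame1X e)) = Submodule.span ℝ {a} ⊔ R ∧
      Submodule.span ℝ (Set.range (frameXn e)) = Submodule.span ℝ {b} ⊔ R := by
  have hba : sp δ b a = 1 := by rw [sp_comm hδ, hab]
  let r : Fin (Module.finrank ℝ R) → Mom L E := fun i => Module.finBasis ℝ R i
  have hr : LinearIndependent ℝ r :=
    (Module.finBasis ℝ R).linearIndependent.map' R.subtype R.ker_subtype
  have hrs : Submodule.span ℝ (Set.range r) = R := by
    have : Set.range r = R.subtype '' Set.range (Module.finBasis ℝ R) := by
      rw [← Set.range_comp]; rfl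
    rw [this, Submodule.span_image, Module.Basis.span_eq, Submodule.map_top,
      Submodule.range_subtype]
  have hrm : ∀ i, r i ∈ R := fun i => Submodule.coe_mem _
  let e : Fin (Module.finrank ℝ R + 2) → Mom L E := Fin.cons a (Fin.snoc r b)
  have e0 : e 0 = a := rfl
  have ei : ∀ i : Fin (Module.finrank ℝ R), e i.castSucc.succ = r i := fun i => by simp [e]
  have el : e (Fin.last _) = b := by
    rw [← Fin.succ_last]
    simp [e]
  have hX : frameX e = r := funext ei
  have h1X : frame1X e = Fin.cons a r := by
    funext i
    refine Fin.cases rfl (fun i => ?_) i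
    rw [frame1X, ← Fin.succ_castSucc, ei, Fin.cons_succ]
  have hXn : frameXn e = Fin.snoc r b := by
    funext i
    simp [frameXn, e]
  have hb : b ∉ R := fun h => by
    have := hRa b h
    rw [hab] at this
    exact one_ne_zero this
  have ha : a ∉ Submodule.span ℝ {b} ⊔ R := by
    intro h
    obtain ⟨y, hy, z, hz, hyz⟩ := Submodule.mem_sup.1 h
    obtain ⟨c, rfl⟩ := Submodule.mem_span_singleton.1 hy
    have h1 : sp δ b a = 0 := by
      rw [← hyz, sp_add_right, sp_smul_right, hbb, hRb z hz, mul_zero, add_zero]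
    rw [hba] at h1
    exact one_ne_zero h1
  have hXns : Submodule.span ℝ (Set.range (Fin.snoc r b : Fin (_ + 1) → Mom L E))
      = Submodule.span ℝ {b} ⊔ R := by
    rw [Fin.range_snoc, Submodule.span_insert, hrs]
  refine ⟨_, e, ⟨?_, ?_, ?_⟩, by rw [hX, hrs], ?_, by rw [hXn, hXns]⟩
  · refine linearIndependent_finCons.2 ⟨linearIndependent_finSnoc.2 ⟨hr, by rwa [hrs]⟩, ?_⟩
    rwa [hXns]
  · have : Set.range e = insert a (Set.range (Fin.snoc r b : Fin (_ + 1) → Mom L E)) :=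
      Fin.range_cons _ _
    rw [this, Submodule.span_insert, hXns]
  · have n1 : ∀ i : Fin (Module.finrank ℝ R), i.castSucc.succ ≠ Fin.last (Module.finrank ℝ R + 1) :=
      fun i h => absurd (congrArg Fin.val h) (by simp; omega)
    have key : ∀ i : Fin (Module.finrank ℝ R + 2), i = 0 ∨ i = Fin.last _ ∨
        ∃ k : Fin (Module.finrank ℝ R), i = k.castSucc.succ := by
      intro i
      refine Fin.cases (Or.inl rfl) (fun i => Or.inr ?_) i
      exact Fin.lastCases (Or.inl (Fin.succ_last _)) (fun i => Or.inr ⟨i, rfl⟩) i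
    have nl : Fin.last (Module.finrank ℝ R + 1) ≠ 0 := Fin.last_pos.ne'
    intro i j
    rcases key i with rfl | rfl | ⟨k, rfl⟩ <;> rcases key j with rfl | rfl | ⟨l, rfl⟩
    · simp [e0, haa, nl.symm]
    · simp [e0, el, hab]
    · simp [e0, ei, hRa _ (hrm l), n1, nl.symm]
    · simp [e0, el, hba]
    · simp [el, hbb, nl]
    · simp [el, ei, hRb _ (hrm l), nl]
    · simp [e0, ei, sp_comm hδ _ a, hRa _ (hrm k), n1]
    · simp [el, ei, sp_comm hδ _ b, hRb _ (hrm k), n1]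
    · simp [ei, hR _ (hrm k) _ (hrm l), n1]
  · rw [h1X, Fin.range_cons, Submodule.span_insert, hrs]

/-- The degree in `t` counts the non-zero `c i`, so there are two of them; the leading coefficient
`-A < 0` makes their product negative. -/
theorem exists_signature_of_prod_eq {n : ℕ} {c : Fin n → ℝ} {a A B C : ℝ} (ha : 0 < a)
    (hA : 0 < A) (h : ∀ t : ℝ, a * ∏ i, (1 + t * c i) = -(A * t ^ 2 + B * t + C)) :
    ∃ i j, 0 < c i ∧ c j < 0 ∧ ∀ k, k ≠ i → k ≠ j → c k = 0 := by
  classical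
  let s := Finset.univ.filter fun i => c i ≠ 0
  have hs : ∀ t : ℝ, ∏ i, (1 + t * c i) = ∏ i ∈ s, (c i * t + 1) := by
    intro t
    rw [Finset.prod_filter]
    refine Finset.prod_congr rfl fun i _ => ?_
    split_ifs with hi
    · ring
    · rw [not_not] at hi
      rw [hi]; ring
  let p : Polynomial ℝ := Polynomial.C a * ∏ i ∈ s, (Polynomial.C (c i) * Polynomial.X + Polynomial.C 1)
  let q : Polynomial ℝ := Polynomial.C (-A) * Polynomial.X ^ 2 + Polynomial.C (-B) * Polynomial.X
    + Polynomial.C (-C)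
  have hpq : p = q := by
    refine Polynomial.funext fun t => ?_
    have := h t
    rw [hs] at this
    simp only [p, q, Polynomial.eval_mul, Polynomial.eval_C, Polynomial.eval_prod,
      Polynomial.eval_add, Polynomial.eval_X, Polynomial.eval_pow]
    rw [this]; ring
  have hsc : ∀ i ∈ s, c i ≠ 0 := fun i hi => (Finset.mem_filter.1 hi).2
  have hdeg : s.card = 2 := by
    have h1 : p.natDegree = s.card := by
      rw [Polynomial.natDegree_C_mul ha.ne', Polynomial.natDegree_prod, Finset.card_eq_sum_ones]
      · exact Finset.sum_congr rfl fun i hi => Polynomial.natDegree_linear (hsc i hi)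
      · intro i hi h0
        have := Polynomial.natDegree_linear (b := (1 : ℝ)) (hsc i hi)
        rw [h0] at this
        simp at this
    rw [← h1, hpq, Polynomial.natDegree_quadratic (neg_ne_zero.2 hA.ne')]
  have hlead : a * ∏ i ∈ s, c i = -A := by
    have h1 : p.leadingCoeff = a * ∏ i ∈ s, c i := by
      rw [Polynomial.leadingCoeff_mul, Polynomial.leadingCoeff_C, Polynomial.leadingCoeff_prod]
      congr 1
      exact Finset.prod_congr rfl fun i hi => Polynomial.leadingCoeff_linear (hsc i hi)
    rw [← h1, hpq, Polynomial.leadingCoeff_quadratic (neg_ne_zero.2 hA.ne')]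
  obtain ⟨i, j, hij, hs2⟩ := Finset.card_eq_two.1 hdeg
  have hz : ∀ k, k ≠ i → k ≠ j → c k = 0 := by
    intro k hi hj
    by_contra hk
    have : k ∈ s := Finset.mem_filter.2 ⟨Finset.mem_univ _, hk⟩
    rw [hs2] at this
    simp [hi, hj] at this
  rw [hs2, Finset.prod_pair hij] at hlead
  have hneg : c i * c j < 0 := by
    by_contra hcon
    have := mul_nonneg ha.le (not_lt.1 hcon)
    linarith
  rcases mul_neg_iff.1 hneg with ⟨h1, h2⟩ | ⟨h1, h2⟩
  · exact ⟨i, j, h1, h2, hz⟩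
  · exact ⟨j, i, h2, h1, fun k hj hi => hz k hi hj⟩

theorem IsQuadratic.exists_cornerFrame {δ : GramMat L E} (hδ : δ.IsSymm)
    {W : Submodule ℝ (Mom L E)} (h : IsQuadratic δ W) :
    ∃ (m : ℕ) (e : Fin (m + 2) → Mom L E), IsCornerFrame δ W e := by
  obtain ⟨n, v, c, hv, hW, hδv, M, hM, hdet⟩ := exists_diagonal hδ W
  obtain ⟨a, ha, hg⟩ := exists_gram_eq hv hW
  obtain ⟨A, B, C, hA, hq⟩ := h M hM
  obtain ⟨i, j, hi, hj, hk⟩ := exists_signature_of_prod_eq ha hA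
    (fun t => by rw [← hdet, ← hg]; exact hq t)
  have hij : i ≠ j := by
    rintro rfl
    exact lt_asymm hi hj
  have hvm : ∀ i, v i ∈ W := fun i => hW ▸ Submodule.subset_span (Set.mem_range_self i)
  -- Normalization of the positive and the negative direction to `δ`-squares `1` and `-1`.
  let f := (√(c i))⁻¹ • v i
  let g := (√(-c j))⁻¹ • v j
  have hff : sp δ f f = 1 := by
    simp only [f, sp_smul_left, sp_smul_right, hδv, if_true]
    have := Real.mul_self_sqrt hi.le
    have h0 := (Real.sqrt_pos.2 hi).ne'
    field_simp
    nlinarith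
  have hgg : sp δ g g = -1 := by
    simp only [g, sp_smul_left, sp_smul_right, hδv, if_true]
    have := Real.mul_self_sqrt (neg_pos.2 hj).le
    have h0 := (Real.sqrt_pos.2 (neg_pos.2 hj)).ne'
    field_simp
    nlinarith
  have hfg : sp δ f g = 0 := by
    simp only [f, g, sp_smul_left, sp_smul_right, hδv, if_neg hij, mul_zero]
  have hgf : sp δ g f = 0 := by rw [sp_comm hδ, hfg]
  -- Light-cone combinations: both are isotropic, and the factor `1 / 2` makes their pairing `1`.
  let x := f + g
  let y := (1 / 2 : ℝ) • (f + (-1 : ℝ) • g)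
  have hxm : x ∈ W := W.add_mem (W.smul_mem _ (hvm i)) (W.smul_mem _ (hvm j))
  have hym : y ∈ W := W.smul_mem _ (W.add_mem (W.smul_mem _ (hvm i))
    (W.smul_mem _ (W.smul_mem _ (hvm j))))
  have hfxy : f = (1 / 2 : ℝ) • x + y := by
    simp only [x, y]; module
  have hgxy : g = (1 / 2 : ℝ) • x + (-1 : ℝ) • y := by
    simp only [x, y]; module
  have hvi : v i = √(c i) • f := by
    simp only [f, smul_smul]
    rw [mul_inv_cancel₀ (Real.sqrt_pos.2 hi).ne', one_smul]
  have hvj : v j = √(-c j) • g := by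
    simp only [g, smul_smul]
    rw [mul_inv_cancel₀ (Real.sqrt_pos.2 (neg_pos.2 hj)).ne', one_smul]
  have hxx : sp δ x x = 0 := by
    simp only [x, sp_add_left, sp_add_right, hff, hgg, hfg, hgf]; ring
  have hyy : sp δ y y = 0 := by
    simp only [y, sp_add_left, sp_add_right, sp_smul_left, sp_smul_right, hff, hgg, hfg, hgf]; ring
  have hxy : sp δ x y = 1 := by
    simp only [x, y, sp_add_left, sp_add_right, sp_smul_right, hff, hgg, hfg, hgf]
    ring
  have hyx : sp δ y x = 1 := by rw [sp_comm hδ, hxy]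
  -- The orthogonal complement of the hyperbolic plane in `W`. It is the radical: its vectors are
  -- orthogonal to `f` and `g`, hence to `v i` and `v j`, and the other `v k` are orthogonal to all
  -- of `W`.
  let R : Submodule ℝ (Mom L E) := W ⊓ (LinearMap.ker (Matrix.toBilin' δ x) ⊓
    LinearMap.ker (Matrix.toBilin' δ y))
  have hmR : ∀ r, r ∈ R ↔ r ∈ W ∧ sp δ x r = 0 ∧ sp δ y r = 0 := by
    intro r
    simp [R, sp_eq_toBilin']
  have hker : ∀ r ∈ R, ∀ w ∈ W, sp δ r w = 0 := by
    intro r hr w hw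
    obtain ⟨hrW, hrx, hry⟩ := (hmR r).1 hr
    rw [sp_comm hδ] at hrx hry
    have hrf : sp δ r f = 0 := by
      rw [hfxy, sp_add_right, sp_smul_right, hrx, hry]; ring
    have hrg : sp δ r g = 0 := by
      rw [hgxy, sp_add_right, sp_smul_right, sp_smul_right, hrx, hry]; ring
    have hrv : ∀ k, sp δ r (v k) = 0 := by
      intro k
      by_cases hki : k = i
      · rw [hki, hvi, sp_smul_right, hrf, mul_zero]
      by_cases hkj : k = j
      · rw [hkj, hvj, sp_smul_right, hrg, mul_zero]
      rw [← hW] at hrW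
      clear hr hrx hry hrf hrg
      induction hrW using Submodule.span_induction with
      | mem y hy =>
        obtain ⟨l, rfl⟩ := hy
        rw [hδv]
        split_ifs with h
        · rw [h, hk k hki hkj]
        · rfl
      | zero => exact sp_zero_left _ _
      | add y z _ _ h1 h2 => rw [sp_add_left, h1, h2, add_zero]
      | smul c y _ h => rw [sp_smul_left, h, mul_zero]
    rw [← hW] at hw
    induction hw using Submodule.span_induction with
    | mem y hy =>
      obtain ⟨l, rfl⟩ := hy
      exact hrv l
    | zero => rw [sp_comm hδ]; exact sp_zero_left _ _
    | add y z _ _ h1 h2 => rw [sp_add_right, h1, h2, add_zero]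
    | smul c y _ h => rw [sp_smul_right, h, mul_zero]
  obtain ⟨m, e, he, -⟩ := Baikov.exists_cornerFrame hδ (R := R) hxx hyy hxy
    (fun r hr => ((hmR r).1 hr).2.1) (fun r hr => ((hmR r).1 hr).2.2)
    (fun r hr s hs => hker r hr s ((hmR s).1 hs).1)
  refine ⟨m, e, ?_⟩
  convert he
  refine le_antisymm (fun w hw => ?_) ?_
  -- Projection to the complement: the coefficient along `x` is the pairing with `y`, and
  -- conversely.
  · have hmem : w - (sp δ y w • x + sp δ x w • y) ∈ R := by
      rw [hmR]
      refine ⟨W.sub_mem hw (W.add_mem (W.smul_mem _ hxm) (W.smul_mem _ hym)), ?_, ?_⟩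
      · rw [sp_comm hδ, sp_sub_left, sp_add_left, sp_smul_left _ _ x, sp_smul_left _ _ y, hxx, hyx,
          sp_comm hδ w x]
        ring
      · rw [sp_comm hδ, sp_sub_left, sp_add_left, sp_smul_left _ _ x, sp_smul_left _ _ y, hxy, hyy,
          sp_comm hδ w y]
        ring
    rw [show w = sp δ y w • x + (sp δ x w • y + (w - (sp δ y w • x + sp δ x w • y))) by module]
    exact Submodule.add_mem_sup (Submodule.smul_mem _ _ (Submodule.mem_span_singleton_self x))
      (Submodule.add_mem_sup (Submodule.smul_mem _ _ (Submodule.mem_span_singleton_self y)) hmem)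
  · refine sup_le ?_ (sup_le ?_ inf_le_left)
    · rwa [Submodule.span_singleton_le_iff_mem]
    · rwa [Submodule.span_singleton_le_iff_mem]

section

variable {δ : GramMat L E} {W : Submodule ℝ (Mom L E)} {m : ℕ} {e : Fin (m + 2) → Mom L E}

theorem range_frame1X_insert (e : Fin (m + 2) → Mom L E) :
    Set.range e = insert (e (Fin.last _)) (Set.range (frame1X e)) := by
  rw [← Fin.range_snoc]
  congr 1
  funext i
  refine Fin.lastCases ?_ (fun i => ?_) i <;> simp [frame1X]

theorem range_frameXn_insert (e : Fin (m + 2) → Mom L E) :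
    Set.range e = insert (e 0) (Set.range (frameXn e)) := by
  rw [← Fin.range_cons]
  congr 1
  funext i
  refine Fin.cases ?_ (fun i => ?_) i <;> simp [frameXn]

theorem range_frameX_insert (e : Fin (m + 2) → Mom L E) :
    Set.range (frame1X e) = insert (e 0) (Set.range (frameX e)) := by
  rw [← Fin.range_cons]
  congr 1
  funext i
  refine Fin.cases ?_ (fun i => ?_) i <;> simp [frameX, frame1X]

theorem range_frameX_insert_last (e : Fin (m + 2) → Mom L E) :
    Set.range (frameXn e) = insert (e (Fin.last _)) (Set.range (frameX e)) := by
  rw [← Fin.range_snoc]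
  congr 1
  funext i
  refine Fin.lastCases ?_ (fun i => ?_) i <;> simp [frameX, frameXn]

theorem sp_eq_zero_of_span {n : ℕ} {v : Fin n → Mom L E} {x y : Mom L E}
    (h : ∀ i, sp δ (v i) x = 0) (hy : y ∈ Submodule.span ℝ (Set.range v)) : sp δ y x = 0 := by
  induction hy using Submodule.span_induction with
  | mem y hy =>
    obtain ⟨l, rfl⟩ := hy
    exact h l
  | zero => exact sp_zero_left _ _
  | add y z _ _ h1 h2 => rw [sp_add_left, h1, h2, add_zero]
  | smul c y _ h => rw [sp_smul_left, h, mul_zero]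

/-- Pairing with `e 0` reads off the coefficient of the last frame vector, so this span is the
hyperplane of `W` orthogonal to the isotropic vector `e 0`. -/
theorem IsCornerFrame.mem_frame1X_iff (h : IsCornerFrame δ W e) {w : Mom L E} :
    w ∈ Submodule.span ℝ (Set.range (frame1X e)) ↔ w ∈ W ∧ sp δ w (e 0) = 0 := by
  obtain ⟨-, hW, hs⟩ := h
  have h0 : ∀ y ∈ Submodule.span ℝ (Set.range (frame1X e)), sp δ y (e 0) = 0 := fun y hy =>
    sp_eq_zero_of_span (fun i => by
      rw [frame1X, hs]
      simp [(Fin.castSucc_lt_last i).ne, Fin.last_pos.ne]) hy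
  rw [← hW, range_frame1X_insert]
  constructor
  · exact fun hw => ⟨Submodule.span_mono (Set.subset_insert _ _) hw, h0 w hw⟩
  · rintro ⟨hw, hw0⟩
    obtain ⟨c, z, hz, rfl⟩ := Submodule.mem_span_insert.1 hw
    rw [sp_add_left, sp_smul_left, h0 z hz, hs] at hw0
    simp at hw0
    rwa [hw0, zero_smul, zero_add]

theorem IsCornerFrame.mem_frameXn_iff (h : IsCornerFrame δ W e) {w : Mom L E} :
    w ∈ Submodule.span ℝ (Set.range (frameXn e)) ↔ w ∈ W ∧ sp δ w (e (Fin.last _)) = 0 := by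
  obtain ⟨-, hW, hs⟩ := h
  have h0 : ∀ y ∈ Submodule.span ℝ (Set.range (frameXn e)), sp δ y (e (Fin.last _)) = 0 :=
    fun y hy => sp_eq_zero_of_span (fun i => by
      rw [frameXn, hs]
      simp [Fin.succ_ne_zero, Fin.last_pos.ne']) hy
  rw [← hW, range_frameXn_insert]
  constructor
  · exact fun hw => ⟨Submodule.span_mono (Set.subset_insert _ _) hw, h0 w hw⟩
  · rintro ⟨hw, hw0⟩
    obtain ⟨c, z, hz, rfl⟩ := Submodule.mem_span_insert.1 hw
    rw [sp_add_left, sp_smul_left, h0 z hz, hs] at hw0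
    simp at hw0
    rwa [hw0, zero_smul, zero_add]

theorem IsCornerFrame.frame1X_inf_frameXn (h : IsCornerFrame δ W e) :
    Submodule.span ℝ (Set.range (frame1X e)) ⊓ Submodule.span ℝ (Set.range (frameXn e))
      = Submodule.span ℝ (Set.range (frameX e)) := by
  refine le_antisymm (fun w hw => ?_) (le_inf ?_ ?_)
  · obtain ⟨h1, h2⟩ := hw
    have h0 := (h.mem_frameXn_iff.1 h2).2
    rw [SetLike.mem_coe, range_frameX_insert] at h1
    obtain ⟨c, z, hz, rfl⟩ := Submodule.mem_span_insert.1 h1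
    have hz' : z ∈ Submodule.span ℝ (Set.range (frameXn e)) := by
      rw [range_frameX_insert_last]
      exact Submodule.span_mono (Set.subset_insert _ _) hz
    rw [sp_add_left, sp_smul_left, (h.mem_frameXn_iff.1 hz').2, h.2.2] at h0
    simp at h0
    rwa [h0, zero_smul, zero_add]
  · rw [range_frameX_insert]
    exact Submodule.span_mono (Set.subset_insert _ _)
  · rw [range_frameX_insert_last]
    exact Submodule.span_mono (Set.subset_insert _ _)

theorem IsCornerFrame.frame1X_le (h : IsCornerFrame δ W e) :
    Submodule.span ℝ (Set.range (frame1X e)) ≤ W := fun _ hw => (h.mem_frame1X_iff.1 hw).1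

theorem IsCornerFrame.frameXn_le (h : IsCornerFrame δ W e) :
    Submodule.span ℝ (Set.range (frameXn e)) ≤ W := fun _ hw => (h.mem_frameXn_iff.1 hw).1

theorem frameX_le_frame1X (e : Fin (m + 2) → Mom L E) :
    Submodule.span ℝ (Set.range (frameX e)) ≤ Submodule.span ℝ (Set.range (frame1X e)) := by
  rw [range_frameX_insert]
  exact Submodule.span_mono (Set.subset_insert _ _)

theorem frameX_le_frameXn (e : Fin (m + 2) → Mom L E) :
    Submodule.span ℝ (Set.range (frameX e)) ≤ Submodule.span ℝ (Set.range (frameXn e)) := by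
  rw [range_frameX_insert_last]
  exact Submodule.span_mono (Set.subset_insert _ _)

theorem IsCornerFrame.mem (h : IsCornerFrame δ W e) (i : Fin (m + 2)) : e i ∈ W :=
  h.2.1 ▸ Submodule.subset_span (Set.mem_range_self i)

theorem IsCornerFrame.not_vanishesOn (h : IsCornerFrame δ W e) : ¬ VanishesOn δ W := by
  intro hv
  have h1 := hv _ (h.mem 0) _ (h.mem (Fin.last _))
  rw [h.2.2] at h1
  simp at h1

theorem IsCornerFrame.vanishesOn_frame1X (h : IsCornerFrame δ W e) :
    VanishesOn δ (Submodule.span ℝ (Set.range (frame1X e))) := by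
  refine vanishesOn_of_orthogonal fun i j => ?_
  rw [frame1X, frame1X, h.2.2]
  simp [(Fin.castSucc_lt_last _).ne]

/-- The pairings with the two end vectors are the coordinates along the opposite ends; the interior
lies in the radical and contributes nothing. -/
theorem IsCornerFrame.sp_eq (h : IsCornerFrame δ W e) (hδ : δ.IsSymm) {u u' : Mom L E}
    (hu : u ∈ W) (hu' : u' ∈ W) :
    sp δ u u' = sp δ u (e 0) * sp δ u' (e (Fin.last _))
      + sp δ u (e (Fin.last _)) * sp δ u' (e 0) := by
  rw [← h.2.1, range_frame1X_insert, range_frameX_insert] at hu hu'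
  obtain ⟨a, x, hx, rfl⟩ := Submodule.mem_span_insert.1 hu
  obtain ⟨a', x', hx', rfl⟩ := Submodule.mem_span_insert.1 hu'
  obtain ⟨b, y, hy, rfl⟩ := Submodule.mem_span_insert.1 hx
  obtain ⟨b', y', hy', rfl⟩ := Submodule.mem_span_insert.1 hx'
  have hy1 := frameX_le_frame1X e hy
  have hy1' := frameX_le_frame1X e hy'
  have hyn := frameX_le_frameXn e hy
  have hyn' := frameX_le_frameXn e hy'
  have z1 := (h.mem_frame1X_iff.1 hy1).2
  have z1' := (h.mem_frame1X_iff.1 hy1').2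
  have zn := (h.mem_frameXn_iff.1 hyn).2
  have zn' := (h.mem_frameXn_iff.1 hyn').2
  have zz := h.vanishesOn_frame1X _ hy1 _ hy1'
  have e00 : sp δ (e 0) (e 0) = 0 := by rw [h.2.2]; simp [Fin.last_pos.ne]
  have e0n : sp δ (e 0) (e (Fin.last _)) = 1 := by rw [h.2.2]; simp
  have en0 : sp δ (e (Fin.last _)) (e 0) = 1 := by rw [h.2.2]; simp
  have enn : sp δ (e (Fin.last _)) (e (Fin.last _)) = 0 := by
    rw [h.2.2]; simp [Fin.last_pos.ne']
  have w1 := (sp_comm hδ (e 0) y').trans z1'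
  have wn := (sp_comm hδ (e (Fin.last _)) y').trans zn'
  simp only [sp_add_left, sp_add_right, sp_smul_left, sp_smul_right, z1, z1', zn, zn', w1, wn, zz,
    e00, e0n, en0, enn]
  ring

/-- A totally isotropic subspace lies in one of the two isotropic hyperplanes. -/
theorem IsCornerFrame.le_or_le (h : IsCornerFrame δ W e) (hδ : δ.IsSymm)
    {U : Submodule ℝ (Mom L E)} (hU : U ≤ W) (hv : VanishesOn δ U) :
    U ≤ Submodule.span ℝ (Set.range (frame1X e)) ∨
      U ≤ Submodule.span ℝ (Set.range (frameXn e)) := by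
  by_contra! hcon
  obtain ⟨h1, h2⟩ := hcon
  obtain ⟨u, hu, hu1⟩ := SetLike.not_le_iff_exists.1 h1
  obtain ⟨u', hu', hu2⟩ := SetLike.not_le_iff_exists.1 h2
  have a1 : sp δ u (e 0) ≠ 0 := fun h0 => hu1 (h.mem_frame1X_iff.2 ⟨hU hu, h0⟩)
  have a2 : sp δ u' (e (Fin.last _)) ≠ 0 := fun h0 => hu2 (h.mem_frameXn_iff.2 ⟨hU hu', h0⟩)
  have b1 := hv u hu u hu
  have b2 := hv u' hu' u' hu'
  have b3 := hv u hu u' hu'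
  rw [h.sp_eq hδ (hU hu) (hU hu)] at b1
  rw [h.sp_eq hδ (hU hu') (hU hu')] at b2
  rw [h.sp_eq hδ (hU hu) (hU hu')] at b3
  -- Isotropy of `u` makes the product of its two coordinates zero. With this one zero, the pairing
  -- of `u` with `u'` is a product of two non-zero numbers.
  have c1 : sp δ u (e (Fin.last _)) = 0 := by
    rcases mul_eq_zero.1 (show sp δ u (e 0) * sp δ u (e (Fin.last _)) = 0 by linarith) with h | h
    · exact absurd h a1
    · exact h
  rw [c1, zero_mul, add_zero] at b3
  exact mul_ne_zero a1 a2 b3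

end

/-! ### The Gram determinant as a function of a corner variable -/

theorem det_fromBlocks_unit {m : ℕ} {A : Matrix (Fin m) (Fin m) ℝ} (hA : A.det ≠ 0)
    (u : Fin m → ℝ) (a : ℝ) :
    (Matrix.fromBlocks A (Matrix.of fun i (_ : Unit) => u i) (Matrix.of fun (_ : Unit) i => u i)
      (Matrix.of fun _ _ => a)).det = A.det * (a - u ⬝ᵥ A⁻¹ *ᵥ u) := by
  let _ := A.invertibleOfIsUnitDet (isUnit_iff_ne_zero.2 hA)
  rw [Matrix.det_fromBlocks₁₁, Matrix.det_unique (n := Unit), Matrix.invOf_eq_nonsing_inv, Matrix.mul_assoc]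
  rfl

theorem det_fromBlocks_fin_two {m : ℕ} {A : Matrix (Fin m) (Fin m) ℝ} (hA : A.det ≠ 0)
    (hs : A.IsSymm) (u : Fin 2 → Fin m → ℝ) (a b c : ℝ) :
    (Matrix.fromBlocks A (Matrix.of fun i j => u j i) (Matrix.of u) !![a, b; b, c]).det
      = A.det * ((a - u 0 ⬝ᵥ A⁻¹ *ᵥ u 0) * (c - u 1 ⬝ᵥ A⁻¹ *ᵥ u 1)
        - (b - u 0 ⬝ᵥ A⁻¹ *ᵥ u 1) ^ 2) := by
  let _ := A.invertibleOfIsUnitDet (isUnit_iff_ne_zero.2 hA)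
  have h : ∀ i j, (Matrix.of u * (A⁻¹ * Matrix.of fun i j => u j i)) i j
      = u i ⬝ᵥ A⁻¹ *ᵥ u j := fun i j => rfl
  have hsym : u 1 ⬝ᵥ A⁻¹ *ᵥ u 0 = u 0 ⬝ᵥ A⁻¹ *ᵥ u 1 := by
    have hi : (A⁻¹)ᵀ = A⁻¹ := by rw [Matrix.transpose_nonsing_inv, hs.eq]
    rw [Matrix.dotProduct_mulVec, ← Matrix.mulVec_transpose, hi, dotProduct_comm]
  rw [Matrix.det_fromBlocks₁₁, Matrix.det_fin_two, Matrix.invOf_eq_nonsing_inv, Matrix.mul_assoc]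
  simp only [Matrix.sub_apply, h, hsym]
  simp
  left
  ring

/-- The indices of a frame, those in the interior first. -/
def cornerEquiv (m : ℕ) : Fin m ⊕ Fin 2 ≃ Fin (m + 2) :=
  Equiv.ofBijective (Sum.elim (fun i => i.castSucc.succ) ![0, Fin.last _]) <| by
    refine (Fintype.bijective_iff_injective_and_card _).2 ⟨?_, by simp⟩
    rintro (i | i) (j | j) h
    · simpa using h
    · have := congrArg Fin.val h
      fin_cases j <;> simp at this
      omega
    · have := congrArg Fin.val h
      fin_cases i <;> simp at this
      omega
    · have := congrArg Fin.val h
      fin_cases i <;> fin_cases j <;> simp at this ⊢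

/-- The indices of `Fin (m + 1)`, the first one last. -/
def headEquiv (m : ℕ) : Fin m ⊕ Unit ≃ Fin (m + 1) :=
  Equiv.ofBijective (Sum.elim Fin.succ fun _ => 0) <| by
    refine (Fintype.bijective_iff_injective_and_card _).2 ⟨?_, by simp⟩
    rintro (i | i) (j | j) h <;> simp_all [Fin.succ_ne_zero, (Fin.succ_ne_zero _).symm]

/-- The indices of `Fin (m + 1)`. -/
def lastEquiv (m : ℕ) : Fin m ⊕ Unit ≃ Fin (m + 1) :=
  Equiv.ofBijective (Sum.elim Fin.castSucc fun _ => Fin.last m) <| by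
    refine (Fintype.bijective_iff_injective_and_card _).2 ⟨?_, by simp⟩
    rintro (i | i) (j | j) h <;> simp_all [Fin.castSucc_ne_last, (Fin.castSucc_ne_last _).symm]

section

variable {δ : GramMat L E} {W : Submodule ℝ (Mom L E)} {m : ℕ} {e : Fin (m + 2) → Mom L E}

theorem IsSymm.add_smul {M δ : GramMat L E} (hM : M.IsSymm) (hδ : δ.IsSymm) (t : ℝ) :
    (M + t • δ).IsSymm :=
  hM.add (hδ.smul t)

/-- The numbers `a`, `b`, `c` are the entries of the `2 × 2` Schur complement of the interior block;
`t` only shifts its off-diagonal entry. -/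
theorem IsCornerFrame.exists_gramDet_eq (h : IsCornerFrame δ W e)
    {M : GramMat L E} (hM : M.IsSymm) (hX : gramDet (frameX e) M ≠ 0) :
    ∃ a b c : ℝ, gramDet (frame1X e) M = gramDet (frameX e) M * a ∧
      gramDet (frameXn e) M = gramDet (frameX e) M * c ∧
      ∀ t : ℝ, gramDet e (M + t • δ) = gramDet (frameX e) M * (a * c - (b + t) ^ 2) := by
  let A : Matrix (Fin m) (Fin m) ℝ := Matrix.of fun i j => sp M (frameX e i) (frameX e j)
  have hA : A.IsSymm := by
    ext i j
    exact sp_comm hM _ _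
  let u : Fin 2 → Fin m → ℝ := fun j i => sp M (frameX e i) (e (![0, Fin.last _] j))
  let s : Fin 2 → Fin 2 → ℝ := fun i j => u i ⬝ᵥ A⁻¹ *ᵥ u j
  refine ⟨sp M (e 0) (e 0) - s 0 0, sp M (e 0) (e (Fin.last _)) - s 0 1,
    sp M (e (Fin.last _)) (e (Fin.last _)) - s 1 1, ?_, ?_, fun t => ?_⟩
  · refine Eq.trans ?_ (det_fromBlocks_unit (A := A) hX (u 0) _)
    rw [gramDet, ← Matrix.det_submatrix_equiv_self (headEquiv m)]
    congr 1
    ext (i | i) (j | j)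
    · rfl
    · rfl
    · exact sp_comm hM _ _
    · rfl
  · refine Eq.trans ?_ (det_fromBlocks_unit (A := A) hX (u 1) _)
    rw [gramDet, ← Matrix.det_submatrix_equiv_self (lastEquiv m)]
    congr 1
    ext (i | i) (j | j)
    · rfl
    · rfl
    · exact sp_comm hM _ _
    · rfl
  · have h2 := det_fromBlocks_fin_two (A := A) hX hA u (sp M (e 0) (e 0))
      (sp M (e 0) (e (Fin.last _)) + t) (sp M (e (Fin.last _)) (e (Fin.last _)))
    refine Eq.trans (Eq.trans ?_ h2) ?_
    · rw [gramDet, ← Matrix.det_submatrix_equiv_self (cornerEquiv m)]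
      congr 1
      have hn : ∀ i : Fin m, i.castSucc.succ ≠ Fin.last (m + 1) :=
        fun i h => absurd (congrArg Fin.val h) (by simp; omega)
      have hl : Fin.last (m + 1) ≠ 0 := Fin.last_pos.ne'
      have hc : ∀ k (j : Fin m), sp M (e k) (e j.castSucc.succ) = sp M (e j.castSucc.succ) (e k) :=
        fun k j => sp_comm hM _ _
      ext (i | i) (j | j)
      · simp [cornerEquiv, sp_add_smul, h.2.2, A, frameX, hn]
      · fin_cases j <;> simp [cornerEquiv, sp_add_smul, h.2.2, frameX, u, hn]
      · fin_cases i <;> simp [cornerEquiv, sp_add_smul, h.2.2, frameX, u, hn, hc]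
      · fin_cases i <;> fin_cases j <;>
          simp [cornerEquiv, sp_add_smul, h.2.2, hl, hl.symm, sp_comm hM (e (Fin.last _)) (e 0)]
    · change A.det * _ = A.det * _
      ring

/-- The determinant is a polynomial in `s` whose coefficient of degree `n` is the Gram determinant
for the identity matrix, which is positive. -/
theorem finite_gramDet_add_smul_eq_zero {n : ℕ} {v : Fin n → Mom L E} (hv : LinearIndependent ℝ v)
    (M : GramMat L E) : {s : ℝ | gramDet v (M + s • 1) = 0}.Finite := by
  let A : Matrix (Fin n) (Fin n) ℝ := Matrix.of fun i j => sp (1 : GramMat L E) (v i) (v j)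
  let B : Matrix (Fin n) (Fin n) ℝ := Matrix.of fun i j => sp M (v i) (v j)
  let p : Polynomial ℝ :=
    ((Polynomial.X : Polynomial ℝ) • A.map Polynomial.C + B.map Polynomial.C).det
  have hp : p ≠ 0 := by
    intro h0
    have h1 := Polynomial.coeff_det_X_add_C_card A B
    change p.coeff _ = _ at h1
    rw [h0, Polynomial.coeff_zero] at h1
    exact (gramDet_pos hv (Matrix.PosDef.one : (1 : GramMat L E).PosDef)).ne h1
  refine (Polynomial.finite_setOfPred_isRoot hp).subset fun s hs => ?_
  change p.eval s = 0
  rw [← Polynomial.coe_evalRingHom, RingHom.map_det]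
  refine Eq.trans ?_ hs
  unfold gramDet
  congr 1
  ext i j
  simp [A, B, sp_add_smul]
  ring

theorem continuous_gramDet {n : ℕ} (v : Fin n → Mom L E) : Continuous (gramDet v) := by
  refine Continuous.matrix_det (continuous_matrix fun i j => ?_)
  unfold sp
  exact Continuous.dotProduct continuous_const (Continuous.matrix_mulVec continuous_id
    continuous_const)

/-- The Schur complement proves this when the interior minor is non-zero. Along `M + s • 1` that
excludes finitely many `s`, and continuity at `s = 0` gives the rest. -/
theorem IsCornerFrame.gramDet_quadratic (h : IsCornerFrame δ W e)
    {M : GramMat L E} (hM : M.IsSymm) : ∃ B C : ℝ,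
      (∀ t : ℝ, gramDet e (M + t • δ) = -(gramDet (frameX e) M * t ^ 2 + B * t + C)) ∧
      B ^ 2 - 4 * gramDet (frameX e) M * C
        = 4 * gramDet (frame1X e) M * gramDet (frameXn e) M := by
  -- The coefficients are recovered from the values at `t = -1, 0, 1`, which makes them continuous
  -- in `M` even where the interior minor vanishes.
  let Bf : GramMat L E → ℝ := fun M => (gramDet e (M + (-1 : ℝ) • δ) - gramDet e (M + (1 : ℝ) • δ)) / 2
  let Cf : GramMat L E → ℝ := fun M => -gramDet e M
  have hcont : ∀ t : ℝ, Continuous fun M : GramMat L E => gramDet e (M + t • δ) := fun t =>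
    (continuous_gramDet e).comp (continuous_id.add continuous_const)
  have hB : Continuous Bf := ((hcont _).sub (hcont _)).div_const _
  have hC : Continuous Cf := (continuous_gramDet e).neg
  have hXc := continuous_gramDet (frameX e)
  have key : ∀ M : GramMat L E, M.IsSymm → gramDet (frameX e) M ≠ 0 →
      (∀ t : ℝ, gramDet e (M + t • δ) = -(gramDet (frameX e) M * t ^ 2 + Bf M * t + Cf M)) ∧
      Bf M ^ 2 - 4 * gramDet (frameX e) M * Cf M
        = 4 * gramDet (frame1X e) M * gramDet (frameXn e) M := by
    intro M hM hX
    obtain ⟨a, b, c, h1, h2, h3⟩ := h.exists_gramDet_eq hM hX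
    have h0 := h3 0
    rw [zero_smul, add_zero] at h0
    simp only [Bf, Cf, h0, h1, h2, h3]
    exact ⟨fun t => by ring, by ring⟩
  have hfin := finite_gramDet_add_smul_eq_zero
    (h.1.comp _ (fun i j hij => by simpa using hij :
      Function.Injective fun i : Fin m => i.castSucc.succ)) M
  have hd := hfin.countable.dense_compl ℝ
  have hpath : Continuous fun s : ℝ => M + s • (1 : GramMat L E) := by fun_prop
  have hsym : ∀ s : ℝ, (M + s • (1 : GramMat L E)).IsSymm := fun s =>
    IsSymm.add_smul hM Matrix.isSymm_one s
  refine ⟨Bf M, Cf M, fun t => ?_, ?_⟩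
  · have := Continuous.ext_on hd ((hcont t).comp hpath)
      ((((hXc.mul continuous_const).add (hB.mul continuous_const)).add hC).neg.comp hpath)
      (fun s hs => (key _ (hsym s) hs).1 t)
    simpa using congrFun this 0
  · have := Continuous.ext_on hd
      (((hB.pow 2).sub ((continuous_const.mul hXc).mul hC)).comp hpath)
      (((continuous_const.mul (continuous_gramDet (frame1X e))).mul
        (continuous_gramDet (frameXn e))).comp hpath)
      (fun s hs => (key _ (hsym s) hs).2)
    simpa using congrFun this 0

theorem IsCornerFrame.linearIndependent_frameX (h : IsCornerFrame δ W e) :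
    LinearIndependent ℝ (frameX e) :=
  h.1.comp (fun i : Fin m => i.castSucc.succ) fun i j hij => by simpa using hij

theorem IsCornerFrame.linearIndependent_frame1X (h : IsCornerFrame δ W e) :
    LinearIndependent ℝ (frame1X e) :=
  h.1.comp _ (Fin.castSucc_injective _)

theorem IsCornerFrame.linearIndependent_frameXn (h : IsCornerFrame δ W e) :
    LinearIndependent ℝ (frameXn e) :=
  h.1.comp _ (Fin.succ_injective _)

theorem IsCornerFrame.isQuadratic (h : IsCornerFrame δ W e) :
    IsQuadratic δ W := by
  intro M hM
  obtain ⟨c, hc, hg⟩ := exists_gram_eq h.1 h.2.1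
  obtain ⟨B, C, hq, -⟩ := h.gramDet_quadratic (M := M) hM.1
  refine ⟨c * gramDet (frameX e) M, c * B, c * C,
    mul_pos hc (gramDet_pos h.linearIndependent_frameX hM), fun t => ?_⟩
  rw [hg, hq]
  ring

theorem IsCornerFrame.finrank_eq (h : IsCornerFrame δ W e) : Module.finrank ℝ W = m + 2 := by
  rw [← h.2.1, finrank_span_eq_card h.1, Fintype.card_fin]

theorem IsCornerFrame.finrank_frameX (h : IsCornerFrame δ W e) :
    Module.finrank ℝ (Submodule.span ℝ (Set.range (frameX e))) = m := by
  rw [finrank_span_eq_card h.linearIndependent_frameX, Fintype.card_fin]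

theorem IsCornerFrame.finrank_frame1X (h : IsCornerFrame δ W e) :
    Module.finrank ℝ (Submodule.span ℝ (Set.range (frame1X e))) = m + 1 := by
  rw [finrank_span_eq_card h.linearIndependent_frame1X, Fintype.card_fin]

theorem IsCornerFrame.finrank_frameXn (h : IsCornerFrame δ W e) :
    Module.finrank ℝ (Submodule.span ℝ (Set.range (frameXn e))) = m + 1 := by
  rw [finrank_span_eq_card h.linearIndependent_frameXn, Fintype.card_fin]

end

/-! ### Moments of the symmetric beta distribution -/

/-- The moments of `u ^ γ * (1 - u) ^ γ` on the unit interval, about its midpoint. -/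
def betaMoment (γ : ℂ) (k : ℕ) : ℂ :=
  ∫ u in (0 : ℝ)..1, ((2 * u - 1 : ℝ) : ℂ) ^ k * ((u : ℂ) ^ γ * (1 - (u : ℂ)) ^ γ)

theorem intervalIntegrable_beta {γ : ℂ} (hγ : -1 < γ.re) :
    IntervalIntegrable (fun u : ℝ => (u : ℂ) ^ γ * (1 - (u : ℂ)) ^ γ) MeasureTheory.volume 0 1 := by
  have h := Complex.betaIntegral_convergent (u := γ + 1) (v := γ + 1)
    (by simp; linarith) (by simp; linarith)
  simpa using h

theorem intervalIntegrable_mul_beta {γ : ℂ} (hγ : -1 < γ.re) {f : ℝ → ℂ} (hf : Continuous f) :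
    IntervalIntegrable (fun u : ℝ => f u * ((u : ℂ) ^ γ * (1 - (u : ℂ)) ^ γ))
      MeasureTheory.volume 0 1 :=
  (intervalIntegrable_beta hγ).continuousOn_mul hf.continuousOn

theorem betaMoment_zero_ne_zero {γ : ℂ} (hγ : -1 < γ.re) : betaMoment γ 0 ≠ 0 := by
  have h : betaMoment γ 0 = Complex.betaIntegral (γ + 1) (γ + 1) := by
    simp [betaMoment, Complex.betaIntegral]
  have hre : 0 < (γ + 1).re := by simp; linarith
  have hG := Complex.Gamma_mul_Gamma_eq_betaIntegral hre hre
  rw [h]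
  intro h0
  rw [h0, mul_zero] at hG
  exact mul_ne_zero (Complex.Gamma_ne_zero_of_re_pos hre) (Complex.Gamma_ne_zero_of_re_pos hre) hG

theorem hasDerivAt_beta_primitive {γ : ℂ} {f : ℝ → ℂ} {f' : ℂ} {u : ℝ} (h0 : 0 < u) (h1 : u < 1)
    (hf : HasDerivAt f f' u) :
    HasDerivAt (fun u : ℝ => f u * ((u : ℂ) ^ (γ + 1) * (1 - (u : ℂ)) ^ (γ + 1)))
      ((f' * (u * (1 - u)) + f u * (γ + 1) * (1 - 2 * u)) * ((u : ℂ) ^ γ * (1 - (u : ℂ)) ^ γ)) u := by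
  have hu : (u : ℂ) ∈ Complex.slitPlane := Or.inl (by simpa using h0)
  have hu' : (1 - (u : ℂ)) ∈ Complex.slitPlane := Or.inl (by simpa using h1)
  have hu0 : (u : ℂ) ≠ 0 := by exact_mod_cast h0.ne'
  have hu1 : (1 - (u : ℂ)) ≠ 0 := by
    rw [sub_ne_zero]; exact_mod_cast h1.ne'
  have d1 : HasDerivAt (fun u : ℝ => (u : ℂ) ^ (γ + 1)) ((γ + 1) * (u : ℂ) ^ γ) u := by
    have := (((hasDerivAt_id (u : ℂ)).cpow_const (c := γ + 1) hu)).comp_ofReal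
    simpa using this
  have d2 : HasDerivAt (fun u : ℝ => (1 - (u : ℂ)) ^ (γ + 1)) (-((γ + 1) * (1 - (u : ℂ)) ^ γ)) u := by
    have := ((((hasDerivAt_id (u : ℂ)).const_sub 1).cpow_const (c := γ + 1) hu')).comp_ofReal
    simpa using this
  refine (hf.fun_mul (d1.fun_mul d2)).congr_deriv ?_
  rw [Complex.cpow_add _ _ hu0, Complex.cpow_add _ _ hu1, Complex.cpow_one, Complex.cpow_one]
  ring

/-- The integrand is the derivative of `f * u ^ (γ + 1) * (1 - u) ^ (γ + 1)`, which vanishes at both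
ends since `γ + 1` has positive real part. Suitable `f` give the moment relations. -/
theorem integral_beta_eq_zero {γ : ℂ} (hγ : -1 < γ.re) {f f' : ℝ → ℂ} (hf' : Continuous f')
    (hf : ∀ u, HasDerivAt f (f' u) u) :
    ∫ u in (0 : ℝ)..1, (f' u * (u * (1 - u)) + f u * (γ + 1) * (1 - 2 * u))
      * ((u : ℂ) ^ γ * (1 - (u : ℂ)) ^ γ) = 0 := by
  have hγ0 : γ + 1 ≠ 0 := fun h => by
    have := congrArg Complex.re h
    simp at this
    linarith
  have hfc : Continuous f := continuous_iff_continuousAt.2 fun u => (hf u).continuousAt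
  have hre : 0 < (γ + 1).re := by simp; linarith
  have hcp : ∀ g : ℝ → ℝ, Continuous g → Continuous fun u : ℝ => ((g u : ℝ) : ℂ) ^ (γ + 1) :=
    fun g hg => (Complex.continuous_ofReal_cpow_const hre).comp hg
  have hc : Continuous fun u : ℝ => f u * ((u : ℂ) ^ (γ + 1) * (1 - (u : ℂ)) ^ (γ + 1)) := by
    have h2 := hcp (fun u => 1 - u) (by fun_prop)
    push_cast at h2
    exact hfc.mul ((hcp id continuous_id).mul h2)
  rw [intervalIntegral.integral_eq_sub_of_hasDeriv_right_of_le zero_le_one hc.continuousOn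
    (fun u hu => (hasDerivAt_beta_primitive hu.1 hu.2 (hf u)).hasDerivWithinAt)
    (intervalIntegrable_mul_beta hγ (by fun_prop))]
  simp [Complex.zero_cpow hγ0]

theorem betaMoment_one {γ : ℂ} (hγ : -1 < γ.re) : betaMoment γ 1 = 0 := by
  have hγ0 : γ + 1 ≠ 0 := fun h => by
    have := congrArg Complex.re h
    simp at this
    linarith
  have h := integral_beta_eq_zero hγ (f := fun _ => 1) (f' := fun _ => 0) continuous_const
    (fun u => hasDerivAt_const _ _)
  have h2 : betaMoment γ 1 * -(γ + 1) = 0 := by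
    rw [betaMoment, ← intervalIntegral.integral_mul_const, ← h]
    refine intervalIntegral.integral_congr fun u _ => ?_
    push_cast
    ring
  exact (mul_eq_zero.1 h2).resolve_right (neg_ne_zero.2 hγ0)

theorem betaMoment_add_two {γ : ℂ} (hγ : -1 < γ.re) (k : ℕ) :
    betaMoment γ (k + 2) * (k + 1 + 2 * (γ + 1)) = (k + 1) * betaMoment γ k := by
  have h := integral_beta_eq_zero hγ (f := fun u => ((2 * u - 1 : ℝ) : ℂ) ^ (k + 1))
    (f' := fun u => ((k : ℂ) + 1) * ((2 * u - 1 : ℝ) : ℂ) ^ k * 2) (by fun_prop) (fun u => by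
      have h1 : HasDerivAt (fun u : ℝ => ((2 * u - 1 : ℝ) : ℂ)) 2 u := by
        have : HasDerivAt (fun u : ℝ => (2 * u - 1 : ℝ)) 2 u := by
          simpa using ((hasDerivAt_id u).const_mul 2).sub_const 1
        simpa using this.ofReal_comp
      simpa using h1.fun_pow (k + 1))
  -- Follows from `4 * u * (1 - u) = 1 - (2 * u - 1) ^ 2`.
  have e : betaMoment γ (k + 2) * (k + 1 + 2 * (γ + 1)) - (k + 1) * betaMoment γ k
      = (-2) * ∫ u in (0 : ℝ)..1, ((((k : ℂ) + 1) * ((2 * u - 1 : ℝ) : ℂ) ^ k * 2) * (u * (1 - u))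
        + ((2 * u - 1 : ℝ) : ℂ) ^ (k + 1) * (γ + 1) * (1 - 2 * u))
      * ((u : ℂ) ^ γ * (1 - (u : ℂ)) ^ γ) := by
    rw [betaMoment, betaMoment, ← intervalIntegral.integral_mul_const,
      ← intervalIntegral.integral_const_mul, ← intervalIntegral.integral_const_mul,
      ← intervalIntegral.integral_sub
        ((intervalIntegrable_mul_beta hγ (by fun_prop)).mul_const _)
        ((intervalIntegrable_mul_beta hγ (by fun_prop)).const_mul _)]
    refine intervalIntegral.integral_congr fun u _ => ?_
    push_cast
    ring
  rw [h, mul_zero] at e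
  exact sub_eq_zero.1 e

theorem betaMoment_odd {γ : ℂ} (hγ : -1 < γ.re) (j : ℕ) : betaMoment γ (2 * j + 1) = 0 := by
  induction j with
  | zero => exact betaMoment_one hγ
  | succ j ih =>
    have h := betaMoment_add_two hγ (2 * j + 1)
    rw [ih, mul_zero] at h
    refine (mul_eq_zero.1 h).resolve_right fun h0 => ?_
    have := congrArg Complex.re h0
    simp at this
    have : (0 : ℝ) ≤ j := j.cast_nonneg
    linarith

theorem cast_choose_succ (n k : ℕ) :
    (n.choose (k + 1) : ℂ) * (k + 1) = n.choose k * (n - k) := by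
  have h := Nat.choose_succ_right_eq n k
  rcases le_or_gt k n with hk | hk
  · have := congrArg (Nat.cast : ℕ → ℂ) h
    push_cast [Nat.cast_sub hk] at this
    exact this
  · rw [Nat.choose_eq_zero_of_lt hk, Nat.choose_eq_zero_of_lt (by omega)]
    simp

/-- Both sides have the same ratio of consecutive terms: the two Pochhammer symbols in the numerator
contribute `(n - 2 * j) * (n - (2 * j + 1)) / 4`, as do the binomials and the moment recurrence
together with the remaining factors. -/
theorem hypergeometric_coeff_mul_betaMoment {γ : ℂ} (hγ : -1 < γ.re) (n j : ℕ) :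
    (((j.factorial : ℂ)⁻¹ * (ascPochhammer ℂ j).eval (-(n : ℂ) / 2)
      * (ascPochhammer ℂ j).eval ((1 - (n : ℂ)) / 2)
      * ((ascPochhammer ℂ j).eval (3 / 2 + γ))⁻¹)) * betaMoment γ 0
      = n.choose (2 * j) * betaMoment γ (2 * j) := by
  induction j with
  | zero => simp
  | succ j ih =>
    have hne : (3 / 2 + γ + j) ≠ 0 := fun h0 => by
      have := congrArg Complex.re h0
      simp at this
      have : (0 : ℝ) ≤ j := j.cast_nonneg
      linarith
    have hj : (j : ℂ) + 1 ≠ 0 := by exact_mod_cast j.succ_ne_zero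
    have hj1 : (2 * (j : ℂ) + 1) ≠ 0 := by exact_mod_cast (2 * j).succ_ne_zero
    have h1 := cast_choose_succ n (2 * j)
    have h2 := cast_choose_succ n (2 * j + 1)
    have h3 := betaMoment_add_two hγ (2 * j)
    push_cast at h1 h2 h3
    rw [ascPochhammer_succ_eval, ascPochhammer_succ_eval, ascPochhammer_succ_eval,
      Nat.factorial_succ, show 2 * (j + 1) = 2 * j + 2 by ring]
    have e1 : (((j + 1) * j.factorial : ℕ) : ℂ) = (j + 1) * j.factorial := by push_cast; ring
    rw [e1]
    have e2 : betaMoment γ (2 * j + 2)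
        = (2 * j + 1) * betaMoment γ (2 * j) / (2 * (3 / 2 + γ + j)) := by
      rw [eq_div_iff (mul_ne_zero two_ne_zero hne), ← h3]
      ring
    have e3 : (n.choose (2 * j + 2) : ℂ)
        = n.choose (2 * j) * (n - 2 * j) * (n - (2 * j + 1)) / ((2 * j + 1) * (2 * (j + 1))) := by
      rw [eq_div_iff (mul_ne_zero hj1 (mul_ne_zero two_ne_zero hj))]
      linear_combination (2 * (j : ℂ) + 1) * h2 + (n - (2 * j + 1)) * h1
    rw [e2, e3]
    simp only [mul_inv]
    have e4 : (n.choose (2 * j) : ℂ) * (n - 2 * j) * (n - (2 * j + 1))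
          / ((2 * j + 1) * (2 * (j + 1)))
          * ((2 * j + 1) * betaMoment γ (2 * j) / (2 * (3 / 2 + γ + j)))
        = (n.choose (2 * j) * betaMoment γ (2 * j)) *
          ((n - 2 * j) * (n - (2 * j + 1)) / (4 * (j + 1) * (3 / 2 + γ + j))) := by
      field_simp
      ring
    rw [e4, ← ih]
    field_simp
    ring

theorem sum_range_two_mul (f : ℕ → ℂ) (N : ℕ) :
    ∑ k ∈ Finset.range (2 * N), f k = ∑ j ∈ Finset.range N, (f (2 * j) + f (2 * j + 1)) := by
  induction N with
  | zero => simp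
  | succ N ih =>
    rw [show 2 * (N + 1) = 2 * N + 1 + 1 by ring, Finset.sum_range_succ, Finset.sum_range_succ, ih,
      Finset.sum_range_succ]
    ring

theorem sum_choose_mul_betaMoment {γ : ℂ} (hγ : -1 < γ.re) (n : ℕ) (y : ℂ) :
    ∑ k ∈ Finset.range (n + 1), (n.choose k : ℂ) * y ^ k * betaMoment γ k
      = betaMoment γ 0 *
        ordinaryHypergeometric (-(n : ℂ) / 2) ((1 - (n : ℂ)) / 2) (3 / 2 + γ) (y ^ 2) := by
  have h0 := betaMoment_zero_ne_zero hγ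
  -- Binomials beyond `n` vanish, so the range may be extended to even length and split into even
  -- and odd indices.
  have hs : ∑ k ∈ Finset.range (n + 1), (n.choose k : ℂ) * y ^ k * betaMoment γ k
      = ∑ k ∈ Finset.range (2 * (n + 1)), (n.choose k : ℂ) * y ^ k * betaMoment γ k := by
    refine Finset.sum_subset (Finset.range_mono (by omega)) fun k _ hk => ?_
    rw [Finset.mem_range, not_lt] at hk
    rw [Nat.choose_eq_zero_of_lt (by omega)]
    simp
  rw [hs, sum_range_two_mul, ordinaryHypergeometric_eq_tsum]
  beta_reduce
  rw [tsum_eq_sum (s := Finset.range (n + 1)), Finset.mul_sum]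
  · refine Finset.sum_congr rfl fun j _ => ?_
    rw [betaMoment_odd hγ, mul_zero, add_zero, smul_eq_mul]
    have := hypergeometric_coeff_mul_betaMoment hγ n j
    linear_combination -(y ^ 2) ^ j * this
  -- The series terminates: its coefficient times the non-zero number `betaMoment γ 0` contains a
  -- vanishing binomial.
  · intro j hj
    rw [Finset.mem_range, not_lt] at hj
    have := hypergeometric_coeff_mul_betaMoment hγ n j
    rw [Nat.choose_eq_zero_of_lt (by omega), Nat.cast_zero, zero_mul] at this
    rw [(mul_eq_zero.1 this).resolve_right h0, zero_smul]

/-- The moments of a power of a quadratic polynomial between its roots. -/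
theorem integral_quadratic_cpow {γ : ℂ} (hγ : -1 < γ.re) {A c₁ c₂ : ℝ} (hA : 0 < A)
    (hc : c₁ < c₂) (n : ℕ) (hn : n = 0 ∨ c₁ + c₂ ≠ 0) :
    ∫ x in c₁..c₂, (x : ℂ) ^ n * ((A * ((x - c₁) * (c₂ - x)) : ℝ) : ℂ) ^ γ
      = betaMoment γ 0 * ((c₂ - c₁ : ℝ) : ℂ) * ((A * (c₂ - c₁) ^ 2 : ℝ) : ℂ) ^ γ
        * (((c₁ + c₂) / 2 : ℝ) : ℂ) ^ n
        * ordinaryHypergeometric (-(n : ℂ) / 2) ((1 - (n : ℂ)) / 2) (3 / 2 + γ)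
          ((((c₁ - c₂) / (c₁ + c₂)) ^ 2 : ℝ) : ℂ) := by
  have hD : 0 < c₂ - c₁ := sub_pos.2 hc
  have hsub := intervalIntegral.smul_integral_comp_add_mul (a := 0) (b := 1)
    (fun x : ℝ => (x : ℂ) ^ n * ((A * ((x - c₁) * (c₂ - x)) : ℝ) : ℂ) ^ γ) (c₂ - c₁) c₁
  rw [mul_zero, mul_one, add_zero, add_sub_cancel] at hsub
  rw [← hsub]
  have hint : ∀ u ∈ Set.uIoc (0 : ℝ) 1,
      ((c₁ + (c₂ - c₁) * u : ℝ) : ℂ) ^ n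
        * ((A * ((c₁ + (c₂ - c₁) * u - c₁) * (c₂ - (c₁ + (c₂ - c₁) * u))) : ℝ) : ℂ) ^ γ
      = ∑ k ∈ Finset.range (n + 1), ((A * (c₂ - c₁) ^ 2 : ℝ) : ℂ) ^ γ *
        (((((c₁ + c₂) / 2 : ℝ) : ℂ) ^ (n - k) * ((((c₂ - c₁) / 2 : ℝ) : ℂ) ^ k * n.choose k)) *
        (((2 * u - 1 : ℝ) : ℂ) ^ k * ((u : ℂ) ^ γ * (1 - (u : ℂ)) ^ γ))) := by
    intro u hu
    rw [Set.uIoc_of_le zero_le_one] at hu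
    have e1 : A * ((c₁ + (c₂ - c₁) * u - c₁) * (c₂ - (c₁ + (c₂ - c₁) * u)))
        = A * (c₂ - c₁) ^ 2 * (u * (1 - u)) := by ring
    have hu1 : 0 ≤ 1 - u := sub_nonneg.2 hu.2
    rw [e1, Complex.ofReal_mul, Complex.mul_cpow_ofReal_nonneg (by positivity)
      (mul_nonneg hu.1.le hu1), Complex.ofReal_mul u, Complex.mul_cpow_ofReal_nonneg hu.1.le hu1]
    -- Midpoint plus half-width times `2 * u - 1`; the binomial expansion then produces the centred
    -- moments.
    have e2 : c₁ + (c₂ - c₁) * u = (c₂ - c₁) / 2 * (2 * u - 1) + (c₁ + c₂) / 2 := by ring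
    rw [e2, Complex.ofReal_add, Complex.ofReal_mul ((c₂ - c₁) / 2), add_pow, Finset.sum_mul]
    refine Finset.sum_congr rfl fun k _ => ?_
    rw [mul_pow, Complex.ofReal_sub 1 u, Complex.ofReal_one]
    ring
  rw [intervalIntegral.integral_congr_ae (Filter.Eventually.of_forall hint),
    intervalIntegral.integral_finsetSum]
  swap
  · intro k _
    exact ((intervalIntegrable_mul_beta hγ (by fun_prop)).const_mul _).const_mul _
  simp only [intervalIntegral.integral_const_mul]
  have hsum := sum_choose_mul_betaMoment hγ n ((((c₂ - c₁) / (c₁ + c₂) : ℝ)) : ℂ)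
  have hy : ((((c₁ - c₂) / (c₁ + c₂)) ^ 2 : ℝ) : ℂ)
      = ((((c₂ - c₁) / (c₁ + c₂) : ℝ)) : ℂ) ^ 2 := by
    rw [← Complex.ofReal_pow, div_pow, div_pow]
    congr 2
    ring
  have hterm : ∀ k ∈ Finset.range (n + 1),
      ((A * (c₂ - c₁) ^ 2 : ℝ) : ℂ) ^ γ * ((((c₁ + c₂) / 2 : ℝ) : ℂ) ^ (n - k)
        * ((((c₂ - c₁) / 2 : ℝ) : ℂ) ^ k * n.choose k) * betaMoment γ k)
      = ((A * (c₂ - c₁) ^ 2 : ℝ) : ℂ) ^ γ * (((c₁ + c₂) / 2 : ℝ) : ℂ) ^ n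
        * ((n.choose k : ℂ) * (((c₂ - c₁) / (c₁ + c₂) : ℝ) : ℂ) ^ k * betaMoment γ k) := by
    intro k hk
    have hkn : k ≤ n := Nat.lt_succ_iff.1 (Finset.mem_range.1 hk)
    -- For `n = 0` only `k = 0` occurs, so the midpoint may be zero; otherwise it is factored out of
    -- every term.
    have e : (((c₁ + c₂) / 2 : ℝ) : ℂ) ^ (n - k) * (((c₂ - c₁) / 2 : ℝ) : ℂ) ^ k
        = (((c₁ + c₂) / 2 : ℝ) : ℂ) ^ n * (((c₂ - c₁) / (c₁ + c₂) : ℝ) : ℂ) ^ k := by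
      rcases hn with rfl | hn
      · simp [Nat.le_zero.1 hkn]
      · have h1 : (c₂ - c₁) / 2 = (c₁ + c₂) / 2 * ((c₂ - c₁) / (c₁ + c₂)) := by
          field_simp
        rw [h1, Complex.ofReal_mul, mul_pow, ← mul_assoc, ← pow_add, Nat.sub_add_cancel hkn]
    linear_combination ((A * (c₂ - c₁) ^ 2 : ℝ) : ℂ) ^ γ * n.choose k * betaMoment γ k * e
  rw [hy]
  refine Eq.trans (congrArg _ (Finset.sum_congr rfl hterm)) ?_
  rw [← Finset.mul_sum, hsum, Complex.real_smul]
  ring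

/-! ### Integrating out a quadratic variable -/

theorem ofReal_gram_ne_zero (W : Submodule ℝ (Mom L E)) {M : GramMat L E} (hM : M.PosDef) :
    ((gram W M : ℝ) : ℂ) ≠ 0 := by
  exact_mod_cast (gram_pos W hM).ne'

theorem integrand_add (ρ σ : Rep L E) {M : GramMat L E} (hM : M.PosDef) :
    integrand (ρ + σ) M = integrand ρ M * integrand σ M :=
  Finsupp.prod_add_index' (fun _ => Complex.cpow_zero _)
    fun W _ _ => Complex.cpow_add _ _ (ofReal_gram_ne_zero W hM)

theorem integrand_single (W : Submodule ℝ (Mom L E)) (γ : ℂ) (M : GramMat L E) :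
    integrand (Finsupp.single W γ) M = ((gram W M : ℝ) : ℂ) ^ γ :=
  Finsupp.prod_single_index (Complex.cpow_zero _)

theorem integrand_eq_mul_erase {ρ : Rep L E} {W : Submodule ℝ (Mom L E)} (hW : W ∈ ρ.support)
    (M : GramMat L E) :
    integrand ρ M = ((gram W M : ℝ) : ℂ) ^ ρ W * integrand (ρ.erase W) M :=
  (Finsupp.mul_prod_erase ρ W _ hW).symm

theorem integrand_erase_add_smul {ρ : Rep L E} {W : Submodule ℝ (Mom L E)} {δ : GramMat L E}
    (absent : ∀ W' ∈ ρ.support, W' ≠ W → IsAbsent δ W') {M : GramMat L E} (hM : M.IsSymm) (t : ℝ) :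
    integrand (ρ.erase W) (M + t • δ) = integrand (ρ.erase W) M := by
  classical
  refine Finsupp.prod_congr fun W' hW' => ?_
  rw [Finsupp.support_erase, Finset.mem_erase] at hW'
  rw [absent W' hW'.2 hW'.1 M hM]

theorem cpow_eq_exp_log {r : ℝ} (hr : 0 < r) (s : ℂ) :
    (r : ℂ) ^ s = Complex.exp (Real.log r * s) := by
  rw [Complex.cpow_def_of_ne_zero (by exact_mod_cast hr.ne'), Complex.ofReal_log hr.le]

theorem eq_of_roots {a b c r₁ r₂ : ℝ} (hr : r₁ ≠ r₂) (h₁ : a * r₁ ^ 2 + b * r₁ + c = 0)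
    (h₂ : a * r₂ ^ 2 + b * r₂ + c = 0) : b = -(a * (r₁ + r₂)) ∧ c = a * (r₁ * r₂) := by
  have hb : b = -(a * (r₁ + r₂)) := by
    refine mul_left_cancel₀ (sub_ne_zero.2 hr) ?_
    linear_combination h₁ - h₂
  refine ⟨hb, ?_⟩
  rw [hb] at h₁
  linear_combination h₁

/-- Between the roots `G(W)` is `a * X * (x - c₁) * (c₂ - x)`, and the other factors are constant.
The discriminant identity expresses `c₂ - c₁` by the three minors, which turns `(c₂ - c₁) ^ (2 * γ +
1) * X ^ γ` into the new product of powers. -/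
theorem IsCornerFrame.integral_eq {δ : GramMat L E} {W : Submodule ℝ (Mom L E)} {m : ℕ}
    {e : Fin (m + 2) → Mom L E} (h : IsCornerFrame δ W e) {ρ : Rep L E} (hW : W ∈ ρ.support)
    (absent : ∀ W' ∈ ρ.support, W' ≠ W → IsAbsent δ W') (hγ : -1 < (ρ W).re) :
    ∃ κ : ℂ, κ ≠ 0 ∧ ∀ M : GramMat L E, M.PosDef → ∀ x₀ c₁ c₂ : ℝ, c₁ < c₂ →
      gram W (M + (c₁ - x₀) • δ) = 0 → gram W (M + (c₂ - x₀) • δ) = 0 →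
      ∀ n : ℕ, (n = 0 ∨ c₁ + c₂ ≠ 0) →
        ∫ x in c₁..c₂, (x : ℂ) ^ n * integrand ρ (M + (x - x₀) • δ)
          = κ * integrand (replaceGram ρ W e) M * (((c₁ + c₂) / 2 : ℝ) : ℂ) ^ n
            * ordinaryHypergeometric (-(n : ℂ) / 2) ((1 - (n : ℂ)) / 2) (3 / 2 + ρ W)
              ((((c₁ - c₂) / (c₁ + c₂)) ^ 2 : ℝ) : ℂ) := by
  obtain ⟨a, ha, hg⟩ := exists_gram_eq h.1 h.2.1
  obtain ⟨aX, haX, hgX⟩ := exists_gram_eq h.linearIndependent_frameX rfl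
  obtain ⟨a1, ha1, hg1⟩ := exists_gram_eq h.linearIndependent_frame1X rfl
  obtain ⟨an, han, hgn⟩ := exists_gram_eq h.linearIndependent_frameXn rfl
  set γ := ρ W with hγdef
  -- The powers of `a`, `aX`, `a1`, `an` account for the bases used in `gram`; the power of `2`
  -- comes from the factor `4` in the discriminant.
  refine ⟨betaMoment γ 0 * Complex.exp (Real.log a * γ + Real.log 2 * (2 * γ + 1)
    + Real.log aX * (1 + γ) - (Real.log a1 + Real.log an) * (γ + 1 / 2)),
    mul_ne_zero (betaMoment_zero_ne_zero hγ) (Complex.exp_ne_zero _), ?_⟩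
  intro M hM x₀ c₁ c₂ hc h₁ h₂ n hn
  have pX := gramDet_pos h.linearIndependent_frameX hM
  have p1 := gramDet_pos h.linearIndependent_frame1X hM
  have pn := gramDet_pos h.linearIndependent_frameXn hM
  have hD : 0 < c₂ - c₁ := sub_pos.2 hc
  obtain ⟨B, C, hq, hdisc⟩ := h.gramDet_quadratic (M := M) hM.1
  set X := gramDet (frameX e) M with hX
  have hroot : ∀ c : ℝ, gram W (M + (c - x₀) • δ) = 0 →
      X * (c - x₀) ^ 2 + B * (c - x₀) + C = 0 := by
    intro c hc0
    rw [hg, hq] at hc0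
    have := (mul_eq_zero.1 hc0).resolve_left ha.ne'
    linarith
  obtain ⟨hB, hC⟩ := eq_of_roots (by simpa using hc.ne : c₁ - x₀ ≠ c₂ - x₀) (hroot _ h₁) (hroot _ h₂)
  have hgram : ∀ x : ℝ, gram W (M + (x - x₀) • δ) = a * X * ((x - c₁) * (c₂ - x)) := by
    intro x
    rw [hg, hq, hB, hC]
    ring
  have hint : ∀ x : ℝ, (x : ℂ) ^ n * integrand ρ (M + (x - x₀) • δ)
      = (x : ℂ) ^ n * ((a * X * ((x - c₁) * (c₂ - x)) : ℝ) : ℂ) ^ γ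
        * integrand (ρ.erase W) M := by
    intro x
    rw [integrand_eq_mul_erase hW, integrand_erase_add_smul (M := M) absent hM.1, hgram, ← mul_assoc]
  simp only [hint]
  rw [intervalIntegral.integral_mul_const,
    integral_quadratic_cpow hγ (mul_pos ha pX) hc n hn]
  have hDX : X ^ 2 * (c₂ - c₁) ^ 2 = 4 * gramDet (frame1X e) M * gramDet (frameXn e) M := by
    rw [← hdisc, hB, hC]
    ring
  -- All bases are positive, so after taking logarithms the identity of complex powers is linear in
  -- this relation.
  have hlog : 2 * Real.log (c₂ - c₁) = 2 * Real.log 2 + Real.log (gramDet (frame1X e) M)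
      + Real.log (gramDet (frameXn e) M) - 2 * Real.log X := by
    have h1 := congrArg Real.log hDX
    rw [Real.log_mul (by positivity) (by positivity), Real.log_mul (by positivity) pn.ne',
      Real.log_mul (by norm_num) p1.ne', Real.log_pow, Real.log_pow,
      show (4 : ℝ) = 2 ^ 2 by norm_num, Real.log_pow] at h1
    push_cast at h1
    linarith
  have hlog' := congrArg (Complex.ofReal) hlog
  push_cast at hlog'
  have hD' : ((c₂ - c₁ : ℝ) : ℂ) = Complex.exp (Real.log (c₂ - c₁)) := by
    rw [← Complex.ofReal_exp, Real.exp_log hD]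
  have key : ((c₂ - c₁ : ℝ) : ℂ) * ((a * X * (c₂ - c₁) ^ 2 : ℝ) : ℂ) ^ γ
      = Complex.exp (Real.log a * γ + Real.log 2 * (2 * γ + 1)
          + Real.log aX * (1 + γ) - (Real.log a1 + Real.log an) * (γ + 1 / 2))
        * (((gram (Submodule.span ℝ (Set.range (frameX e))) M : ℝ) : ℂ) ^ (-1 - γ)
          * ((gram (Submodule.span ℝ (Set.range (frame1X e))) M : ℝ) : ℂ) ^ (γ + 1 / 2)
          * ((gram (Submodule.span ℝ (Set.range (frameXn e))) M : ℝ) : ℂ) ^ (γ + 1 / 2)) := by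
    rw [hD', cpow_eq_exp_log (by positivity), cpow_eq_exp_log (gram_pos _ hM),
      cpow_eq_exp_log (gram_pos _ hM), cpow_eq_exp_log (gram_pos _ hM), hgX, hg1, hgn,
      Real.log_mul haX.ne' pX.ne', Real.log_mul ha1.ne' p1.ne', Real.log_mul han.ne' pn.ne',
      Real.log_mul (mul_pos ha pX).ne' (by positivity), Real.log_mul ha.ne' pX.ne', Real.log_pow,
      ← Complex.exp_add, ← Complex.exp_add, ← Complex.exp_add, ← Complex.exp_add]
    congr 1
    push_cast
    linear_combination (γ + 1 / 2) * hlog'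
  rw [replaceGram, integrand_add _ _ hM, integrand_add _ _ hM, integrand_add _ _ hM,
    integrand_single, integrand_single, integrand_single, ← hγdef]
  linear_combination betaMoment γ 0 * integrand (ρ.erase W) M * (((c₁ + c₂) / 2 : ℝ) : ℂ) ^ n
    * ordinaryHypergeometric (-(n : ℂ) / 2) ((1 - (n : ℂ)) / 2) (3 / 2 + γ)
      ((((c₁ - c₂) / (c₁ + c₂)) ^ 2 : ℝ) : ℂ) * key

/-! ### The number of Gram polynomials -/

theorem mem_ext {q : Mom L E} : q ∈ ext L E ↔ ∀ i, q (Sum.inl i) = 0 := Iff.rfl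

/-- The external momenta are given by their coefficients. -/
def extEquiv (L E : ℕ) : ext L E ≃ₗ[ℝ] (Fin E → ℝ) where
  toFun q j := (q : Mom L E) (Sum.inr j)
  map_add' _ _ := rfl
  map_smul' _ _ := rfl
  invFun c := ⟨Sum.elim 0 c, fun _ => rfl⟩
  left_inv q := by
    ext (i | j)
    · exact (q.2 i).symm
    · rfl
  right_inv _ := rfl

theorem finrank_ext : Module.finrank ℝ (ext L E) = E := by
  rw [(extEquiv L E).finrank_eq, Module.finrank_fin_fun]

theorem finrank_top_mom : Module.finrank ℝ (⊤ : Submodule ℝ (Mom L E)) = L + E := by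
  rw [finrank_top]
  simp

theorem ext_lt_top (hL : 1 ≤ L) : ext L E < ⊤ := by
  refine lt_of_le_of_ne le_top fun h => ?_
  have := finrank_top_mom (L := L) (E := E)
  rw [← h, finrank_ext] at this
  omega

open Classical in
/-- The number of polynomials, with multiplicity, of the spaces satisfying `p`. -/
def countOf (p : Submodule ℝ (Mom L E) → Prop) : (Submodule ℝ (Mom L E) →₀ ℤ) →ₗ[ℤ] ℤ :=
  Finsupp.linearCombination ℤ fun W => if p W then 1 else 0

open Classical in
theorem countOf_single (p : Submodule ℝ (Mom L E) → Prop) (W : Submodule ℝ (Mom L E)) :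
    countOf p (Finsupp.single W 1) = if p W then 1 else 0 := by
  simp [countOf]

/-- The sum of the dimensions, with multiplicity. -/
def dimOf : (Submodule ℝ (Mom L E) →₀ ℤ) →ₗ[ℤ] ℤ :=
  Finsupp.linearCombination ℤ fun W => (Module.finrank ℝ W : ℤ)

theorem dimOf_single (W : Submodule ℝ (Mom L E)) :
    dimOf (Finsupp.single W 1) = Module.finrank ℝ W := by
  simp [dimOf]

/-- The formal difference of two spaces. -/
def diffOf (p : Submodule ℝ (Mom L E) × Submodule ℝ (Mom L E)) : Submodule ℝ (Mom L E) →₀ ℤ :=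
  Finsupp.single p.1 1 - Finsupp.single p.2 1

/-- Multiplicities of Gram polynomials that behave like those of the cliques and separators of a
junction tree. -/
structure IsTreeLike (k : Submodule ℝ (Mom L E) →₀ ℤ) : Prop where
  count_eq : ∀ U W, ¬ U ≤ ext L E → U ≤ W → k W ≠ 0 → countOf (fun W' => U ≤ W') k = 1
  pairs : ∃ T : Multiset (Submodule ℝ (Mom L E) × Submodule ℝ (Mom L E)),
    (∀ p ∈ T, p.2 < p.1) ∧ k = (T.map diffOf).sum
  ext_count : countOf (fun W => W ≤ ext L E) k ≤ -1
  dim_eq : dimOf k = L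

theorem isTreeLike_root (hL : 1 ≤ L) :
    IsTreeLike (diffOf ((⊤ : Submodule ℝ (Mom L E)), ext L E)) where
  count_eq U W hU _ _ := by
    rw [diffOf, map_sub, countOf_single, countOf_single, if_pos le_top, if_neg hU, sub_zero]
  pairs := ⟨{(⊤, ext L E)}, by simpa using ext_lt_top hL, by simp⟩
  ext_count := by
    rw [diffOf, map_sub, countOf_single, countOf_single, if_pos le_rfl,
      if_neg (ext_lt_top hL).not_ge]
    norm_num
  dim_eq := by
    rw [diffOf, map_sub, dimOf_single, dimOf_single, finrank_top_mom, finrank_ext]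
    push_cast
    ring

/-- Two pairs `(A, B)` and `(B, C)` merge into `(A, C)` without changing the sum, and the number of
pairs drops. Afterwards no second component is cancelled by a first one, so it has negative
multiplicity. -/
theorem exists_reduced_pairs (T : Multiset (Submodule ℝ (Mom L E) × Submodule ℝ (Mom L E)))
    (hT : ∀ p ∈ T, p.2 < p.1) : ∃ T' : Multiset (Submodule ℝ (Mom L E) × Submodule ℝ (Mom L E)),
      (∀ p ∈ T', p.2 < p.1) ∧ (T'.map diffOf).sum = (T.map diffOf).sum ∧
      ∀ p ∈ T', ∀ q ∈ T', p.1 ≠ q.2 := by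
  induction hn : T.card using Nat.strong_induction_on generalizing T with
  | _ n ih =>
    by_cases h : ∀ p ∈ T, ∀ q ∈ T, p.1 ≠ q.2
    · exact ⟨T, hT, rfl, h⟩
    push Not at h
    obtain ⟨p, hp, q, hq, hpq⟩ := h
    obtain ⟨T₁, rfl⟩ := Multiset.exists_cons_of_mem hp
    have hqp : q ≠ p := by
      rintro rfl
      exact (hT q hp).ne hpq.symm
    obtain ⟨T₂, rfl⟩ := Multiset.exists_cons_of_mem ((Multiset.mem_cons.1 hq).resolve_left hqp)
    obtain ⟨T', h1, h2, h3⟩ := ih (T₂.card + 1) (by simp at hn; omega) ((q.1, p.2) ::ₘ T₂) (by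
      intro r hr
      rcases Multiset.mem_cons.1 hr with rfl | hr
      · exact (hT p hp).trans (hpq ▸ hT q hq)
      · exact hT r (by simp [hr])) (by simp)
    refine ⟨T', h1, h2.trans ?_, h3⟩
    simp only [Multiset.map_cons, Multiset.sum_cons, diffOf, hpq]
    abel

theorem sum_diffOf_apply (T : Multiset (Submodule ℝ (Mom L E) × Submodule ℝ (Mom L E)))
    (W : Submodule ℝ (Mom L E)) :
    (T.map diffOf).sum W = (T.map fun p => diffOf p W).sum :=
  (map_multiset_sum (Finsupp.applyAddHom W : (Submodule ℝ (Mom L E) →₀ ℤ) →+ ℤ) _).trans (by rw [Multiset.map_map]; rfl)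

theorem sum_diffOf_nonpos {T : Multiset (Submodule ℝ (Mom L E) × Submodule ℝ (Mom L E))}
    {W : Submodule ℝ (Mom L E)} (h : ∀ p ∈ T, p.1 ≠ W) : (T.map diffOf).sum W ≤ 0 := by
  classical
  rw [sum_diffOf_apply]
  refine (Multiset.sum_map_le_sum_map _ (fun _ => 0) fun p hp => ?_).trans_eq (by simp)
  rw [diffOf, Finsupp.sub_apply, Finsupp.single_apply, if_neg (h p hp), Finsupp.single_apply]
  split_ifs <;> norm_num

theorem sum_diffOf_neg {T : Multiset (Submodule ℝ (Mom L E) × Submodule ℝ (Mom L E))}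
    {W : Submodule ℝ (Mom L E)} (h : ∀ p ∈ T, p.1 ≠ W) (hW : ∃ p ∈ T, p.2 = W) :
    (T.map diffOf).sum W < 0 := by
  classical
  obtain ⟨p, hp, rfl⟩ := hW
  obtain ⟨T₁, rfl⟩ := Multiset.exists_cons_of_mem hp
  have h1 := sum_diffOf_nonpos (T := T₁) (W := p.2) fun q hq => h q (Multiset.mem_cons_of_mem hq)
  rw [Multiset.map_cons, Multiset.sum_cons, Finsupp.add_apply, diffOf, Finsupp.sub_apply,
    Finsupp.single_apply, if_neg (h p hp), Finsupp.single_eq_same]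
  omega

/-- The multiplicities after integrating out a variable. -/
def replaceMult {m : ℕ} (k : Submodule ℝ (Mom L E) →₀ ℤ) (W : Submodule ℝ (Mom L E))
    (e : Fin (m + 2) → Mom L E) : Submodule ℝ (Mom L E) →₀ ℤ :=
  k - Finsupp.single W 1 + Finsupp.single (Submodule.span ℝ (Set.range (frame1X e))) 1
    + Finsupp.single (Submodule.span ℝ (Set.range (frameXn e))) 1
    - Finsupp.single (Submodule.span ℝ (Set.range (frameX e))) 1

section

variable {δ : GramMat L E} {W : Submodule ℝ (Mom L E)} {m : ℕ} {e : Fin (m + 2) → Mom L E}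
  {k : Submodule ℝ (Mom L E) →₀ ℤ}

theorem IsCornerFrame.not_le_ext (h : IsCornerFrame δ W e) (hext : VanishesOn δ (ext L E)) :
    ¬ W ≤ ext L E := fun hle => h.not_vanishesOn (hext.mono hle)

/-- No other space of non-zero multiplicity contains `W`, because `δ` vanishes on those spaces but
not on `W`. So `count_eq` for `U = W` has the single term `k W`. -/
theorem IsTreeLike.eq_one (hk : IsTreeLike k) (hext : VanishesOn δ (ext L E))
    (h : IsCornerFrame δ W e) (hW : k W ≠ 0) (hv : ∀ W', W' ≠ W → k W' ≠ 0 → VanishesOn δ W') :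
    k W = 1 := by
  rw [← hk.count_eq W W (h.not_le_ext hext) le_rfl hW, countOf, Finsupp.linearCombination_apply,
    Finsupp.sum, Finset.sum_eq_single W]
  · simp
  · intro W' hW' hne
    rw [if_neg, smul_zero]
    exact fun hle => h.not_vanishesOn ((hv W' hne (Finsupp.mem_support_iff.1 hW')).mono hle)
  · intro hn
    exact absurd (Finsupp.mem_support_iff.2 hW) hn

theorem IsCornerFrame.frameX_lt_frame1X (h : IsCornerFrame δ W e) :
    Submodule.span ℝ (Set.range (frameX e)) < Submodule.span ℝ (Set.range (frame1X e)) := by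
  refine lt_of_le_of_ne (frameX_le_frame1X e) fun h0 => ?_
  have h1 := h.finrank_frame1X
  rw [← h0, h.finrank_frameX] at h1
  omega

theorem IsCornerFrame.frameX_lt_frameXn (h : IsCornerFrame δ W e) :
    Submodule.span ℝ (Set.range (frameX e)) < Submodule.span ℝ (Set.range (frameXn e)) := by
  refine lt_of_le_of_ne (frameX_le_frameXn e) fun h0 => ?_
  have h1 := h.finrank_frameXn
  rw [← h0, h.finrank_frameX] at h1
  omega

/-- For `U ≤ W` the replacement preserves the count exactly when `U` lies in one of the hyperplanes,
by inclusion-exclusion. It does: `U` lies in a hyperplane or in a surviving old space, where `δ`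
vanishes, and then `IsCornerFrame.le_or_le` applies. -/
theorem IsTreeLike.count_replace (hk : IsTreeLike k) (hδ : δ.IsSymm)
    (hext : VanishesOn δ (ext L E)) (h : IsCornerFrame δ W e) (hW : k W ≠ 0)
    (hv : ∀ W', W' ≠ W → k W' ≠ 0 → VanishesOn δ W') (U W₁ : Submodule ℝ (Mom L E))
    (hU : ¬ U ≤ ext L E) (hUW : U ≤ W₁) (hW₁ : replaceMult k W e W₁ ≠ 0) :
    countOf (fun W' => U ≤ W') (replaceMult k W e) = 1 := by
  classical
  have h1 := hk.eq_one hext h hW hv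
  -- Since `k W = 1`, the space `W` drops out unless it is one of the new spaces.
  have hcases : (W₁ ≠ W ∧ k W₁ ≠ 0) ∨ W₁ = Submodule.span ℝ (Set.range (frame1X e)) ∨
      W₁ = Submodule.span ℝ (Set.range (frameXn e)) ∨
      W₁ = Submodule.span ℝ (Set.range (frameX e)) := by
    by_contra! hcon
    obtain ⟨c1, c2, c3, c4⟩ := hcon
    refine hW₁ ?_
    simp only [replaceMult, Finsupp.sub_apply, Finsupp.add_apply, Finsupp.single_apply,
      if_neg c2.symm, if_neg c3.symm, if_neg c4.symm]
    by_cases hw : W₁ = W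
    · rw [hw, if_pos rfl, h1]; norm_num
    · rw [if_neg (Ne.symm hw), c1 hw]; norm_num
  simp only [replaceMult, map_sub, map_add, countOf_single]
  have hX : U ≤ Submodule.span ℝ (Set.range (frameX e)) ↔
      U ≤ Submodule.span ℝ (Set.range (frame1X e)) ∧
      U ≤ Submodule.span ℝ (Set.range (frameXn e)) := by
    rw [← h.frame1X_inf_frameXn, le_inf_iff]
  by_cases hUw : U ≤ W
  · rw [hk.count_eq U W hU hUw hW]
    have hor : U ≤ Submodule.span ℝ (Set.range (frame1X e)) ∨
        U ≤ Submodule.span ℝ (Set.range (frameXn e)) := by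
      rcases hcases with ⟨c1, c2⟩ | rfl | rfl | rfl
      · exact h.le_or_le hδ hUw ((hv W₁ c1 c2).mono hUW)
      · exact Or.inl hUW
      · exact Or.inr hUW
      · exact Or.inl (hX.1 hUW).1
    simp only [hX]
    rcases hor with c | c
    · by_cases c' : U ≤ Submodule.span ℝ (Set.range (frameXn e)) <;> simp [c, c', hUw]
    · by_cases c' : U ≤ Submodule.span ℝ (Set.range (frame1X e)) <;> simp [c, c', hUw]
  · have n1 : ¬ U ≤ Submodule.span ℝ (Set.range (frame1X e)) := fun c => hUw (c.trans h.frame1X_le)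
    have nn : ¬ U ≤ Submodule.span ℝ (Set.range (frameXn e)) := fun c => hUw (c.trans h.frameXn_le)
    have nX : ¬ U ≤ Submodule.span ℝ (Set.range (frameX e)) := fun c => n1 (hX.1 c).1
    have hkW₁ : k W₁ ≠ 0 := by
      rcases hcases with ⟨-, c⟩ | rfl | rfl | rfl
      · exact c
      · exact absurd hUW n1
      · exact absurd hUW nn
      · exact absurd hUW nX
    rw [hk.count_eq U W₁ hU hUW hkW₁]
    simp [hUw, n1, nn, nX]

/-- In reduced form `W` is the first component of a pair `(W, V)` and `V` has non-zero multiplicity.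
So `δ` vanishes on `V`, which therefore lies in a hyperplane `H`; the pair is replaced by `(H, V)`
and (other hyperplane, intersection). -/
theorem IsTreeLike.pairs_replace (hk : IsTreeLike k) (hδ : δ.IsSymm)
    (hext : VanishesOn δ (ext L E)) (h : IsCornerFrame δ W e) (hW : k W ≠ 0)
    (hv : ∀ W', W' ≠ W → k W' ≠ 0 → VanishesOn δ W') :
    ∃ T : Multiset (Submodule ℝ (Mom L E) × Submodule ℝ (Mom L E)),
      (∀ p ∈ T, p.2 < p.1) ∧ replaceMult k W e = (T.map diffOf).sum := by
  have h1 := hk.eq_one hext h hW hv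
  obtain ⟨T₀, hT₀, hkT₀⟩ := hk.pairs
  obtain ⟨T, hT, hTs, hred⟩ := exists_reduced_pairs T₀ hT₀
  rw [← hTs] at hkT₀
  obtain ⟨p, hp, hpW⟩ : ∃ p ∈ T, p.1 = W := by
    by_contra! hcon
    have := sum_diffOf_nonpos hcon
    rw [← hkT₀, h1] at this
    norm_num at this
  obtain ⟨W', V⟩ := p
  obtain rfl : W' = W := hpW
  have hVneg : k V < 0 := by
    rw [hkT₀]
    exact sum_diffOf_neg (fun q hq => hred q hq _ hp) ⟨_, hp, rfl⟩
  have hVW : V < W' := hT _ hp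
  have hor := h.le_or_le hδ hVW.le (hv V hVW.ne hVneg.ne)
  obtain ⟨T₁, rfl⟩ := Multiset.exists_cons_of_mem hp
  have hT₁ : ∀ p ∈ T₁, p.2 < p.1 := fun q hq => hT q (Multiset.mem_cons_of_mem hq)
  rw [Multiset.map_cons, Multiset.sum_cons, diffOf] at hkT₀
  rcases hor with c | c
  · rcases c.lt_or_eq with c | c
    · refine ⟨(Submodule.span ℝ (Set.range (frame1X e)), V) ::ₘ
        (Submodule.span ℝ (Set.range (frameXn e)), Submodule.span ℝ (Set.range (frameX e))) ::ₘ T₁,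
        ?_, ?_⟩
      · simpa [c, h.frameX_lt_frameXn] using hT₁
      · rw [replaceMult, hkT₀]
        simp only [Multiset.map_cons, Multiset.sum_cons, diffOf]
        abel
    -- Here `V` equals the hyperplane; the degenerate pair contributes zero and is omitted.
    · refine ⟨(Submodule.span ℝ (Set.range (frameXn e)),
        Submodule.span ℝ (Set.range (frameX e))) ::ₘ T₁, ?_, ?_⟩
      · simpa [h.frameX_lt_frameXn] using hT₁
      · rw [replaceMult, hkT₀, c]
        simp only [Multiset.map_cons, Multiset.sum_cons, diffOf]
        abel
  · rcases c.lt_or_eq with c | c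
    · refine ⟨(Submodule.span ℝ (Set.range (frameXn e)), V) ::ₘ
        (Submodule.span ℝ (Set.range (frame1X e)), Submodule.span ℝ (Set.range (frameX e))) ::ₘ T₁,
        ?_, ?_⟩
      · simpa [c, h.frameX_lt_frame1X] using hT₁
      · rw [replaceMult, hkT₀]
        simp only [Multiset.map_cons, Multiset.sum_cons, diffOf]
        abel
    · refine ⟨(Submodule.span ℝ (Set.range (frame1X e)),
        Submodule.span ℝ (Set.range (frameX e))) ::ₘ T₁, ?_, ?_⟩
      · simpa [h.frameX_lt_frame1X] using hT₁
      · rw [replaceMult, hkT₀, c]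
        simp only [Multiset.map_cons, Multiset.sum_cons, diffOf]
        abel

theorem IsTreeLike.replace (hk : IsTreeLike k) (hδ : δ.IsSymm)
    (hext : VanishesOn δ (ext L E)) (h : IsCornerFrame δ W e) (hW : k W ≠ 0)
    (hv : ∀ W', W' ≠ W → k W' ≠ 0 → VanishesOn δ W') : IsTreeLike (replaceMult k W e) where
  count_eq := hk.count_replace hδ hext h hW hv
  pairs := hk.pairs_replace hδ hext h hW hv
  ext_count := by
    classical
    have hx := hk.ext_count
    have hWe := h.not_le_ext hext
    have hX1 := frameX_le_frame1X e
    have hXn := frameX_le_frameXn e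
    -- Both end vectors cannot be external, since `δ` vanishes there. If one hyperplane is external,
    -- so is the intersection, and their contributions cancel; hence the count never increases.
    have hnot : ¬ (Submodule.span ℝ (Set.range (frame1X e)) ≤ ext L E ∧
        Submodule.span ℝ (Set.range (frameXn e)) ≤ ext L E) := by
      rintro ⟨c1, cn⟩
      have m0 : e 0 ∈ ext L E := c1 (Submodule.subset_span ⟨0, rfl⟩)
      have ml : e (Fin.last _) ∈ ext L E := cn (Submodule.subset_span ⟨Fin.last _, by simp [frameXn]⟩)
      have := hext _ m0 _ ml
      rw [h.2.2] at this
      simp at this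
    simp only [replaceMult, map_sub, map_add, countOf_single, if_neg hWe]
    by_cases c1 : Submodule.span ℝ (Set.range (frame1X e)) ≤ ext L E
    · have cn : ¬ Submodule.span ℝ (Set.range (frameXn e)) ≤ ext L E := fun c => hnot ⟨c1, c⟩
      rw [if_pos c1, if_neg cn, if_pos (hX1.trans c1)]
      omega
    · by_cases cn : Submodule.span ℝ (Set.range (frameXn e)) ≤ ext L E
      · rw [if_neg c1, if_pos cn, if_pos (hXn.trans cn)]
        omega
      · rw [if_neg c1, if_neg cn]
        split_ifs <;> omega
  dim_eq := by
    simp only [replaceMult, map_sub, map_add, dimOf_single, hk.dim_eq, h.finrank_eq,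
      h.finrank_frame1X, h.finrank_frameXn, h.finrank_frameX]
    push_cast
    ring

end

/-- Each strictly nested pair contributes at least `1` to the total dimension `L`. If no second
component were external, the count over external spaces would be non-negative, contradicting
`ext_count`. -/
theorem IsTreeLike.ncard_le {k : Submodule ℝ (Mom L E) →₀ ℤ} (hk : IsTreeLike k) :
    {W : Submodule ℝ (Mom L E) | k W ≠ 0 ∧ ¬ W ≤ ext L E}.ncard ≤ 2 * L - 1 := by
  classical
  obtain ⟨T, hT, hkT⟩ := hk.pairs
  have hcard : T.card ≤ L := by
    have h1 := hk.dim_eq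
    rw [hkT, map_multiset_sum, Multiset.map_map] at h1
    have h2 : (T.map fun _ => (1 : ℤ)).sum ≤ (T.map (dimOf ∘ diffOf)).sum := by
      refine Multiset.sum_map_le_sum_map _ _ fun p hp => ?_
      have := Submodule.finrank_lt_finrank_of_lt (hT p hp)
      simp only [Function.comp, diffOf, map_sub, dimOf_single]
      omega
    rw [h1] at h2
    simpa using h2
  obtain ⟨q, hq, hqe⟩ : ∃ q ∈ T, q.2 ≤ ext L E := by
    by_contra! hcon
    have h1 := hk.ext_count
    rw [hkT, map_multiset_sum, Multiset.map_map] at h1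
    have h2 : 0 ≤ (T.map (countOf (fun W => W ≤ ext L E) ∘ diffOf)).sum := by
      refine Multiset.sum_nonneg fun x hx => ?_
      obtain ⟨p, hp, rfl⟩ := Multiset.mem_map.1 hx
      simp only [Function.comp, diffOf, map_sub, countOf_single, if_neg (hcon p hp)]
      split_ifs <;> norm_num
    omega
  obtain ⟨T₁, rfl⟩ := Multiset.exists_cons_of_mem hq
  set A := ((q ::ₘ T₁).map Prod.fst).toFinset with hA
  set B := (T₁.map Prod.snd).toFinset with hB
  have hsub : {W : Submodule ℝ (Mom L E) | k W ≠ 0 ∧ ¬ W ≤ ext L E} ⊆ ((A ∪ B : Finset _) : Set _) := by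
    rintro W ⟨hW, hWe⟩
    by_contra hcon
    rw [Finset.mem_coe, Finset.mem_union, not_or, hA, hB, Multiset.mem_toFinset,
      Multiset.mem_toFinset] at hcon
    refine hW ?_
    rw [hkT, sum_diffOf_apply]
    refine Multiset.sum_eq_zero fun x hx => ?_
    obtain ⟨p, hp, rfl⟩ := Multiset.mem_map.1 hx
    have n1 : p.1 ≠ W := fun h0 => hcon.1 (Multiset.mem_map.2 ⟨p, hp, h0⟩)
    have n2 : p.2 ≠ W := by
      rintro rfl
      rcases Multiset.mem_cons.1 hp with rfl | hp
      · exact hWe hqe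
      · exact hcon.2 (Multiset.mem_map.2 ⟨p, hp, rfl⟩)
    rw [diffOf, Finsupp.sub_apply, Finsupp.single_apply, Finsupp.single_apply, if_neg n1,
      if_neg n2, sub_zero]
  have hc1 : A.card ≤ T₁.card + 1 := by
    refine (Multiset.toFinset_card_le _).trans ?_
    simp
  have hc2 : B.card ≤ T₁.card := by
    refine (Multiset.toFinset_card_le _).trans ?_
    simp
  rw [Multiset.card_cons] at hcard
  calc _ ≤ ((A ∪ B : Finset _) : Set (Submodule ℝ (Mom L E))).ncard :=
        Set.ncard_le_ncard hsub (Finset.finite_toSet _)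
    _ = (A ∪ B).card := Set.ncard_coe_finset _
    _ ≤ A.card + B.card := Finset.card_union_le _ _
    _ ≤ 2 * L - 1 := by omega

/-- The power of the Gram polynomial of a clique. -/
def gramPower (d : ℂ) (W : Submodule ℝ (Mom L E)) : ℂ := (d - Module.finrank ℝ W - 1) / 2

theorem gramPower_ne_zero {d : ℂ} (hd : ∀ k : ℤ, d ≠ k) (W : Submodule ℝ (Mom L E)) :
    gramPower d W ≠ 0 := by
  intro h
  refine hd (Module.finrank ℝ W + 1) ?_
  rw [gramPower, div_eq_zero_iff] at h
  push_cast
  linear_combination h.resolve_right two_ne_zero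

theorem single_eq_mul_gramPower {d c γ : ℂ} {V W : Submodule ℝ (Mom L E)}
    (hγ : γ = c * gramPower d V) :
    Finsupp.single V γ W = c * ((Finsupp.single V (1 : ℤ) W : ℤ) : ℂ) * gramPower d W := by
  by_cases h : V = W
  · subst h
    simp [hγ]
  · simp [Finsupp.single_eq_of_ne' h]

/-- With `γ = (d - dim W - 1) / 2`, the exponents `γ + 1 / 2` and `-1 - γ` are `gramPower` for
codimension one and minus `gramPower` for codimension two. So powers added for equal spaces match
added multiplicities. -/
theorem replaceGram_apply {d : ℂ} {δ : GramMat L E} {W : Submodule ℝ (Mom L E)} {m : ℕ}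
    {e : Fin (m + 2) → Mom L E} (h : IsCornerFrame δ W e) {ρ : Rep L E}
    {k : Submodule ℝ (Mom L E) →₀ ℤ} (hρ : ∀ W, ρ W = k W * gramPower d W) (hW : k W = 1)
    (W' : Submodule ℝ (Mom L E)) :
    replaceGram ρ W e W' = replaceMult k W e W' * gramPower d W' := by
  classical
  have hρW : ρ W = gramPower d W := by rw [hρ, hW]; simp
  have g0 : gramPower d W = (d - (m + 2) - 1) / 2 := by
    rw [gramPower, h.finrank_eq]; push_cast; ring
  have gX : gramPower d (Submodule.span ℝ (Set.range (frameX e))) = (d - m - 1) / 2 := by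
    rw [gramPower, h.finrank_frameX]
  have g1 : gramPower d (Submodule.span ℝ (Set.range (frame1X e))) = (d - (m + 1) - 1) / 2 := by
    rw [gramPower, h.finrank_frame1X]; push_cast; ring
  have gn : gramPower d (Submodule.span ℝ (Set.range (frameXn e))) = (d - (m + 1) - 1) / 2 := by
    rw [gramPower, h.finrank_frameXn]; push_cast; ring
  have he : ρ.erase W W' = (k W' - ((Finsupp.single W (1 : ℤ) W' : ℤ) : ℂ)) * gramPower d W' := by
    by_cases hw : W' = W
    · subst hw
      simp [hW]
    · rw [Finsupp.erase_ne hw, hρ, Finsupp.single_eq_of_ne hw]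
      simp
  rw [replaceGram, Finsupp.add_apply, Finsupp.add_apply, Finsupp.add_apply, he,
    single_eq_mul_gramPower (c := -1) (d := d) (by rw [hρW, g0, gX]; ring),
    single_eq_mul_gramPower (c := 1) (d := d) (by rw [hρW, g0, g1]; ring),
    single_eq_mul_gramPower (c := 1) (d := d) (by rw [hρW, g0, gn]; ring)]
  simp only [replaceMult, Finsupp.sub_apply, Finsupp.add_apply]
  push_cast
  ring

theorem Reachable.exists_isTreeLike (hL : 1 ≤ L) {F : IntegralFamily L E} {d : ℂ}
    (hd : ∀ k : ℤ, d ≠ k) {ν : Node L E} (hν : Reachable F d ν) :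
    ∃ k : Submodule ℝ (Mom L E) →₀ ℤ, IsTreeLike k ∧ ∀ W, ν.rep W = k W * gramPower d W := by
  induction hν with
  | refl =>
    refine ⟨_, isTreeLike_root hL, fun W => ?_⟩
    change standardRep L E d W = _
    rw [standardRep, Finsupp.add_apply,
      single_eq_mul_gramPower (c := 1) (d := d) (by
        rw [gramPower, finrank_top_mom]; push_cast; ring),
      single_eq_mul_gramPower (c := -1) (d := d) (by rw [gramPower, finrank_ext]; ring)]
    simp only [diffOf, Finsupp.sub_apply]
    push_cast
    ring
  | tail _ hstep ih =>
    obtain ⟨k, hk, hrep⟩ := ih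
    cases hstep with
    | redefine => exact ⟨k, hk, hrep⟩
    | pinch => exact ⟨k, hk, hrep⟩
    | integrate z _ _ δ _ W hW _ absent m e frame =>
      -- Since `d` is not an integer, a polynomial is present exactly when its multiplicity is
      -- non-zero.
      have hsupp : ∀ W', k W' ≠ 0 ↔ W' ∈ Finsupp.support (Node.rep _) := fun W' => by
        rw [Finsupp.mem_support_iff, hrep, mul_ne_zero_iff, and_iff_left (gramPower_ne_zero hd W'),
          Int.cast_ne_zero]
      have hkW := (hsupp W).2 hW
      have hv : ∀ W', W' ≠ W → k W' ≠ 0 → VanishesOn (δ : GramMat L E) W' := fun W' hne h0 =>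
        (absent W' ((hsupp W').1 h0) hne).vanishesOn (Dir.isSymm δ)
      exact ⟨replaceMult k W e, hk.replace (Dir.isSymm δ) (Dir.vanishesOn_ext δ) frame hkW hv,
        replaceGram_apply frame hrep (hk.eq_one (Dir.vanishesOn_ext δ) frame hkW hv)⟩

theorem Reachable.ncard_le (hL : 1 ≤ L) {F : IntegralFamily L E} {d : ℂ}
    (hd : ∀ k : ℤ, d ≠ k) {ν : Node L E} (hν : Reachable F d ν) :
    {W : Submodule ℝ (Mom L E) | ν.rep W ≠ 0 ∧ ¬ W ≤ ext L E}.ncard ≤ 2 * L - 1 := by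
  obtain ⟨k, hk, hrep⟩ := hν.exists_isTreeLike hL hd
  convert hk.ncard_le using 3
  ext W
  rw [hrep, mul_ne_zero_iff,
    and_iff_left (gramPower_ne_zero hd W), Int.cast_ne_zero]

/-! ### Momenta of the loops from a given one on -/

/-- The span of the external momenta and the loop momenta `l k`, `n ≤ k`. -/
def upper (l : Fin L → Mom L E) (n : ℕ) : Submodule ℝ (Mom L E) :=
  ext L E ⊔ Submodule.span ℝ (l '' {k | n ≤ (k : ℕ)})

theorem upper_anti (l : Fin L → Mom L E) {m n : ℕ} (h : m ≤ n) : upper l n ≤ upper l m :=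
  sup_le_sup_left (Submodule.span_mono (Set.image_mono fun _ hk => h.trans hk)) _

theorem ext_le_upper (l : Fin L → Mom L E) (n : ℕ) : ext L E ≤ upper l n := le_sup_left

theorem upper_last (l : Fin L → Mom L E) : upper l L = ext L E := by
  have : {k : Fin L | L ≤ (k : ℕ)} = ∅ := by
    ext k
    simp
  rw [upper, this, Set.image_empty, Submodule.span_empty, sup_bot_eq]

theorem span_sup_upper_succ (l : Fin L → Mom L E) (k : Fin L) :
    Submodule.span ℝ {l k} ⊔ upper l (k + 1) = upper l k := by
  have : {j : Fin L | (k : ℕ) ≤ j} = insert k {j : Fin L | (k : ℕ) + 1 ≤ j} := by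
    ext j
    simp only [Set.mem_insert_iff, Fin.ext_iff]
    change (k : ℕ) ≤ j ↔ (j : ℕ) = k ∨ (k : ℕ) + 1 ≤ j
    omega
  rw [upper, upper, this, Set.image_insert_eq, Submodule.span_insert, sup_left_comm]

/-- The coefficients of the loop momenta. -/
theorem exists_coord {l : Fin L → Mom L E} (h : ext L E ⊔ Submodule.span ℝ (Set.range l) = ⊤)
    (i : Fin L) : ∃ φ : Module.Dual ℝ (Mom L E), φ (l i) = 1 ∧ (∀ k, k ≠ i → φ (l k) = 0) ∧
      ext L E ≤ LinearMap.ker φ := by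
  -- Modulo external momenta the `L` loop momenta span a space of dimension `L`, so they form a
  -- basis; `φ` is a coordinate of it.
  have htop : ⊤ ≤ Submodule.span ℝ (Set.range fun k => (ext L E).mkQ (l k)) := by
    have h1 : (fun k => (ext L E).mkQ (l k)) = (ext L E).mkQ ∘ l := rfl
    rw [h1, Set.range_comp, ← Submodule.map_span]
    have h2 := congrArg (Submodule.map (ext L E).mkQ) h
    rw [Submodule.map_sup, Submodule.mkQ_map_self, bot_sup_eq, Submodule.map_top,
      Submodule.range_mkQ] at h2
    exact h2.ge
  have hcard : Fintype.card (Fin L) = Module.finrank ℝ (Mom L E ⧸ ext L E) := by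
    have h1 := Submodule.finrank_quotient_add_finrank (ext L E)
    rw [finrank_ext] at h1
    simp at h1
    simp
    omega
  let b := basisOfTopLeSpanOfCardEqFinrank _ htop hcard
  have hb : ∀ k, (ext L E).mkQ (l k) = b k := fun k => by simp [b]
  refine ⟨(b.coord i).comp (ext L E).mkQ, ?_, fun k hk => ?_, fun x hx => ?_⟩
  · rw [LinearMap.comp_apply, hb]
    simp
  · rw [LinearMap.comp_apply, hb]
    simp [Finsupp.single_eq_of_ne' hk]
  · rw [LinearMap.mem_ker, LinearMap.comp_apply, Submodule.mkQ_apply,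
      (Submodule.Quotient.mk_eq_zero _).2 hx, map_zero]

theorem upper_le_ker {l : Fin L → Mom L E} {φ : Module.Dual ℝ (Mom L E)} {n : ℕ}
    (hφ : ∀ k : Fin L, n ≤ k → φ (l k) = 0) (hext : ext L E ≤ LinearMap.ker φ) :
    upper l n ≤ LinearMap.ker φ := by
  refine sup_le hext (Submodule.span_le.2 ?_)
  rintro _ ⟨k, hk, rfl⟩
  exact hφ k hk

theorem notMem_upper {l : Fin L → Mom L E} (h : ext L E ⊔ Submodule.span ℝ (Set.range l) = ⊤)
    (i : Fin L) : l i ∉ upper l (i + 1) := by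
  obtain ⟨φ, h1, h2, h3⟩ := exists_coord h i
  intro hmem
  have := upper_le_ker (fun k hk => h2 k (by rintro rfl; omega)) h3 hmem
  rw [LinearMap.mem_ker, h1] at this
  exact one_ne_zero this

theorem finrank_span_sup {x : Mom L E} {V : Submodule ℝ (Mom L E)} (h : x ∉ V) :
    Module.finrank ℝ (Submodule.span ℝ {x} ⊔ V : Submodule ℝ (Mom L E))
      = Module.finrank ℝ V + 1 := by
  rw [sup_comm, Submodule.finrank_sup_span_singleton h]

theorem finrank_upper {l : Fin L → Mom L E} (h : ext L E ⊔ Submodule.span ℝ (Set.range l) = ⊤)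
    (m : ℕ) : ∀ n, n + m = L → Module.finrank ℝ (upper l n) = E + m := by
  induction m with
  | zero =>
    intro n hn
    rw [show n = L by omega, upper_last, finrank_ext, add_zero]
  | succ m ih =>
    intro n hn
    have := finrank_span_sup (notMem_upper h ⟨n, by omega⟩)
    rw [span_sup_upper_succ l ⟨n, by omega⟩] at this
    rw [this, ih (n + 1) (by omega)]
    ring

/-! ### Loop-by-loop changes of variables -/

section

variable {F : IntegralFamily L E} {S : Finset (Fin (L * (L + 1) / 2 + L * E))}

theorem LoopByLoop.V_le_upper (Λ : LoopByLoop F S) (i : Fin L) : Λ.V i ≤ upper Λ.l (i + 1) :=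
  Λ.V_le i

theorem LoopByLoop.le_block (Λ : LoopByLoop F S) (i : Fin L) : Λ.V i ≤ Λ.block i := le_sup_right

theorem LoopByLoop.l_mem_block (Λ : LoopByLoop F S) (i : Fin L) : Λ.l i ∈ Λ.block i :=
  (le_sup_left : _ ≤ Λ.block i) (Submodule.mem_span_singleton_self _)

theorem LoopByLoop.block_le_upper (Λ : LoopByLoop F S) (i : Fin L) :
    Λ.block i ≤ upper Λ.l i := by
  rw [← span_sup_upper_succ]
  exact sup_le_sup_left (Λ.V_le_upper i) _

theorem LoopByLoop.block_le_iff (Λ : LoopByLoop F S) (i : Fin L) (U : Submodule ℝ (Mom L E)) :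
    Λ.block i ≤ U ↔ Λ.l i ∈ U ∧ Λ.V i ≤ U := by
  rw [LoopByLoop.block, sup_le_iff, Submodule.span_singleton_le_iff_mem]

theorem LoopByLoop.finrank_block (Λ : LoopByLoop F S) (i : Fin L) :
    Module.finrank ℝ (Λ.block i) = Λ.numExt i + 1 :=
  finrank_span_sup fun h => notMem_upper Λ.span_eq i (Λ.V_le_upper i h)

/-- The external momenta of a loop are external or available to a later loop. -/
theorem LoopByLoop.V_le_ext_or (Λ : LoopByLoop F S) (j : Fin L) :
    Λ.V j ≤ ext L E ∨ ∃ k, j < k ∧ Λ.V j ≤ Λ.block k := by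
  classical
  refine or_iff_not_imp_left.2 fun h => ?_
  -- The least such index is one more than that of the first loop momentum on which `V j` depends;
  -- condition `seen` applies to that loop.
  have hex : ∃ n, ¬ Λ.V j ≤ upper Λ.l n := ⟨L, by rwa [upper_last]⟩
  have hspec := Nat.find_spec hex
  have hmin := fun m => Nat.find_min hex (m := m)
  have hle : Nat.find hex ≤ L := Nat.find_min' hex (by rwa [upper_last])
  have hlt : (j : ℕ) + 1 < Nat.find hex := by
    by_contra hcon
    exact hspec ((Λ.V_le_upper j).trans (upper_anti _ (not_lt.1 hcon)))
  obtain ⟨n, hn⟩ : ∃ n, Nat.find hex = n + 1 := ⟨Nat.find hex - 1, by omega⟩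
  rw [hn] at hspec hle hlt
  refine ⟨⟨n, by omega⟩, by rw [Fin.lt_def]; simp; omega, Λ.seen j ⟨n, by omega⟩
    (by rw [Fin.lt_def]; simp; omega) ?_ hspec⟩
  exact not_not.1 (hmin n (by omega))

/-- A pair of functionals detecting `l i` and `u`, one of which vanishes on each of the other
blocks. -/
theorem LoopByLoop.exists_functionals (Λ : LoopByLoop F S) (i : Fin L) {u : Mom L E}
    (hu : u ∈ upper Λ.l (i + 1)) (huV : u ∉ Λ.V i) :
    ∃ φ ψ : Module.Dual ℝ (Mom L E), φ (Λ.l i) = 1 ∧ upper Λ.l (i + 1) ≤ LinearMap.ker φ ∧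
      ψ u = 1 ∧ Λ.block i ≤ LinearMap.ker ψ ∧
      ∀ j, j ≠ i → Λ.block j ≤ LinearMap.ker φ ∨ Λ.block j ≤ LinearMap.ker ψ := by
  suffices H : ∀ m : ℕ, ∃ φ ψ : Module.Dual ℝ (Mom L E), φ (Λ.l i) = 1 ∧
      upper Λ.l (i + 1) ≤ LinearMap.ker φ ∧ ψ u = 1 ∧ Λ.block i ≤ LinearMap.ker ψ ∧
      ∀ j : Fin L, j < i → (i : ℕ) ≤ j + m →
        Λ.block j ≤ LinearMap.ker φ ∨ Λ.block j ≤ LinearMap.ker ψ by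
    obtain ⟨φ, ψ, h1, h2, h3, h4, h5⟩ := H i
    refine ⟨φ, ψ, h1, h2, h3, h4, fun j hj => ?_⟩
    rcases lt_or_gt_of_ne hj with hj | hj
    · exact h5 j hj (by omega)
    · exact Or.inl ((Λ.block_le_upper j).trans ((upper_anti _ hj).trans h2))
  -- Blocks before `i` are treated by descending index, `m` being the number treated so far; later
  -- blocks lie in `upper Λ.l (i + 1)`, which `φ` kills.
  intro m
  induction m with
  | zero =>
    obtain ⟨φ, h1, h2, h3⟩ := exists_coord Λ.span_eq i
    have hker : upper Λ.l (i + 1) ≤ LinearMap.ker φ :=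
      upper_le_ker (fun k hk => h2 k (by rintro rfl; omega)) h3
    -- Applying `φ` shows that a representation of `u` in the block has no `l i` component.
    have hub : u ∉ Λ.block i := by
      intro hmem
      obtain ⟨y, hy, v, hv, rfl⟩ := Submodule.mem_sup.1 hmem
      obtain ⟨c, rfl⟩ := Submodule.mem_span_singleton.1 hy
      have e1 := hker hu
      have e2 := hker (Λ.V_le_upper i hv)
      rw [LinearMap.mem_ker] at e1 e2
      rw [map_add, map_smul, h1, e2, smul_eq_mul, mul_one, add_zero] at e1
      rw [e1, zero_smul, zero_add] at huV
      exact huV hv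
    obtain ⟨f, hf, hfk⟩ := Submodule.exists_le_ker_of_notMem hub
    refine ⟨φ, (f u)⁻¹ • f, h1, hker, ?_, fun x hx => ?_, fun j hj hj' => ?_⟩
    · simp [hf]
    · have := hfk hx
      rw [LinearMap.mem_ker] at this ⊢
      simp [this]
    · rw [Fin.lt_def] at hj
      omega
  | succ m ih =>
    obtain ⟨φ, ψ, h1, h2, h3, h4, h5⟩ := ih
    by_cases hm : m + 1 ≤ (i : ℕ)
    swap
    · exact ⟨φ, ψ, h1, h2, h3, h4, fun j hj hj' => h5 j hj (by omega)⟩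
    let n : Fin L := ⟨i - (m + 1), by omega⟩
    have hn : (n : ℕ) + (m + 1) = i := by simp only [n]; omega
    -- The coordinate `c` of `l n` vanishes on everything after loop `n`, so multiples of it can be
    -- subtracted from `φ` or `ψ` without spoiling what was achieved.
    obtain ⟨c, c1, c2, c3⟩ := exists_coord Λ.span_eq n
    have hc : upper Λ.l (n + 1) ≤ LinearMap.ker c :=
      upper_le_ker (fun k hk => c2 k (by rintro rfl; omega)) c3
    have hcj : ∀ j : Fin L, n < j → Λ.block j ≤ LinearMap.ker c := fun j hj =>
      (Λ.block_le_upper j).trans ((upper_anti _ hj).trans hc)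
    have hsub : ∀ (f : Module.Dual ℝ (Mom L E)) (a : ℝ) (U : Submodule ℝ (Mom L E)),
        U ≤ LinearMap.ker c → U ≤ LinearMap.ker f → U ≤ LinearMap.ker (f - a • c) := by
      intro f a U hU hf x hx
      have e1 := hU hx
      have e2 := hf hx
      rw [LinearMap.mem_ker] at e1 e2 ⊢
      simp [e1, e2]
    have hni : n < i := by rw [Fin.lt_def]; omega
    have hup : upper Λ.l (i + 1) ≤ LinearMap.ker c :=
      (upper_anti _ (by omega)).trans hc
    have hli : c (Λ.l i) = 0 := hcj i hni (Λ.l_mem_block i)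
    have hcu : c u = 0 := hup hu
    -- `V n` is external or inside a later block, hence already in one of the kernels. The
    -- functional that kills `V n` is then corrected to kill `l n` as well.
    have hV : Λ.V n ≤ LinearMap.ker φ ∨ Λ.V n ≤ LinearMap.ker ψ := by
      rcases Λ.V_le_ext_or n with h | ⟨k, hk, h⟩
      · exact Or.inl (h.trans ((ext_le_upper _ _).trans h2))
      · rcases lt_trichotomy k i with hki | rfl | hki
        · rw [Fin.lt_def] at hk
          rcases h5 k hki (by omega) with h' | h'
          · exact Or.inl (h.trans h')
          · exact Or.inr (h.trans h')
        · exact Or.inr (h.trans h4)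
        · exact Or.inl (h.trans ((Λ.block_le_upper k).trans ((upper_anti _ hki).trans h2)))
    have hVc : Λ.V n ≤ LinearMap.ker c := (Λ.V_le_upper n).trans hc
    have hcase : ∀ j : Fin L, j < i → (i : ℕ) ≤ j + (m + 1) → j = n ∨ (n < j ∧ (i : ℕ) ≤ j + m) := by
      intro j _ hj
      rw [Fin.ext_iff, Fin.lt_def]
      omega
    rcases hV with hV | hV
    · refine ⟨φ - φ (Λ.l n) • c, ψ, by simp [h1, hli], hsub _ _ _ hup h2, h3, h4,
        fun j hj hj' => ?_⟩
      rcases hcase j hj hj' with rfl | ⟨hnj, hj''⟩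
      · refine Or.inl ((Λ.block_le_iff _ _).2 ⟨?_, hsub _ _ _ hVc hV⟩)
        simp [c1]
      · rcases h5 j hj hj'' with h | h
        · exact Or.inl (hsub _ _ _ (hcj j hnj) h)
        · exact Or.inr h
    · refine ⟨φ, ψ - ψ (Λ.l n) • c, h1, h2, by simp [h3, hcu], hsub _ _ _ (hcj i hni) h4,
        fun j hj hj' => ?_⟩
      rcases hcase j hj hj' with rfl | ⟨hnj, hj''⟩
      · refine Or.inr ((Λ.block_le_iff _ _).2 ⟨?_, hsub _ _ _ hVc hV⟩)
        simp [c1]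
      · rcases h5 j hj hj'' with h | h
        · exact Or.inl h
        · exact Or.inr (hsub _ _ _ (hcj j hnj) h)

/-- The changes of the scalar products that do not affect the blocks. -/
def LoopByLoop.fixing (Λ : LoopByLoop F S) : Submodule ℝ (Dir L E) where
  carrier := {δ | ∀ i, VanishesOn (δ : GramMat L E) (Λ.block i)}
  add_mem' := by
    intro a b ha hb i v hv w hw
    have h1 := ha i v hv w hw
    have h2 := hb i v hv w hw
    have h3 := sp_add_smul (a : GramMat L E) (b : GramMat L E) 1 v w
    rw [one_smul, h1, h2] at h3
    simpa using h3
  zero_mem' := by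
    intro i v _ w _
    simp [sp]
  smul_mem' := by
    intro c a ha i v hv w hw
    have h1 := ha i v hv w hw
    have h3 := sp_add_smul (0 : GramMat L E) (a : GramMat L E) c v w
    rw [h1, zero_add] at h3
    simpa [sp] using h3

/-- A loop-by-loop representation is reached, with Baikov variables that span the functions of the
scalar products within the blocks. -/
def LoopByLoop.Reached (Λ : LoopByLoop F S) (d : ℂ) : Prop :=
  ∃ ν : Node L E, Reachable F d ν ∧ ν.sector = S ∧ ν.rep = Λ.rep d ∧
    ν.vars.card = ∑ i, (Λ.numExt i + 1) ∧
    LinearIndepOn ℝ id (ν.vars : Set (Module.Dual ℝ (Dir L E))) ∧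
    Submodule.span ℝ (ν.vars : Set (Module.Dual ℝ (Dir L E))) = Λ.fixing.dualAnnihilator

end

/-! ### The root of the tree -/

theorem finrank_dir_le : Module.finrank ℝ (Dir L E) ≤ L * (L + 1) / 2 + L * E := by
  let f : Dir L E →ₗ[ℝ] (Sym2 (Fin L) ⊕ (Fin L × Fin E) → ℝ) :=
    { toFun := fun δ => Sum.elim
        (Sym2.lift ⟨fun i j => (δ : GramMat L E) (Sum.inl i) (Sum.inl j),
          fun i j => ((Dir.isSymm δ).apply _ _)⟩)
        fun p => (δ : GramMat L E) (Sum.inl p.1) (Sum.inr p.2)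
      map_add' := by
        intro a b
        ext (i | i)
        · induction i with
          | h i j => rfl
        · rfl
      map_smul' := by
        intro c a
        ext (i | i)
        · induction i with
          | h i j => rfl
        · rfl }
  have hf : Function.Injective f := by
    rw [← LinearMap.ker_eq_bot, LinearMap.ker_eq_bot']
    intro δ hδ
    have h1 : ∀ i j, (δ : GramMat L E) (Sum.inl i) (Sum.inl j) = 0 := fun i j =>
      congrFun hδ (Sum.inl s(i, j))
    have h2 : ∀ i j, (δ : GramMat L E) (Sum.inl i) (Sum.inr j) = 0 := fun i j =>
      congrFun hδ (Sum.inr (i, j))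
    ext (i | i) (j | j)
    · exact h1 i j
    · exact h2 i j
    · exact ((Dir.isSymm δ).apply _ _).trans (h2 j i)
    · exact δ.2.2 i j
  refine (LinearMap.finrank_le_finrank_of_injective hf).trans_eq ?_
  rw [Module.finrank_fintype_fun_eq_card, Fintype.card_sum, Sym2.card, Fintype.card_prod,
    Fintype.card_fin, Fintype.card_fin, Nat.choose_two_right, Nat.add_sub_cancel, mul_comm (L + 1)]

/-- The `N` independent functionals live in a dual space of dimension at most `N`, so they span it;
only the upper bound on the dimension of `Dir L E` is needed. -/
theorem span_range_x (F : IntegralFamily L E) : Submodule.span ℝ (Set.range F.x) = ⊤ := by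
  refine Submodule.eq_top_of_finrank_eq (le_antisymm (Submodule.finrank_le _) ?_)
  rw [finrank_span_eq_card F.indep, Fintype.card_fin, Subspace.dual_finrank_eq]
  exact finrank_dir_le

theorem sum_loops (L E : ℕ) : ∑ i ∈ Finset.range L, (E + (L - (i + 1)) + 1) = L * (L + 1) / 2 + L * E := by
  have h : ∑ i ∈ Finset.range L, (E + (L - (i + 1)) + 1) = ∑ i ∈ Finset.range L, (E + i + 1) := by
    rw [← Finset.sum_range_reflect]
    refine Finset.sum_congr rfl fun i hi => ?_
    have := Finset.mem_range.1 hi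
    omega
  rw [h]
  clear h
  induction L with
  | zero => simp
  | succ L ih =>
    rw [Finset.sum_range_succ, ih]
    have e1 : (L + 1) * (L + 1 + 1) = L * (L + 1) + 2 * (L + 1) := by ring
    rw [e1, Nat.add_mul_div_left _ _ (by norm_num)]
    ring

section

variable {F : IntegralFamily L E} {S : Finset (Fin (L * (L + 1) / 2 + L * E))}

-- With maximal external spaces, `block i` is `upper i` and `V i` is `upper (i + 1)`, so the product
-- telescopes and pinching the root is enough. The first block contains all momenta, so `fixing` is
-- trivial.
open Classical in
theorem LoopByLoop.reached_of_V_eq_upper (hL : 1 ≤ L) {d : ℂ} (hS : S ⊆ F.top)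
    (Λ : LoopByLoop F S) (hΛ : ∀ i, Λ.V i = upper Λ.l (i + 1)) : Λ.Reached d := by
  have hb : ∀ i, Λ.block i = upper Λ.l i := fun i => by
    rw [LoopByLoop.block, hΛ, span_sup_upper_succ]
  have htop : upper Λ.l 0 = ⊤ := by
    rw [← Λ.span_eq, upper]
    congr 3
    rw [← Set.image_univ]
    congr 1
    ext k
    simp
  have hnum : ∀ i : Fin L, Λ.numExt i = E + (L - (i + 1)) := fun i => by
    rw [LoopByLoop.numExt, hΛ]
    exact finrank_upper Λ.span_eq _ _ (by omega)
  refine ⟨⟨S, (root F d).vars, (root F d).rep⟩,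
    Relation.ReflTransGen.single (Step.pinch (root F d) S hS), rfl, ?_, ?_, ?_, ?_⟩
  · change standardRep L E d = _
    let G : ℕ → Rep L E := fun n => Finsupp.single (upper Λ.l n) (gramPower d (upper Λ.l n))
    have hG : ∀ i : Fin L, Finsupp.single (Λ.block i) ((d - Λ.numExt i - 2) / 2)
        + Finsupp.single (Λ.V i) (-(d - Λ.numExt i - 1) / 2) = G i - G (i + 1) := by
      intro i
      have e1 : gramPower d (Λ.block i) = (d - Λ.numExt i - 2) / 2 := by
        rw [gramPower, Λ.finrank_block]
        push_cast
        ring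
      have e2 : (-(d - Λ.numExt i - 1) / 2) = -gramPower d (Λ.V i) := by
        rw [gramPower, LoopByLoop.numExt]
        ring
      rw [← e1, e2, hb, hΛ, Finsupp.single_neg, ← sub_eq_add_neg]
    rw [LoopByLoop.rep, Finset.sum_congr rfl fun i _ => hG i,
      Fin.sum_univ_eq_sum_range (fun n => G n - G (n + 1)), Finset.sum_range_sub']
    have g0 : G 0 = Finsupp.single ⊤ (gramPower d (⊤ : Submodule ℝ (Mom L E))) := by simp only [G, htop]
    have gL : G L = Finsupp.single (ext L E) (gramPower d (ext L E)) := by simp only [G, upper_last]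
    rw [g0, gL, gramPower, gramPower, finrank_top_mom, finrank_ext, standardRep, neg_div,
      Finsupp.single_neg, ← sub_eq_add_neg]
    push_cast
    rfl
  · change (Finset.univ.image F.x).card = _
    rw [Finset.card_image_of_injective _ F.indep.injective, Finset.card_univ, Fintype.card_fin,
      Finset.sum_congr rfl fun i _ => by rw [hnum i],
      Fin.sum_univ_eq_sum_range (fun n => E + (L - (n + 1)) + 1), sum_loops]
  · change LinearIndepOn ℝ id (↑(Finset.univ.image F.x) : Set (Module.Dual ℝ (Dir L E)))
    rw [Finset.coe_image, Finset.coe_univ, Set.image_univ]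
    exact F.indep.linearIndepOn_id
  · change Submodule.span ℝ (↑(Finset.univ.image F.x) : Set (Module.Dual ℝ (Dir L E))) = _
    rw [Finset.coe_image, Finset.coe_univ, Set.image_univ, span_range_x]
    have : Λ.fixing = ⊥ := by
      rw [eq_bot_iff]
      intro δ hδ
      have h0 := hδ ⟨0, hL⟩
      rw [hb] at h0
      change VanishesOn _ (upper Λ.l 0) at h0
      rw [htop] at h0
      rw [Submodule.mem_bot]
      ext i j
      have := h0 (Pi.single i 1) trivial (Pi.single j 1) trivial
      simpa [sp] using this
    rw [this, Submodule.dualAnnihilator_bot]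

end

/-! ### Shrinking the external momenta of a loop -/

/-- The change of the scalar products given by a symmetrized product of functionals. -/
def symmProd (φ ψ : Module.Dual ℝ (Mom L E)) : GramMat L E :=
  Matrix.of fun i j => φ (Pi.single i 1) * ψ (Pi.single j 1) + ψ (Pi.single i 1) * φ (Pi.single j 1)

theorem sp_symmProd (φ ψ : Module.Dual ℝ (Mom L E)) (v w : Mom L E) :
    sp (symmProd φ ψ) v w = φ v * ψ w + ψ v * φ w := by
  have h : ∀ (f : Module.Dual ℝ (Mom L E)) (x : Mom L E),
      f x = ∑ i, x i * f (Pi.single i 1) := by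
    intro f x
    conv_lhs => rw [← Finset.univ_sum_single x]
    rw [map_sum]
    refine Finset.sum_congr rfl fun i _ => ?_
    rw [show (Pi.single i (x i) : Mom L E) = x i • Pi.single i 1 by
      rw [← Pi.single_smul, smul_eq_mul, mul_one], map_smul, smul_eq_mul]
  simp only [sp, dotProduct, Matrix.mulVec, symmProd, Matrix.of_apply]
  rw [h φ v, h ψ w, h ψ v, h φ w, Finset.sum_mul_sum, Finset.sum_mul_sum, ← Finset.sum_add_distrib]
  refine Finset.sum_congr rfl fun i _ => ?_
  rw [Finset.mul_sum, ← Finset.sum_add_distrib]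
  refine Finset.sum_congr rfl fun j _ => ?_
  ring

theorem symmProd_mem_dir {φ : Module.Dual ℝ (Mom L E)} (ψ : Module.Dual ℝ (Mom L E))
    (hφ : ext L E ≤ LinearMap.ker φ) : symmProd φ ψ ∈ Dir L E := by
  refine ⟨?_, fun i j => ?_⟩
  · ext i j
    simp only [symmProd, Matrix.transpose_apply, Matrix.of_apply]
    ring
  · have h : ∀ i : Fin E, φ (Pi.single (Sum.inr i) 1) = 0 := fun i =>
      hφ (mem_ext.2 fun k => by simp)
    simp [symmProd, h]

theorem vanishesOn_symmProd_left {φ ψ : Module.Dual ℝ (Mom L E)} {U : Submodule ℝ (Mom L E)}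
    (h : U ≤ LinearMap.ker φ) : VanishesOn (symmProd φ ψ) U := by
  intro v hv w hw
  have e1 : φ v = 0 := h hv
  have e2 : φ w = 0 := h hw
  rw [sp_symmProd, e1, e2]
  ring

theorem vanishesOn_symmProd_right {φ ψ : Module.Dual ℝ (Mom L E)} {U : Submodule ℝ (Mom L E)}
    (h : U ≤ LinearMap.ker ψ) : VanishesOn (symmProd φ ψ) U := by
  intro v hv w hw
  have e1 : ψ v = 0 := h hv
  have e2 : ψ w = 0 := h hw
  rw [sp_symmProd, e1, e2]
  ring

/-- Beyond the scalar products within the two smaller spaces, only the one of `a` with `b` is left.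
This is why one variable is lost per shrinking step. -/
theorem VanishesOn.of_corner {δ : GramMat L E} (hδ : δ.IsSymm) {a b : Mom L E}
    {R : Submodule ℝ (Mom L E)} (ha : VanishesOn δ (Submodule.span ℝ {a} ⊔ R))
    (hb : VanishesOn δ (Submodule.span ℝ {b} ⊔ R)) (hab : sp δ a b = 0) :
    VanishesOn δ (Submodule.span ℝ {a} ⊔ (Submodule.span ℝ {b} ⊔ R)) := by
  have ma : a ∈ Submodule.span ℝ {a} ⊔ R :=
    Submodule.mem_sup_left (Submodule.mem_span_singleton_self a)
  intro v hv w hw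
  obtain ⟨v₁, hv₁, v₂, hv₂, rfl⟩ := Submodule.mem_sup.1 hv
  obtain ⟨w₁, hw₁, w₂, hw₂, rfl⟩ := Submodule.mem_sup.1 hw
  obtain ⟨c, rfl⟩ := Submodule.mem_span_singleton.1 hv₁
  obtain ⟨c', rfl⟩ := Submodule.mem_span_singleton.1 hw₁
  have haB : ∀ x ∈ Submodule.span ℝ {b} ⊔ R, sp δ a x = 0 := by
    intro x hx
    obtain ⟨x₁, hx₁, x₂, hx₂, rfl⟩ := Submodule.mem_sup.1 hx
    obtain ⟨c, rfl⟩ := Submodule.mem_span_singleton.1 hx₁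
    rw [sp_add_right, sp_smul_right, hab, ha a ma x₂ (Submodule.mem_sup_right hx₂)]
    ring
  have hBa : ∀ x ∈ Submodule.span ℝ {b} ⊔ R, sp δ x a = 0 := fun x hx => by
    rw [sp_comm hδ, haB x hx]
  simp only [sp_add_left, sp_add_right, sp_smul_left, sp_smul_right, ha a ma a ma, haB w₂ hw₂,
    hBa v₂ hv₂, hb v₂ hv₂ w₂ hw₂]
  ring

/-! ### Baikov variables adapted to the direction of integration -/

section

variable {V : Type*} [AddCommGroup V] [Module ℝ V] [FiniteDimensional ℝ V]

open Classical in
/-- A basis of the functionals that vanish on a space, adapted to a larger space. -/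
theorem exists_adapted_dual_basis {N N' : Submodule ℝ V} {δ : V} (hN : N' = N ⊔ Submodule.span ℝ {δ})
    (hδ : δ ∉ N) {s : Set (Module.Dual ℝ V)} (hs : LinearIndepOn ℝ id s)
    (hsN : ∀ f ∈ s, f ∈ N'.dualAnnihilator) :
    ∃ (b : Finset (Module.Dual ℝ V)) (z : Module.Dual ℝ V), s ⊆ b ∧ z ∉ b ∧ z δ = 1 ∧
      (∀ f ∈ b, f δ = 0) ∧ LinearIndepOn ℝ id (b : Set (Module.Dual ℝ V)) ∧
      Submodule.span ℝ (b : Set (Module.Dual ℝ V)) = N'.dualAnnihilator ∧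
      LinearIndepOn ℝ id ((insert z b : Finset (Module.Dual ℝ V)) : Set (Module.Dual ℝ V)) ∧
      Submodule.span ℝ ((insert z b : Finset (Module.Dual ℝ V)) : Set (Module.Dual ℝ V))
        = N.dualAnnihilator := by
  obtain ⟨b, hbt, hsb, hspan, hli⟩ := exists_linearIndepOn_extension hs
    (t := (N'.dualAnnihilator : Set (Module.Dual ℝ V))) hsN
  rw [Set.image_id, Set.image_id] at hspan
  have hfin : b.Finite := LinearIndependent.setFinite hli
  obtain ⟨b, rfl⟩ := hfin.exists_finset_coe
  have hbspan : Submodule.span ℝ (b : Set (Module.Dual ℝ V)) = N'.dualAnnihilator :=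
    le_antisymm (Submodule.span_le.2 hbt) hspan
  have hmem : δ ∈ N' := by
    rw [hN]
    exact Submodule.mem_sup_right (Submodule.mem_span_singleton_self δ)
  have hle : N ≤ N' := hN ▸ le_sup_left
  have hkill : ∀ f ∈ N'.dualAnnihilator, f δ = 0 := fun f hf =>
    (Submodule.mem_dualAnnihilator f).1 hf δ hmem
  obtain ⟨f, hf, hfN⟩ := Submodule.exists_le_ker_of_notMem hδ
  let z : Module.Dual ℝ V := (f δ)⁻¹ • f
  have hz1 : z δ = 1 := by simp [z, hf]
  have hzN : z ∈ N.dualAnnihilator := by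
    rw [Submodule.mem_dualAnnihilator]
    intro w hw
    have : f w = 0 := hfN hw
    simp [z, this]
  have hznot : z ∉ Submodule.span ℝ (b : Set (Module.Dual ℝ V)) := by
    rw [hbspan]
    intro h
    rw [hkill z h] at hz1
    exact zero_ne_one hz1
  refine ⟨b, z, hsb, fun h => hznot (Submodule.subset_span h), hz1, fun f hf => hkill f (hbt hf),
    hli, hbspan, ?_, ?_⟩
  · rw [Finset.coe_insert]
    exact LinearIndepOn.id_insert hli hznot
  · rw [Finset.coe_insert, Submodule.span_insert, hbspan]
    refine le_antisymm (sup_le ?_ (Submodule.dualAnnihilator_anti hle)) fun g hg => ?_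
    · rwa [Submodule.span_singleton_le_iff_mem]
    -- Subtracting its value on `δ` times `z` makes a functional that vanishes on `N` vanish on all
    -- of `N'`.
    · have h1 : g - g δ • z ∈ N'.dualAnnihilator := by
        rw [Submodule.mem_dualAnnihilator]
        intro w hw
        rw [hN] at hw
        obtain ⟨w₁, hw₁, w₂, hw₂, rfl⟩ := Submodule.mem_sup.1 hw
        obtain ⟨c, rfl⟩ := Submodule.mem_span_singleton.1 hw₂
        have e1 : g w₁ = 0 := (Submodule.mem_dualAnnihilator g).1 hg w₁ hw₁
        have e2 : z w₁ = 0 := (Submodule.mem_dualAnnihilator z).1 hzN w₁ hw₁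
        simp [e1, e2, hz1, mul_comm]
      rw [show g = g δ • z + (g - g δ • z) by abel]
      exact Submodule.add_mem_sup (Submodule.smul_mem _ _ (Submodule.mem_span_singleton_self z)) h1

end

/-! ### One shrinking step in the tree -/

section

variable {F : IntegralFamily L E} {S : Finset (Fin (L * (L + 1) / 2 + L * E))}

open Classical in
/-- Integrating out a variable at a node with prescribed functions of the scalar products. -/
theorem Reachable.exists_integrate {d : ℂ} {ν : Node L E} (hν : Reachable F d ν)
    {N N' : Submodule ℝ (Dir L E)} {δ : Dir L E} (hN : N' = N ⊔ Submodule.span ℝ {δ}) (hδ : δ ∉ N)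
    (hvars : LinearIndepOn ℝ id (ν.vars : Set (Module.Dual ℝ (Dir L E))))
    (hspan : Submodule.span ℝ (ν.vars : Set (Module.Dual ℝ (Dir L E))) = N.dualAnnihilator)
    (hprops : ∀ a ∈ ν.sector, F.x a ∈ N'.dualAnnihilator)
    {W : Submodule ℝ (Mom L E)} (hW : W ∈ ν.rep.support)
    (absent : ∀ W' ∈ ν.rep.support, W' ≠ W → IsAbsent (δ : GramMat L E) W')
    {m : ℕ} {e : Fin (m + 2) → Mom L E} (h : IsCornerFrame (δ : GramMat L E) W e) :
    ∃ b : Finset (Module.Dual ℝ (Dir L E)),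
      Reachable F d ⟨ν.sector, b, replaceGram ν.rep W e⟩ ∧ b.card + 1 = ν.vars.card ∧
      LinearIndepOn ℝ id (b : Set (Module.Dual ℝ (Dir L E))) ∧
      Submodule.span ℝ (b : Set (Module.Dual ℝ (Dir L E))) = N'.dualAnnihilator := by
  have hs : LinearIndepOn ℝ id (F.x '' (ν.sector : Set _)) :=
    F.indep.linearIndepOn_id.mono (Set.image_subset_range _ _)
  obtain ⟨b, z, hsb, hzb, hz, hbδ, hbli, hbspan, hili, hispan⟩ :=
    exists_adapted_dual_basis hN hδ hs (by rintro _ ⟨a, ha, rfl⟩; exact hprops a ha)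
  have hx : ∀ a ∈ ν.sector, F.x a ∈ b := fun a ha => hsb ⟨a, ha, rfl⟩
  have hr : Reachable F d ⟨ν.sector, insert z b, ν.rep⟩ :=
    hν.tail (Step.redefine ν _ (fun a ha => Finset.mem_insert_of_mem (hx a ha)) hili
      (hispan.trans hspan.symm))
  have hstep := Step.integrate (F := F) ⟨ν.sector, insert z b, ν.rep⟩ z
    (Finset.mem_insert_self z b) (fun a ha h => hzb (h ▸ hx a ha)) δ
    ⟨hz, fun y hy hne => hbδ y ((Finset.mem_insert.1 hy).resolve_left hne)⟩ W hW
    h.isQuadratic absent m e h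
  refine ⟨b, ?_, ?_, hbli, hbspan⟩
  · have h0 : Reachable F d ⟨ν.sector, (insert z b).erase z, replaceGram ν.rep W e⟩ := hr.tail hstep
    rwa [Finset.erase_insert hzb] at h0
  -- Old and redefined variables are both independent with the same span, hence equally many.
  · rw [← Finset.card_insert_of_notMem hzb, ← finrank_span_finset_eq_card hili, hispan, ← hspan,
      finrank_span_finset_eq_card hvars]

theorem erase_single_add {W : Submodule ℝ (Mom L E)} {γ : ℂ} {σ : Rep L E} (h : σ W = 0) :
    (Finsupp.single W γ + σ).erase W = σ := by
  rw [Finsupp.erase_add, Finsupp.erase_single, zero_add,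
    Finsupp.erase_of_notMem_support (Finsupp.notMem_support_iff.2 h)]

theorem LoopByLoop.vanishesOn_V (Λ : LoopByLoop F S) {δ : Dir L E} (i : Fin L)
    (h : ∀ j, i < j → VanishesOn (δ : GramMat L E) (Λ.block j)) :
    VanishesOn (δ : GramMat L E) (Λ.V i) := by
  rcases Λ.V_le_ext_or i with h' | ⟨k, hk, h'⟩
  · exact (Dir.vanishesOn_ext δ).mono h'
  · exact (h k hk).mono h'

-- The corner frame of `block i` has ends `l i` and `u` and interior the smaller space `Λ'.V i`. The
-- hyperplane containing `l i` is the new block, and the one containing `u` is the old `V i`, whose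
-- new factor cancels its old one.
open Classical in
theorem LoopByLoop.Reached.shrink {d : ℂ} (hd : ∀ k : ℤ, d ≠ k) {Λ Λ' : LoopByLoop F S}
    (hΛ : Λ.Reached d) (hl : Λ'.l = Λ.l) (i : Fin L) (hV : ∀ j, j ≠ i → Λ'.V j = Λ.V j)
    {u : Mom L E} (huV : u ∉ Λ'.V i) (hVi : Λ.V i = Submodule.span ℝ {u} ⊔ Λ'.V i) :
    Λ'.Reached d := by
  obtain ⟨ν, hν, hsec, hrep, hcard, hli, hspan⟩ := hΛ
  have hb : ∀ j, j ≠ i → Λ'.block j = Λ.block j := fun j hj => by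
    rw [LoopByLoop.block, LoopByLoop.block, hl, hV j hj]
  have hbi : Λ.block i = Submodule.span ℝ {Λ'.l i} ⊔ (Submodule.span ℝ {u} ⊔ Λ'.V i) := by
    rw [LoopByLoop.block, hVi, hl]
  have huVi : u ∈ Λ.V i := by
    rw [hVi]
    exact Submodule.mem_sup_left (Submodule.mem_span_singleton_self u)
  have hup : Λ.V i ≤ upper Λ'.l (i + 1) := hl ▸ Λ.V_le_upper i
  obtain ⟨φ, ψ, h1, h2, h3, h4, h5⟩ := Λ'.exists_functionals i (hup huVi) huV
  let δ : Dir L E := ⟨symmProd φ ψ, symmProd_mem_dir ψ ((ext_le_upper _ _).trans h2)⟩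
  have hδ : (δ : GramMat L E) = symmProd φ ψ := rfl
  have hψl : ψ (Λ'.l i) = 0 := h4 (Λ'.l_mem_block i)
  have hφu : φ u = 0 := h2 (hup huVi)
  have hφR : ∀ r ∈ Λ'.V i, φ r = 0 := fun r hr => h2 (Λ'.V_le_upper i hr)
  have hψR : ∀ r ∈ Λ'.V i, ψ r = 0 := fun r hr => h4 (Λ'.le_block i hr)
  have hcorner : sp (δ : GramMat L E) (Λ'.l i) u = 1 := by
    rw [hδ, sp_symmProd, h1, h3, hψl, hφu]
    ring
  obtain ⟨m, e, he, hX, h1X, hXn⟩ := exists_cornerFrame (Dir.isSymm δ) (R := Λ'.V i)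
    (a := Λ'.l i) (b := u)
    (by rw [hδ, sp_symmProd, hψl]; ring) (by rw [hδ, sp_symmProd, hφu]; ring) hcorner
    (fun r hr => by rw [hδ, sp_symmProd, hψR r hr, hφR r hr]; ring)
    (fun r hr => by rw [hδ, sp_symmProd, hψR r hr, hφR r hr]; ring)
    (vanishesOn_symmProd_left ((Λ'.V_le_upper i).trans h2))
  rw [← hbi] at he
  rw [← hVi] at hXn
  have h1X : Submodule.span ℝ (Set.range (frame1X e)) = Λ'.block i := h1X
  have hvb : ∀ j, VanishesOn (δ : GramMat L E) (Λ'.block j) := by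
    intro j
    by_cases hj : j = i
    · exact hj ▸ vanishesOn_symmProd_right h4
    · rcases h5 j hj with h | h
      · exact vanishesOn_symmProd_left h
      · exact vanishesOn_symmProd_right h
  have hvVi : VanishesOn (δ : GramMat L E) (Λ.V i) := vanishesOn_symmProd_left (hup.trans h2)
  -- the representation
  let rest : Rep L E := ∑ j ∈ Finset.univ.erase i,
    (Finsupp.single (Λ.block j) ((d - Λ.numExt j - 2) / 2)
      + Finsupp.single (Λ.V j) (-(d - Λ.numExt j - 1) / 2))
  have hrest' : rest = ∑ j ∈ Finset.univ.erase i,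
    (Finsupp.single (Λ'.block j) ((d - Λ'.numExt j - 2) / 2)
      + Finsupp.single (Λ'.V j) (-(d - Λ'.numExt j - 1) / 2)) := by
    refine Finset.sum_congr rfl fun j hj => ?_
    have hj := Finset.ne_of_mem_erase hj
    rw [hb j hj, LoopByLoop.numExt, LoopByLoop.numExt, hV j hj]
  let γ : ℂ := (d - Λ.numExt i - 2) / 2
  let σ : Rep L E := Finsupp.single (Λ.V i) (-(d - Λ.numExt i - 1) / 2) + rest
  have hνrep : ν.rep = Finsupp.single (Λ.block i) γ + σ := by
    rw [hrep, LoopByLoop.rep, ← Finset.add_sum_erase _ _ (Finset.mem_univ i), add_assoc]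
  have hrestv : ∀ W', rest W' ≠ 0 → VanishesOn (δ : GramMat L E) W' := by
    intro W' hW'
    rw [Finsupp.finsetSum_apply] at hW'
    obtain ⟨j, hj, hne⟩ := Finset.exists_ne_zero_of_sum_ne_zero hW'
    have hj := Finset.ne_of_mem_erase hj
    rw [Finsupp.add_apply] at hne
    by_cases c1 : Λ.block j = W'
    · rw [← c1, ← hb j hj]
      exact hvb j
    · by_cases c2 : Λ.V j = W'
      · rw [← c2, ← hV j hj]
        exact (hvb j).mono (Λ'.le_block j)
      · rw [Finsupp.single_eq_of_ne' c1, Finsupp.single_eq_of_ne' c2, add_zero] at hne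
        exact absurd rfl hne
  have hσv : ∀ W', σ W' ≠ 0 → VanishesOn (δ : GramMat L E) W' := by
    intro W' hW'
    by_cases c : Λ.V i = W'
    · exact c ▸ hvVi
    · rw [Finsupp.add_apply, Finsupp.single_eq_of_ne' c, zero_add] at hW'
      exact hrestv W' hW'
  -- `δ` vanishes on every space occurring in `σ`, but not on this block, so nothing is added to its
  -- power.
  have hσW : σ (Λ.block i) = 0 := by
    by_contra h
    exact he.not_vanishesOn (hσv _ h)
  have hνW : ν.rep (Λ.block i) = γ := by
    rw [hνrep, Finsupp.add_apply, hσW, Finsupp.single_eq_same, add_zero]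
  have hγ : γ ≠ 0 := by
    have := gramPower_ne_zero hd (Λ.block i)
    rw [gramPower, Λ.finrank_block] at this
    convert this using 2
    push_cast
    ring
  have hsupp : Λ.block i ∈ ν.rep.support := by
    rw [Finsupp.mem_support_iff, hνW]
    exact hγ
  have habs : ∀ W' ∈ ν.rep.support, W' ≠ Λ.block i → IsAbsent (δ : GramMat L E) W' := by
    intro W' hW' hne
    rw [Finsupp.mem_support_iff, hνrep, Finsupp.add_apply, Finsupp.single_eq_of_ne hne,
      zero_add] at hW'
    exact (hσv W' hW').isAbsent
  have hnum : Λ.numExt i = Λ'.numExt i + 1 := by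
    rw [LoopByLoop.numExt, hVi, finrank_span_sup huV, LoopByLoop.numExt]
  have hnum' : ∀ j, j ≠ i → Λ.numExt j = Λ'.numExt j := fun j hj => by
    rw [LoopByLoop.numExt, LoopByLoop.numExt, hV j hj]
  have hrepl : replaceGram ν.rep (Λ.block i) e = Λ'.rep d := by
    rw [replaceGram, hνW, hνrep, erase_single_add hσW, hX, h1X, hXn, LoopByLoop.rep,
      ← Finset.add_sum_erase _ _ (Finset.mem_univ i), ← hrest']
    have e1 : γ + 1 / 2 = (d - Λ'.numExt i - 2) / 2 := by
      simp only [γ, hnum]; push_cast; ring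
    have e2 : -1 - γ = -(d - Λ'.numExt i - 1) / 2 := by
      simp only [γ, hnum]; push_cast; ring
    -- The old power of `G(V i)` is the opposite of the power `γ + 1 / 2` created by the
    -- integration.
    have e3 : -(d - Λ.numExt i - 1) / 2 = -(γ + 1 / 2) := by
      simp only [γ]; ring
    have e4 : σ = rest - Finsupp.single (Λ.V i) (γ + 1 / 2) := by
      simp only [σ, e3, Finsupp.single_neg]
      abel
    rw [e4, e2, ← e1]
    abel
  -- the variables
  have hδN : δ ∉ Λ.fixing := fun h => he.not_vanishesOn (h i)
  have hNle : Λ.fixing ≤ Λ'.fixing := by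
    intro η hη j
    by_cases hj : j = i
    · subst hj
      refine (hη j).mono ?_
      rw [hbi, LoopByLoop.block]
      exact sup_le_sup_left le_sup_right _
    · rw [hb j hj]
      exact hη j
  have hN : Λ'.fixing = Λ.fixing ⊔ Submodule.span ℝ {δ} := by
    refine le_antisymm (fun η hη => ?_) (sup_le hNle ?_)
    -- Subtracting `c • δ` removes the scalar product of `l i` with `u`, the only one in the old
    -- blocks that `Λ'.fixing` does not control.
    · let c := sp (η : GramMat L E) (Λ'.l i) u
      have hmem : η + (-c) • δ ∈ Λ'.fixing :=
        Submodule.add_mem _ hη (Submodule.smul_mem _ _ hvb)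
      have hmem' : η + (-c) • δ ∈ Λ.fixing := by
        intro j
        by_cases hj : j = i
        · subst hj
          rw [hbi]
          refine VanishesOn.of_corner (Dir.isSymm _) (hmem j) ?_ ?_
          · rw [← hVi]
            exact Λ.vanishesOn_V j fun k hk => hb k hk.ne' ▸ hmem k
          · change sp ((η : GramMat L E) + (-c) • (δ : GramMat L E)) _ _ = 0
            rw [sp_add_smul, hcorner]
            ring
        · rw [← hb j hj]
          exact hmem j
      rw [show η = (η + (-c) • δ) + c • δ by module]
      exact Submodule.add_mem_sup hmem'
        (Submodule.smul_mem _ _ (Submodule.mem_span_singleton_self δ))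
    · rw [Submodule.span_singleton_le_iff_mem]
      exact hvb
  obtain ⟨b, hr, hc, hbli, hbspan⟩ := hν.exists_integrate hN hδN hli hspan (by
    intro a ha
    rw [hsec] at ha
    obtain ⟨j, hj⟩ := Λ'.props a ha
    rw [Submodule.mem_dualAnnihilator]
    exact fun η hη => hj η (hη j)) hsupp habs he
  refine ⟨_, hr, hsec, hrepl, ?_, hbli, hbspan⟩
  change b.card = _
  rw [hcard, ← Finset.add_sum_erase _ _ (Finset.mem_univ i), hnum,
    Finset.sum_congr rfl fun j hj => by rw [hnum' j (Finset.ne_of_mem_erase hj)]] at hc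
  rw [← Finset.add_sum_erase _ _ (Finset.mem_univ i)]
  omega

/-! ### All loop-by-loop representations are reached -/

theorem LoopByLoop.Reached.congr {d : ℂ} {Λ Λ' : LoopByLoop F S} (h : Λ.Reached d)
    (hl : Λ.l = Λ'.l) (hV : Λ.V = Λ'.V) : Λ'.Reached d := by
  obtain ⟨l, V, _, _, _, _⟩ := Λ
  obtain ⟨l', V', _, _, _, _⟩ := Λ'
  obtain rfl : l = l' := hl
  obtain rfl : V = V' := hV
  exact h

/-- The spaces of external momenta: final before the `i`-th loop, `U` for it and maximal after it. -/
def LoopByLoop.mixV (Λ : LoopByLoop F S) (i : Fin L) (U : Submodule ℝ (Mom L E)) (j : Fin L) :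
    Submodule ℝ (Mom L E) :=
  if j < i then Λ.V j else if j = i then U else upper Λ.l (j + 1)

theorem LoopByLoop.le_mixV (Λ : LoopByLoop F S) {i : Fin L} {U : Submodule ℝ (Mom L E)}
    (hU : Λ.V i ≤ U) (j : Fin L) : Λ.V j ≤ Λ.mixV i U j := by
  unfold LoopByLoop.mixV
  split_ifs with h1 h2
  · exact le_rfl
  · exact h2 ▸ hU
  · exact Λ.V_le_upper j

/-- An intermediate stage between the standard and a loop-by-loop representation. -/
def LoopByLoop.mix (Λ : LoopByLoop F S) (i : Fin L) (U : Submodule ℝ (Mom L E)) (hU : Λ.V i ≤ U)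
    (hU' : U ≤ upper Λ.l (i + 1)) : LoopByLoop F S where
  l := Λ.l
  V := Λ.mixV i U
  span_eq := Λ.span_eq
  V_le j := by
    change _ ≤ upper Λ.l (j + 1)
    unfold LoopByLoop.mixV
    split_ifs with h1 h2
    · exact Λ.V_le_upper j
    · exact h2 ▸ hU'
    · exact le_rfl
  -- After loop `i` the spaces are maximal and contain whatever is needed. Otherwise `j < i`, so `V
  -- j` is already final and condition `seen` of `Λ` carries over, since the blocks of the stage are
  -- larger.
  seen j k hjk h1 h2 := by
    by_cases hk : i < k
    · have e : Λ.mixV i U k = upper Λ.l (k + 1) := by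
        rw [LoopByLoop.mixV, if_neg hk.not_gt, if_neg hk.ne']
      rw [e, span_sup_upper_succ]
      exact h1
    · have hji : j < i := hjk.trans_le (not_lt.1 hk)
      have e : Λ.mixV i U j = Λ.V j := by rw [LoopByLoop.mixV, if_pos hji]
      rw [e] at h1 h2 ⊢
      exact (Λ.seen j k hjk h1 h2).trans (sup_le_sup_left (Λ.le_mixV hU k) _)
  props a ha := by
    obtain ⟨k, hk⟩ := Λ.props a ha
    exact ⟨k, fun δ hδ => hk δ (hδ.mono (sup_le_sup_left (Λ.le_mixV hU k) _))⟩

/-- Induction on a bound `n` for the codimension of `U` in the maximal space: one vector is added to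
`U`, the larger stage is reached by induction, and `LoopByLoop.Reached.shrink` removes the vector.
-/
theorem LoopByLoop.reached_mix_of_reached {d : ℂ} (hd : ∀ k : ℤ, d ≠ k) (Λ : LoopByLoop F S)
    (i : Fin L) (h : (Λ.mix i (upper Λ.l (i + 1)) (Λ.V_le_upper i) le_rfl).Reached d)
    (n : ℕ) : ∀ (U : Submodule ℝ (Mom L E)) (hU : Λ.V i ≤ U) (hU' : U ≤ upper Λ.l (i + 1)),
      Module.finrank ℝ (upper Λ.l (i + 1)) ≤ Module.finrank ℝ U + n →
      (Λ.mix i U hU hU').Reached d := by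
  induction n with
  | zero =>
    intro U hU hU' hn
    obtain rfl := Submodule.eq_of_le_of_finrank_le hU' hn
    exact h
  | succ n ih =>
    intro U hU hU' hn
    rcases hU'.eq_or_lt with rfl | hlt
    · exact h
    obtain ⟨u, hu, huU⟩ := SetLike.exists_of_lt hlt
    have hle : Submodule.span ℝ {u} ⊔ U ≤ upper Λ.l (i + 1) :=
      sup_le ((Submodule.span_singleton_le_iff_mem _ _).2 hu) hU'
    have hr := ih (Submodule.span ℝ {u} ⊔ U) (hU.trans le_sup_right) hle
      (by rw [finrank_span_sup huU]; omega)
    have hi : ∀ U', Λ.mixV i U' i = U' := fun U' => by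
      rw [LoopByLoop.mixV, if_neg (lt_irrefl i), if_pos rfl]
    refine hr.shrink hd rfl i (fun j hj => ?_) (u := u) ?_ ?_
    · change Λ.mixV i U j = Λ.mixV i _ j
      simp only [LoopByLoop.mixV, if_neg hj]
    · change u ∉ Λ.mixV i U i
      rwa [hi]
    · change Λ.mixV i _ i = _ ⊔ Λ.mixV i U i
      rw [hi, hi]

/-- The stage at which loop `n` is final is the stage at which loop `n + 1` is still maximal, so the
shrinkings of successive loops can be concatenated. -/
theorem LoopByLoop.reached_mix (hL : 1 ≤ L) {d : ℂ} (hd : ∀ k : ℤ, d ≠ k) (hS : S ⊆ F.top)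
    (Λ : LoopByLoop F S) (n : ℕ) : ∀ (hn : n < L) (U : Submodule ℝ (Mom L E))
      (hU : Λ.V ⟨n, hn⟩ ≤ U) (hU' : U ≤ upper Λ.l (n + 1)), (Λ.mix ⟨n, hn⟩ U hU hU').Reached d := by
  induction n with
  | zero =>
    intro hn U hU hU'
    refine Λ.reached_mix_of_reached hd ⟨0, hn⟩ ?_ _ U hU hU' le_add_self
    refine LoopByLoop.reached_of_V_eq_upper hL hS _ fun j => ?_
    change Λ.mixV ⟨0, hn⟩ (upper Λ.l (0 + 1)) j = upper Λ.l (j + 1)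
    unfold LoopByLoop.mixV
    split_ifs with h1 h2
    · exact absurd h1 (Nat.not_lt_zero _)
    · rw [h2]
    · rfl
  | succ n ih =>
    intro hn U hU hU'
    refine Λ.reached_mix_of_reached hd ⟨n + 1, hn⟩ ?_ _ U hU hU' le_add_self
    refine (ih (by omega) (Λ.V ⟨n, by omega⟩) le_rfl (Λ.V_le_upper _)).congr rfl (funext fun j => ?_)
    change Λ.mixV _ _ j = Λ.mixV _ _ j
    simp only [LoopByLoop.mixV, Fin.lt_def, Fin.ext_iff]
    by_cases c1 : (j : ℕ) < n
    · rw [if_pos c1, if_pos (by omega)]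
    by_cases c2 : (j : ℕ) = n
    · rw [if_neg c1, if_pos c2, if_pos (by omega)]
      congr 1
      exact Fin.ext c2.symm
    rw [if_neg c1, if_neg c2, if_neg (by omega)]
    split_ifs with c3
    · rw [c3]
    · rfl

theorem LoopByLoop.reached (hL : 1 ≤ L) {d : ℂ} (hd : ∀ k : ℤ, d ≠ k) (hS : S ⊆ F.top)
    (Λ : LoopByLoop F S) : Λ.Reached d := by
  refine (Λ.reached_mix hL hd hS (L - 1) (by omega) (Λ.V ⟨L - 1, by omega⟩) le_rfl
    (Λ.V_le_upper _)).congr rfl (funext fun j => ?_)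
  change Λ.mixV _ _ j = Λ.V j
  simp only [LoopByLoop.mixV, Fin.lt_def, Fin.ext_iff]
  have := j.2
  split_ifs with c1 c2
  · rfl
  · congr 1
    exact Fin.ext c2.symm
  · omega

end

end Baikov
end

open Classical in
theorem mainTheorem1 (L E : ℕ) (hL : 1 ≤ L) (F : Baikov.IntegralFamily L E)
    (d : ℂ) (hd : ∀ k : ℤ, d ≠ k) :
    -- Integrating out a quadratic variable, at any node of the tree.
    (∀ ν : Baikov.Node L E, Baikov.Reachable F d ν →
      ∀ z ∈ ν.vars, (∀ a ∈ ν.sector, F.x a ≠ z) →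
      ∀ δ : Baikov.Dir L E, Baikov.IsDualDirection ν.vars z δ →
      ∀ W ∈ ν.rep.support, Baikov.IsQuadratic (δ : Baikov.GramMat L E) W →
      (∀ W' ∈ ν.rep.support, W' ≠ W → Baikov.IsAbsent (δ : Baikov.GramMat L E) W') →
      -- The variable can be brought to the corners of the Gram matrix ...
      (∃ (m : ℕ) (e : Fin (m + 2) → Baikov.Mom L E),
        Baikov.IsCornerFrame (δ : Baikov.GramMat L E) W e) ∧
      ∀ (m : ℕ) (e : Fin (m + 2) → Baikov.Mom L E),
        Baikov.IsCornerFrame (δ : Baikov.GramMat L E) W e →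
        Baikov.Step F ν ⟨ν.sector, ν.vars.erase z, Baikov.replaceGram ν.rep W e⟩ ∧
        -- ... the leading coefficient and the discriminant are given by the three Gram minors ...
        (∀ M : Baikov.GramMat L E, M.IsSymm → ∃ B C : ℝ,
          (∀ t : ℝ, Baikov.gramDet e (M + t • (δ : Baikov.GramMat L E))
            = -(Baikov.gramDet (Baikov.frameX e) M * t ^ 2 + B * t + C)) ∧
          B ^ 2 - 4 * Baikov.gramDet (Baikov.frameX e) M * C
            = 4 * Baikov.gramDet (Baikov.frame1X e) M * Baikov.gramDet (Baikov.frameXn e) M) ∧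
        -- ... and integration between the roots gives the representation with these three minors.
        (-1 < (ν.rep W).re → ∃ κ : ℂ, κ ≠ 0 ∧
          ∀ M : Baikov.GramMat L E, M.PosDef → ∀ x₀ c₁ c₂ : ℝ, c₁ < c₂ →
            Baikov.gram W (M + (c₁ - x₀) • (δ : Baikov.GramMat L E)) = 0 →
            Baikov.gram W (M + (c₂ - x₀) • (δ : Baikov.GramMat L E)) = 0 →
            ∀ n : ℕ, (n = 0 ∨ c₁ + c₂ ≠ 0) →
              ∫ x in c₁..c₂, (x : ℂ) ^ n *
                  Baikov.integrand ν.rep (M + (x - x₀) • (δ : Baikov.GramMat L E))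
                = κ * Baikov.integrand (Baikov.replaceGram ν.rep W e) M
                  * (((c₁ + c₂) / 2 : ℝ) : ℂ) ^ n
                  * ordinaryHypergeometric (-(n : ℂ) / 2) ((1 - (n : ℂ)) / 2) (3 / 2 + ν.rep W)
                      ((((c₁ - c₂) / (c₁ + c₂)) ^ 2 : ℝ) : ℂ))) ∧
    -- All loop-by-loop representations of all sectors are reached.
    (∀ S : Finset (Fin (L * (L + 1) / 2 + L * E)), S ⊆ F.top →
      ∀ Λ : Baikov.LoopByLoop F S, ∃ ν : Baikov.Node L E, Baikov.Reachable F d ν ∧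
        ν.sector = S ∧ ν.rep = Λ.rep d ∧
        ν.vars.card = ∑ i, (Λ.numExt i + 1) ∧
        ∀ y ∈ ν.vars, ∀ δ : Baikov.Dir L E,
          (∀ i, Baikov.VanishesOn (δ : Baikov.GramMat L E) (Λ.block i)) → y δ = 0) ∧
    -- No representation in the tree has more than `2 L - 1` polynomials in the Baikov variables.
    (∀ ν : Baikov.Node L E, Baikov.Reachable F d ν →
      {W : Submodule ℝ (Baikov.Mom L E) | ν.rep W ≠ 0 ∧ ¬ W ≤ Baikov.ext L E}.ncard
        ≤ 2 * L - 1) := by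
  refine ⟨fun ν _ z hz isp δ dual W hW hq absent => ⟨hq.exists_cornerFrame (Baikov.Dir.isSymm δ),
    fun m e he => ⟨Baikov.Step.integrate ν z hz isp δ dual W hW hq absent m e he,
      fun M hM => he.gramDet_quadratic hM, fun hγ => he.integral_eq hW absent hγ⟩⟩,
    fun S hS Λ => ?_, fun ν hν => hν.ncard_le hL hd⟩
  obtain ⟨ν, hν, hsec, hrep, hcard, -, hspan⟩ := Λ.reached hL hd hS
  refine ⟨ν, hν, hsec, hrep, hcard, fun y hy δ hδ => ?_⟩
  have hmem : y ∈ Λ.fixing.dualAnnihilator := hspan ▸ Submodule.subset_span hy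
  exact (Submodule.mem_dualAnnihilator y).1 hmem δ hδ
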